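/- **Model.** A unit square is named by its centre in $\mathbb{Z}^2$. A *polyomino tile* is a finite, nonempty, edge-connected set of unit squares together with glue labels on some of its boundary edges; every glue has a strength in $\mathbb{N}$. A set of translated tiles binds a further tile with strength equal to the sum of the strengths of the glues on those edges of the tile that abut an edge with the same glue. A *tile assembly system* (TAS) $\mathcal{T}=(T,\sigma,\tau)$ consists of a finite set $T$ of polyomino tiles, a temperature $\tau\ge 1$ and a finite nonempty seed $\sigma$ of pairwise non-overlapping integer translates of tiles in $T$ that is $\tau$-stable, i.e. every partition of $\sigma$ into two nonempty parts separates bound glues of total strength at least $\tau$. Starting from $\sigma$, translates of tiles of $T$ attach one at a time, each without overlapping earlier tiles and with binding strength at least $\tau$. An assembly is *producible* if it is the result of a finite sequence, or the limit of an infinite sequence, of such attachments; it is *terminal* if it is producible and no tile can attach to it. A *Turing machine* $M$ has a finite state set $Q$, a finite tape alphabet $\Gamma$ with a blank, a start state, and a partial transition function $\delta: Q\times\Gamma\rightharpoonup Q\times\Gamma\times\{L,R\}$; its tape is two-way infinite and it halts when $\delta$ is undefined. On input $w\in\Gamma^*$ it starts with $w$ on cells $0,\dots,|w|-1$, blanks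 elsewhere, and its head on cell $0$. The *content* of cell $i$ at time $t$ is the symbol in cell $i$ after $t$ steps, together with the state of $M$ if the head is on cell $i$ after $t$ steps. **Simulation.** Fix integers $c,h\ge 1$ and a partial function $D$ (the *decoding*) from sets of placed tiles to $\Gamma\times(Q\cup\{\text{no head}\})$. For an assembly $A$, $i\in\mathbb{Z}$ and $t\in\mathbb{N}$, let $A_{i,t}$ be the set of tiles of $A$ that meet the block $[ci,ci+c)\times[ht,ht+h)$, translated by $-(ci,ht)$. The system $\mathcal{T}$ *simulates $M$ on $w$* (with respect to $c,h,D$) if 1. for every producible $A$ and all $i,t$: if $D(A_{i,t})$ is defined, then $M$ on $w$ does not halt in fewer than $t$ steps, and $D(A_{i,t})$ is the content of cell $i$ at time $t$; 2. for every terminal $A$, every $t$ such that $M$ on $w$ does not halt in fewer than $t$ steps, and every $i$: $D(A_{i,t})$ is the content of cell $i$ at time $t$, or $D(A_{i,t})$ is undefined and cell $i$ at time $t$ is blank and does not carry the head; 3. there is a terminal assembly, and a terminal assembly is finite if and only if $M$ halts on $w$. **Lemma.** For every Turing machine $M$ there are a finite set $T$ of tiles, each of which is a horizontal ($2\times 1$)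 or vertical ($1\times 2$) domino, with glue strengths, integers $c,h\ge 1$, a decoding $D$, and finite sets of placed tiles $L$, $R$ and $B_a$ ($a\in\Gamma$), such that for every input $w=w_0\cdots w_{n-1}\in\Gamma^*$ $$\sigma_w \;=\; L\,\cup\,\bigcup_{k<n}\bigl(B_{w_k}+(ck,0)\bigr)\,\cup\,\bigl(R+(cn,0)\bigr)$$ is a seed for which $(T,\sigma_w,1)$ is a TAS that simulates $M$ on $w$ with respect to $c,h,D$. In particular, for every $M$ and $w$ there is a temperature-$1$ TAS consisting only of $2\times1$ and $1\times2$ dominoes that simulates $M$ on $w$. -/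

import Mathlib

/-! ### Turing machines -/

/-- A deterministic one-tape Turing machine with states `Q`, tape alphabet `Γ` and a tape that is
infinite in both directions. In one step the machine writes a symbol, changes its state and moves
its head by one cell; it halts when `δ` is undefined. -/
structure TuringMachine (Q Γ : Type*) where
  blank : Γ
  start : Q
  δ : Q → Γ → Option (Q × Γ × Turing.Dir)

namespace TuringMachine

/-- A configuration; tape cells have absolute positions. -/
structure Config (Q Γ : Type*) where
  state : Q
  head : ℤ
  tape : ℤ → Γ

variable {Q Γ : Type*}

/-- The content of tape cell `i`: its symbol, and the state of the machine if the head is there. -/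
def Config.cell (C : Config Q Γ) (i : ℤ) : Γ × Option Q :=
  (C.tape i, if i = C.head then some C.state else none)

/-- The displacement of the head. -/
def dirVal : Turing.Dir → ℤ
  | .left => -1
  | .right => 1

/-- The initial configuration on input `w`, a word over the tape alphabet (in particular over any
input alphabet contained in it): `w` is written on cells `0, …, |w| - 1`, all other cells are
blank, and the head is on cell `0`. -/
def init (M : TuringMachine Q Γ) (w : List Γ) : Config Q Γ where
  state := M.start
  head := 0
  tape := fun i => if 0 ≤ i then w.getD i.toNat M.blank else M.blank

/-- One step; `none` if the machine has halted. -/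
def step (M : TuringMachine Q Γ) (C : Config Q Γ) : Option (Config Q Γ) :=
  (M.δ C.state (C.tape C.head)).map fun r =>
    { state := r.1
      head := C.head + dirVal r.2.2
      tape := Function.update C.tape C.head r.2.1 }

/-- The configuration of `M` on `w` after `t` steps; `none` if `M` halts in fewer than `t` steps. -/
def run (M : TuringMachine Q Γ) (w : List Γ) : ℕ → Option (Config Q Γ)
  | 0 => some (M.init w)
  | t + 1 => (M.run w t).bind M.step

/-- `M` halts on `w`. -/
def Halts (M : TuringMachine Q Γ) (w : List Γ) : Prop :=
  ∃ t C, M.run w t = some C ∧ M.step C = none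

end TuringMachine

/-! ### The polyomino tile assembly model -/

namespace PolyTAM

/-- The four sides of a unit square. -/
inductive Side
  | north
  | east
  | south
  | west
  deriving DecidableEq

instance : Fintype Side where
  elems := {.north, .east, .south, .west}
  complete := by rintro (_ | _ | _ | _) <;> simp

/-- The displacement to the unit square on the other side. -/
def Side.vec : Side → ℤ × ℤ
  | .north => (0, 1)
  | .east => (1, 0)
  | .south => (0, -1)
  | .west => (-1, 0)

def Side.opp : Side → Side
  | .north => .south
  | .east => .west
  | .south => .north
  | .west => .east

/-- Unit squares (named by their centres in `ℤ × ℤ`) that share a side. -/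
def gridGraph : SimpleGraph (ℤ × ℤ) where
  Adj p q := ∃ s : Side, q = p + s.vec
  symm := ⟨by
    rintro p q ⟨s, rfl⟩
    refine ⟨s.opp, ?_⟩
    cases s <;> ext <;> simp [Side.vec, Side.opp]⟩
  loopless := ⟨by
    rintro p ⟨s, hs⟩
    cases s <;> simp [Side.vec, Prod.ext_iff] at hs⟩

/-- A polyomino tile: a finite, nonempty, edge-connected set of unit squares, some of whose boundary
edges carry a glue label. The edge on side `s` of the square `p` is named by `(p, s)`. -/
structure PolyominoTile (G : Type*) where
  shape : Finset (ℤ × ℤ)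
  connected : (gridGraph.induce (shape : Set (ℤ × ℤ))).Connected
  glue : ℤ × ℤ → Side → Option G
  glue_edge : ∀ p s, glue p s ≠ none → p ∈ shape ∧ p + s.vec ∉ shape

/-- The horizontal (`2 × 1`) domino. -/
def horizontalDomino : Finset (ℤ × ℤ) := {(0, 0), (1, 0)}

/-- The vertical (`1 × 2`) domino. -/
def verticalDomino : Finset (ℤ × ℤ) := {(0, 0), (0, 1)}

/-- An integer translate of a tile. -/
@[ext]
structure PlacedTile (G : Type*) where
  tile : PolyominoTile G
  pos : ℤ × ℤ

variable {G : Type*}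

namespace PlacedTile

/-- The unit squares covered by a placed tile. -/
def cells (x : PlacedTile G) : Set (ℤ × ℤ) := {p | p - x.pos ∈ x.tile.shape}

/-- The glue on side `s` of the square at the absolute position `p`. -/
def glueAt (x : PlacedTile G) (p : ℤ × ℤ) (s : Side) : Option G := x.tile.glue (p - x.pos) s

def translate (v : ℤ × ℤ) (x : PlacedTile G) : PlacedTile G := ⟨x.tile, x.pos + v⟩

end PlacedTile

open Classical in
/-- The total strength with which the placed tile `x` binds to the set `A` of placed tiles: each
edge of `x` contributes the strength of its glue if it abuts an edge of a tile in `A` with the same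
glue. -/
noncomputable def bindStrength (strength : G → ℕ) (A : Set (PlacedTile G)) (x : PlacedTile G) : ℕ :=
  ∑ p ∈ x.tile.shape, ∑ s : Side,
    match x.tile.glue p s with
    | none => 0
    | some g =>
      if ∃ y ∈ A, y.glueAt (p + x.pos + s.vec) s.opp = some g then strength g else 0

/-- Distinct tiles do not overlap. -/
def NonOverlapping (A : Set (PlacedTile G)) : Prop :=
  A.Pairwise fun x y => Disjoint x.cells y.cells

/-- Every partition of the finite assembly into two nonempty parts separates bound glues of total
strength at least `τ`. -/
def Stable (strength : G → ℕ) (τ : ℕ) (A : Finset (PlacedTile G)) : Prop :=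
  ∀ S : Finset (PlacedTile G), S.Nonempty → S ⊂ A →
    τ ≤ ∑ x ∈ S, bindStrength strength ((A : Set (PlacedTile G)) \ S) x

/-- A tile assembly system, with finitely many tile types and a finite seed. (The seed is connected,
because it is stable at a positive temperature.) -/
structure TAS (G : Type*) where
  tiles : Set (PolyominoTile G)
  strength : G → ℕ
  seed : Finset (PlacedTile G)
  temperature : ℕ
  tiles_finite : tiles.Finite
  temperature_pos : 0 < temperature
  seed_nonempty : seed.Nonempty
  seed_tiles : ∀ x ∈ seed, x.tile ∈ tiles
  seed_nonOverlapping : NonOverlapping (seed : Set (PlacedTile G))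
  seed_stable : Stable strength temperature seed

namespace TAS

/-- `A` grows to `B` by the attachment of a single tile. -/
def Step (S : TAS G) (A B : Set (PlacedTile G)) : Prop :=
  ∃ x : PlacedTile G, x.tile ∈ S.tiles ∧ (∀ y ∈ A, Disjoint x.cells y.cells) ∧
    S.temperature ≤ bindStrength S.strength A x ∧ B = insert x A

/-- `A` is the result of a finite assembly sequence, or the limit of an infinite one. -/
def Producible (S : TAS G) (A : Set (PlacedTile G)) : Prop :=
  Relation.ReflTransGen S.Step (S.seed : Set (PlacedTile G)) A ∨
    ∃ α : ℕ → Set (PlacedTile G), α 0 = (S.seed : Set (PlacedTile G)) ∧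
      (∀ n, S.Step (α n) (α (n + 1))) ∧ A = ⋃ n, α n

/-- `A` is producible and no tile can attach to it. -/
def Terminal (S : TAS G) (A : Set (PlacedTile G)) : Prop :=
  S.Producible A ∧ ¬ ∃ B, S.Step A B

end TAS

/-! ### Simulation of Turing machines -/

/-- What the assembly `A` shows in the block `[c i, c i + c) × [h t, h t + h)`: the tiles that meet
the block, in coordinates relative to the corner of the block. -/
def blockView (c h : ℕ) (A : Set (PlacedTile G)) (i : ℤ) (t : ℕ) : Set (PlacedTile G) :=
  {x | x.translate (c * i, h * t) ∈ A ∧ ∃ p ∈ x.cells, 0 ≤ p.1 ∧ p.1 < c ∧ 0 ≤ p.2 ∧ p.2 < h}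

/-- The row of tiles that spells the word `w`: a fixed left end, then for each letter of `w` a fixed
group of tiles, at horizontal distance `c` from one another, then a fixed right end. -/
def inputRow {Γ : Type*} (c : ℕ) (left : Finset (PlacedTile G)) (letter : Γ → Finset (PlacedTile G))
    (right : Finset (PlacedTile G)) (w : List Γ) : Set (PlacedTile G) :=
  (left : Set (PlacedTile G)) ∪
    (⋃ k : Fin w.length,
      PlacedTile.translate ((c : ℤ) * (k : ℕ), 0) '' (letter (w.get k) : Set (PlacedTile G))) ∪
    PlacedTile.translate ((c : ℤ) * w.length, 0) '' (right : Set (PlacedTile G))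

/-- The system `S` simulates the run of `M` on `w`, where the content of tape cell `i` after `t`
steps is read off, by the fixed decoding `dec`, from the block of size `c × h` in column `i` and
row `t` of the plane. `dec` returns `none` on a block that does not represent a tape cell. -/
structure Simulates {Q Γ : Type*} (S : TAS G) (M : TuringMachine Q Γ) (w : List Γ) (c h : ℕ)
    (dec : Set (PlacedTile G) → Option (Γ × Option Q)) : Prop where
  /-- No producible assembly, complete or not, ever shows anything wrong. -/
  sound : ∀ A, S.Producible A → ∀ (i : ℤ) (t : ℕ) (a : Γ × Option Q),
    dec (blockView c h A i t) = some a → ∃ C, M.run w t = some C ∧ C.cell i = a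
  /-- Growth always ends, possibly in the limit, in an assembly that shows the whole run; a tape
  cell that is not represented is blank and does not carry the head. -/
  complete : ∀ A, S.Terminal A → ∀ (t : ℕ) (C : TuringMachine.Config Q Γ), M.run w t = some C →
    ∀ i : ℤ, dec (blockView c h A i t) = some (C.cell i) ∨
      (dec (blockView c h A i t) = none ∧ C.cell i = (M.blank, none))
  /-- There is a terminal assembly. -/
  exists_terminal : ∃ A, S.Terminal A
  /-- Growth stops if and only if the machine halts. -/
  halting : ∀ A, S.Terminal A → (A.Finite ↔ M.Halts w)

end PolyTAM

namespace PolyTAM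

/-! ### Deterministic growth -/

section Growth

variable {G : Type*}

/-! At temperature 1 a single matching glue suffices for attachment, so glues cannot cooperate; the
computation rests on dominoes blocking one another. The assembly is one path of dominoes with
exactly one exposed glue, at its end (`Front`). A tile can attach only if its input glue carries
that label and its two squares are free (`Front.attaches_iff`).

A bit is stored in the upper outline of a column of width 3. For `false` the outline is flat. For
`true` the path makes a detour that leaves a bump over the middle square and a hole in the last
square. The next sweep passes above in the opposite direction, so that the hole lies just below the
square where it enters the column and the bump lies straight ahead. Two dominoes carry the label of
a reading path: one points forward and is blocked by the bump, the other points down and is blocked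
unless there is a hole. Exactly one of them fits, and its output glue records the bit
(`AtColumn.readFalse`, `AtColumn.readTrue`).

A symbol is coded by `K` bits, exactly one of which is `true`, in a block of `2 * K` columns. A
sweep reads the first half of a block and writes the new symbol into the second half; on the way
back the second half comes first, so the halves exchange their roles (`BlockMachine.reach_block`). A
zigzag path therefore acts as a finite-state transducer on a row of symbols. A sweep to the right
carries out a transition of `M` together with a move to the right, the following sweep to the left
carries out a move to the left, and each adds a blank cell at its far end (`Sweep.reach_step`). Each
sweep is two rows high, whence the block height 4.

Since every attachment to the seed is forced, there is only one assembly sequence, up to where it is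
stopped (`producible_cases`). It gets stuck if `M` halts (`Sweep.exists_stuck`) and goes on for ever
otherwise (`Sweep.forall_forced_of_not_halts`). The run is displayed by marks: the label with which
a sweep to the right begins to write a block names the symbol that was found there, and its position
depends only on the cell and the time. All marks in all producible assemblies are correct
(`Sweep.correct_of_producible`), and in a terminal assembly every cell that is not blank or carries
the head has its mark (`Sweep.complete_of_terminal`). -/

theorem PlacedTile.mem_cells_of_glueAt {x : PlacedTile G} {p : ℤ × ℤ} {s : Side} {g : G}
    (h : x.glueAt p s = some g) : p ∈ x.cells :=
  (x.tile.glue_edge (p - x.pos) s (by rw [show x.tile.glue (p - x.pos) s = some g from h]; simp)).1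

theorem PlacedTile.cells_nonempty (x : PlacedTile G) : x.cells.Nonempty := by
  obtain ⟨p, hp⟩ := x.tile.connected.nonempty
  exact ⟨p + x.pos, by simpa [PlacedTile.cells] using hp⟩

@[simp]
theorem Side.opp_opp (s : Side) : s.opp.opp = s := by cases s <;> rfl

@[simp]
theorem Side.opp_vec (s : Side) : s.opp.vec = -s.vec := by cases s <;> rfl

theorem Side.opp_ne (s : Side) : s.opp ≠ s := by cases s <;> simp [Side.opp]

/-- Some glue of `x` abuts the same glue of `y`. -/
def Binds (y x : PlacedTile G) : Prop :=
  ∃ p s g, x.glueAt p s = some g ∧ y.glueAt (p + s.vec) s.opp = some g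

theorem Binds.symm {x y : PlacedTile G} (h : Binds y x) : Binds x y := by
  obtain ⟨p, s, g, h1, h2⟩ := h
  exact ⟨p + s.vec, s.opp, g, h2, by simpa using h1⟩

/-- All strengths are 1, so the sum is positive as soon as one term is. From here on binding is a
relation between two tiles. -/
theorem one_le_bindStrength_iff (A : Set (PlacedTile G)) (x : PlacedTile G) :
    1 ≤ bindStrength (fun _ => 1) A x ↔ ∃ y ∈ A, Binds y x := by
  classical
  rw [Nat.one_le_iff_ne_zero, bindStrength, Ne, Finset.sum_eq_zero_iff]
  push Not
  constructor
  · rintro ⟨p, hp, h⟩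
    rw [Ne, Finset.sum_eq_zero_iff] at h
    push Not at h
    obtain ⟨s, -, h⟩ := h
    cases hg : x.tile.glue p s with
    | none => simp [hg] at h
    | some g =>
      simp only [hg] at h
      obtain ⟨y, hy, hyg⟩ := (ite_ne_right_iff.1 h).1
      exact ⟨y, hy, p + x.pos, s, g, by simpa [PlacedTile.glueAt] using hg, hyg⟩
  · rintro ⟨y, hy, p, s, g, h1, h2⟩
    have h1' : x.tile.glue (p - x.pos) s = some g := h1
    refine ⟨p - x.pos, (x.tile.glue_edge _ s (by simp [h1'])).1, ?_⟩
    rw [Ne, Finset.sum_eq_zero_iff]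
    push Not
    refine ⟨s, Finset.mem_univ _, ?_⟩
    simp only [h1']
    rw [if_pos ⟨y, hy, by rwa [sub_add_cancel]⟩]
    exact one_ne_zero

/-- The tile `x` can attach to `A` at temperature `1`. -/
def Attaches (T : Set (PolyominoTile G)) (A : Set (PlacedTile G)) (x : PlacedTile G) : Prop :=
  x.tile ∈ T ∧ (∀ y ∈ A, Disjoint x.cells y.cells) ∧ ∃ y ∈ A, Binds y x

theorem Attaches.notMem {T : Set (PolyominoTile G)} {A : Set (PlacedTile G)} {x : PlacedTile G}
    (h : Attaches T A x) : x ∉ A := fun hx =>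
  x.cells_nonempty.ne_empty (disjoint_self.1 (h.2.1 x hx))

/-- Assemblies that grow from a single tile by attachments. -/
inductive Built (T : Set (PolyominoTile G)) : Set (PlacedTile G) → Prop
  | single (x : PlacedTile G) (hx : x.tile ∈ T) : Built T {x}
  | attach (A : Set (PlacedTile G)) (x : PlacedTile G) (hA : Built T A) (hx : Attaches T A x) :
      Built T (insert x A)

namespace Built

variable {T : Set (PolyominoTile G)} {A : Set (PlacedTile G)}

theorem tiles (h : Built T A) : ∀ x ∈ A, x.tile ∈ T := by
  induction h with
  | single x hx => simpa using hx
  | attach A x _ hx ih => simpa using ⟨hx.1, ih⟩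

theorem nonempty (h : Built T A) : A.Nonempty := by
  induction h with
  | single x hx => simp
  | attach A x _ hx ih => exact Set.insert_nonempty _ _

theorem finite (h : Built T A) : A.Finite := by
  induction h with
  | single x hx => simp
  | attach A x _ hx ih => exact ih.insert _

theorem nonOverlapping (h : Built T A) : NonOverlapping A := by
  induction h with
  | single x hx => simp [NonOverlapping]
  | attach A x _ hx ih =>
    refine Set.Pairwise.insert ih fun y hy _ => ⟨hx.2.1 y hy, (hx.2.1 y hy).symm⟩

/-- Connectedness under `Binds`: every new tile binds to an older one. A cut either already
separates the older tiles, or has all of them on one side and the new tile on the other. Stability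
of the seed follows. -/
theorem exists_binds (h : Built T A) : ∀ S : Set (PlacedTile G), (∃ x ∈ A, x ∈ S) →
    (∃ x ∈ A, x ∉ S) → ∃ x ∈ A, x ∈ S ∧ ∃ y ∈ A, y ∉ S ∧ Binds y x := by
  induction h with
  | single x hx =>
    rintro S ⟨y, rfl, hy⟩ ⟨z, rfl, hz⟩
    exact absurd hy hz
  | attach A x hA hx ih =>
    intro S h1 h2
    obtain ⟨-, -, z, hz, hzx⟩ := hx
    by_cases ha : ∃ y ∈ A, y ∈ S
    · by_cases hb : ∃ y ∈ A, y ∉ S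
      · obtain ⟨u, hu, huS, v, hv, hvS, huv⟩ := ih S ha hb
        exact ⟨u, Or.inr hu, huS, v, Or.inr hv, hvS, huv⟩
      · push Not at hb
        have hxS : x ∉ S := by
          obtain ⟨y, rfl | hy, hyS⟩ := h2
          · exact hyS
          · exact absurd (hb y hy) hyS
        exact ⟨z, Or.inr hz, hb z hz, x, Or.inl rfl, hxS, hzx.symm⟩
    · push Not at ha
      have hxS : x ∈ S := by
        obtain ⟨y, rfl | hy, hyS⟩ := h1
        · exact hyS
        · exact absurd hyS (ha y hy)
      exact ⟨x, Or.inl rfl, hxS, z, Or.inr hz, ha z hz, hzx⟩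

theorem stable {A : Finset (PlacedTile G)} (h : Built T (A : Set (PlacedTile G))) :
    Stable (fun _ : G => 1) 1 A := by
  intro S hS hSA
  obtain ⟨u, hu⟩ := hS
  obtain ⟨v, hv, hvS⟩ := Finset.exists_of_ssubset hSA
  obtain ⟨x, -, hxS, y, hy, hyS, hxy⟩ := h.exists_binds S ⟨u, hSA.1 hu, hu⟩ ⟨v, hv, hvS⟩
  refine le_trans ?_ (Finset.single_le_sum (fun _ _ => Nat.zero_le _) hxS)
  rw [one_le_bindStrength_iff]
  exact ⟨y, ⟨hy, hyS⟩, hxy⟩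

/-- The temperature-1 system whose seed is an assembly that grows from a single tile. -/
noncomputable def tas (hT : T.Finite) (h : Built T A) : TAS G where
  tiles := T
  strength := fun _ => 1
  seed := h.finite.toFinset
  temperature := 1
  tiles_finite := hT
  temperature_pos := one_pos
  seed_nonempty := by simpa using h.nonempty
  seed_tiles := by simpa using h.tiles
  seed_nonOverlapping := by simpa using h.nonOverlapping
  seed_stable := stable (T := T) (by simpa using h)

theorem tas_step (hT : T.Finite) (h : Built T A) (X Y : Set (PlacedTile G)) :
    (h.tas hT).Step X Y ↔ ∃ x, Attaches T X x ∧ Y = insert x X := by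
  simp only [TAS.Step, tas, one_le_bindStrength_iff, Attaches, and_assoc]

end Built

/-- `B` is the only assembly to which `A` can grow by one attachment. -/
def Forced (T : Set (PolyominoTile G)) (A B : Set (PlacedTile G)) : Prop :=
  ∃ x, Attaches T A x ∧ B = insert x A ∧ ∀ y, Attaches T A y → y = x

/-- No tile can attach to `A`. -/
def Stuck (T : Set (PolyominoTile G)) (A : Set (PlacedTile G)) : Prop :=
  ∀ x, ¬ Attaches T A x

open Classical in
/-- The forced successor of an assembly, or the assembly itself if there is none. -/
noncomputable def forcedNext (T : Set (PolyominoTile G)) (A : Set (PlacedTile G)) :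
    Set (PlacedTile G) :=
  if h : ∃ B, Forced T A B then h.choose else A

variable {T : Set (PolyominoTile G)} {A B : Set (PlacedTile G)}

theorem Forced.unique {C : Set (PlacedTile G)} (h : Forced T A B) (h' : Forced T A C) : B = C := by
  obtain ⟨x, hx, rfl, hu⟩ := h
  obtain ⟨y, hy, rfl, -⟩ := h'
  rw [hu y hy]

theorem Forced.forcedNext_eq (h : Forced T A B) : forcedNext T A = B := by
  have h' : ∃ B, Forced T A B := ⟨B, h⟩
  rw [forcedNext, dif_pos h']
  exact h'.choose_spec.unique h

theorem Stuck.forcedNext_eq (h : Stuck T A) : forcedNext T A = A := by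
  rw [forcedNext, dif_neg]
  rintro ⟨B, x, hx, -⟩
  exact h x hx

theorem Stuck.iterate_eq (h : Stuck T A) (n : ℕ) : (forcedNext T)^[n] A = A := by
  induction n with
  | zero => rfl
  | succ n ih => rw [Function.iterate_succ_apply', ih, h.forcedNext_eq]

theorem subset_forcedNext : A ⊆ forcedNext T A := by
  by_cases h : ∃ B, Forced T A B
  · obtain ⟨B, hB⟩ := h
    rw [hB.forcedNext_eq]
    obtain ⟨x, -, rfl, -⟩ := hB
    exact Set.subset_insert _ _
  · rw [forcedNext, dif_neg h]

theorem iterate_mono : Monotone fun n => (forcedNext T)^[n] A :=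
  monotone_nat_of_le_succ fun n => by
    rw [Function.iterate_succ_apply']
    exact subset_forcedNext

/-- The first `n` attachments to `A` are forced. -/
def ForcedUpTo (T : Set (PolyominoTile G)) (A : Set (PlacedTile G)) (n : ℕ) : Prop :=
  ∀ m < n, Forced T ((forcedNext T)^[m] A) ((forcedNext T)^[m + 1] A)

/-- Forced successors are unique, so any chain of forced steps is a stretch of the iteration of
`forcedNext`. Results about reachability thereby become results about one numbered sequence. -/
theorem ForcedUpTo.of_reflTransGen {n : ℕ} (hn : ForcedUpTo T A n)
    (h : Relation.ReflTransGen (Forced T) ((forcedNext T)^[n] A) B) :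
    ∃ k, n ≤ k ∧ B = (forcedNext T)^[k] A ∧ ForcedUpTo T A k := by
  induction h with
  | refl => exact ⟨n, le_rfl, rfl, hn⟩
  | tail _ h ih =>
    obtain ⟨k, hk, rfl, hF⟩ := ih
    have e := h.forcedNext_eq
    rw [← Function.iterate_succ_apply' (forcedNext T)] at e
    refine ⟨k + 1, by omega, e.symm, fun m hm => ?_⟩
    rcases Nat.lt_succ_iff_lt_or_eq.1 hm with hm | rfl
    · exact hF m hm
    · rw [e]
      exact h

/-- The strict inequality lets the index outgrow every bound when there are infinitely many machine
steps. -/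
theorem ForcedUpTo.of_transGen {n : ℕ} (hn : ForcedUpTo T A n)
    (h : Relation.TransGen (Forced T) ((forcedNext T)^[n] A) B) :
    ∃ k, n < k ∧ B = (forcedNext T)^[k] A ∧ ForcedUpTo T A k := by
  obtain ⟨C, hC, hCB⟩ := Relation.TransGen.head'_iff.1 h
  have e := hC.forcedNext_eq
  rw [← Function.iterate_succ_apply' (forcedNext T)] at e
  subst e
  have hn' : ForcedUpTo T A (n + 1) := by
    intro m hm
    rcases Nat.lt_succ_iff_lt_or_eq.1 hm with hm | rfl
    · exact hn m hm
    · exact hC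
  obtain ⟨k, hk, h1, h2⟩ := hn'.of_reflTransGen hCB
  exact ⟨k, by omega, h1, h2⟩

/-- Growth from `A` is deterministic. -/
def Deterministic (T : Set (PolyominoTile G)) (A : Set (PlacedTile G)) : Prop :=
  ∀ n, Forced T ((forcedNext T)^[n] A) ((forcedNext T)^[n + 1] A) ∨
    Stuck T ((forcedNext T)^[n] A)

theorem Stuck.iterate_eq_of_le {n m : ℕ} (hB : Stuck T ((forcedNext T)^[n] A)) (hm : n ≤ m) :
    (forcedNext T)^[m] A = (forcedNext T)^[n] A := by
  obtain ⟨k, rfl⟩ := Nat.exists_eq_add_of_le hm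
  rw [Nat.add_comm, Function.iterate_add_apply, hB.iterate_eq]

theorem ForcedUpTo.deterministic {n : ℕ} (hn : ForcedUpTo T A n)
    (hB : Stuck T ((forcedNext T)^[n] A)) : Deterministic T A := by
  intro m
  rcases lt_or_ge m n with hm | hm
  · exact Or.inl (hn m hm)
  · right
    rw [hB.iterate_eq_of_le hm]
    exact hB

section Producible

variable (hT : T.Finite) (h : Built T A)

/-- Determinism leaves an assembly sequence only the choice of where to stop. An infinite sequence
moreover shows that no stage is stuck. -/
theorem producible_cases (hdet : Deterministic T A) (X : Set (PlacedTile G)) :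
    (h.tas hT).Producible X →
      (∃ n, X = (forcedNext T)^[n] A) ∨
        (X = ⋃ n, (forcedNext T)^[n] A) ∧
          ∀ n, Forced T ((forcedNext T)^[n] A) ((forcedNext T)^[n + 1] A) := by
  have hseed : ((h.tas hT).seed : Set (PlacedTile G)) = A := by simp [Built.tas]
  have hstep : ∀ n Y, (h.tas hT).Step ((forcedNext T)^[n] A) Y →
      Y = (forcedNext T)^[n + 1] A ∧
        Forced T ((forcedNext T)^[n] A) ((forcedNext T)^[n + 1] A) := by
    intro n Y hY
    obtain ⟨x, hx, rfl⟩ := (h.tas_step hT _ _).1 hY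
    rcases hdet n with hn | hn
    · refine ⟨?_, hn⟩
      obtain ⟨y, -, hB, hu⟩ := hn
      rw [hB, hu x hx]
    · exact absurd hx (hn x)
  rintro (hX | ⟨α, h0, hα, rfl⟩)
  · left
    rw [hseed] at hX
    induction hX with
    | refl => exact ⟨0, rfl⟩
    | tail _ hs ih =>
      obtain ⟨n, rfl⟩ := ih
      exact ⟨n + 1, (hstep n _ hs).1⟩
  · right
    have key : ∀ n, α n = (forcedNext T)^[n] A := by
      intro n
      induction n with
      | zero => rw [h0, hseed]; rfl
      | succ n ih => exact (hstep n _ (ih ▸ hα n)).1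
    refine ⟨by simp only [key], fun n => (hstep n (α (n + 1)) ?_).2⟩
    rw [← key]
    exact hα n

theorem forced_step (hF : Forced T A B) {C : Set (PlacedTile G)} (hC : Built T C) :
    (hC.tas hT).Step A B := by
  obtain ⟨x, hx, rfl, -⟩ := hF
  exact (hC.tas_step hT _ _).2 ⟨x, hx, rfl⟩

theorem producible_iterate (n : ℕ) (hF : ForcedUpTo T A n) :
    (h.tas hT).Producible ((forcedNext T)^[n] A) := by
  have hseed : ((h.tas hT).seed : Set (PlacedTile G)) = A := by simp [Built.tas]
  left
  rw [hseed]
  induction n with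
  | zero => exact .refl
  | succ n ih =>
    exact .tail (ih fun m hm => hF m (by omega)) (forced_step hT (hF n (by omega)) h)

/-- The growth ends after finitely many attachments. -/
theorem terminal_iff_of_stuck {n : ℕ} (hn : ForcedUpTo T A n)
    (hB : Stuck T ((forcedNext T)^[n] A)) (X : Set (PlacedTile G)) :
    (h.tas hT).Terminal X ↔ X = (forcedNext T)^[n] A := by
  constructor
  · rintro ⟨hP, hX⟩
    rcases producible_cases hT h (hn.deterministic hB) X hP with ⟨m, rfl⟩ | ⟨-, hF⟩
    · rcases lt_or_ge m n with hm | hm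
      · exact absurd ⟨_, forced_step hT (hn m hm) h⟩ hX
      · rw [hB.iterate_eq_of_le hm]
    · obtain ⟨x, hx, -⟩ := hF n
      exact absurd hx (hB x)
  · rintro rfl
    refine ⟨producible_iterate hT h n hn, ?_⟩
    rintro ⟨Y, hY⟩
    obtain ⟨x, hx, -⟩ := (h.tas_step hT _ _).1 hY
    exact hB x hx

theorem finite_iterate (h : A.Finite) (n : ℕ) : ((forcedNext T)^[n] A).Finite := by
  induction n with
  | zero => exact h
  | succ n ih =>
    rw [Function.iterate_succ_apply']
    by_cases hF : ∃ B, Forced T ((forcedNext T)^[n] A) B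
    · obtain ⟨B, hB⟩ := hF
      rw [hB.forcedNext_eq]
      obtain ⟨x, -, rfl, -⟩ := hB
      exact ih.insert x
    · rw [forcedNext, dif_neg hF]
      exact ih

/-- The growth never ends. -/
theorem terminal_iff_of_forall_forced
    (hF : ∀ n, Forced T ((forcedNext T)^[n] A) ((forcedNext T)^[n + 1] A))
    (X : Set (PlacedTile G)) :
    (h.tas hT).Terminal X ↔ X = ⋃ n, (forcedNext T)^[n] A := by
  have hseed : ((h.tas hT).seed : Set (PlacedTile G)) = A := by simp [Built.tas]
  constructor
  · rintro ⟨hP, hX⟩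
    rcases producible_cases hT h (fun n => Or.inl (hF n)) X hP with ⟨m, rfl⟩ | ⟨h, -⟩
    · exact absurd ⟨_, forced_step hT (hF m) h⟩ hX
    · exact h
  · rintro rfl
    refine ⟨Or.inr ⟨fun n => (forcedNext T)^[n] A, hseed.symm, fun n => ?_, rfl⟩, ?_⟩
    · exact forced_step hT (hF n) h
    · rintro ⟨Y, hY⟩
      obtain ⟨x, ⟨hxT, hxd, y, hy, hyx⟩, -⟩ := (h.tas_step hT _ _).1 hY
      obtain ⟨n, hn⟩ := Set.mem_iUnion.1 hy
      obtain ⟨z, -, hz, hu⟩ := hF n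
      -- A tile that attaches to the limit binds to some finite stage and avoids it, so it is the
      -- forced tile of that stage; but that tile is already in the limit.
      have hx : x = z :=
        hu x ⟨hxT, fun v hv => hxd v (Set.mem_iUnion.2 ⟨n, hv⟩), y, hn, hyx⟩
      have hxm : x ∈ (forcedNext T)^[n + 1] A := by rw [hz, hx]; exact Set.mem_insert _ _
      exact x.cells_nonempty.ne_empty
        (disjoint_self.1 (hxd x (Set.mem_iUnion.2 ⟨n + 1, hxm⟩)))

/-- A finite union of an increasing chain would be contained in one stage, whereas the next stage
has a new tile. -/
theorem infinite_of_forall_forced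
    (hF : ∀ n, Forced T ((forcedNext T)^[n] A) ((forcedNext T)^[n + 1] A)) :
    (⋃ n, (forcedNext T)^[n] A).Infinite := by
  intro hfin
  obtain ⟨n, hn⟩ : ∃ n, (⋃ n, (forcedNext T)^[n] A) ⊆ (forcedNext T)^[n] A := by
    refine (DirectedOn.exists_mem_subset_of_finite_of_subset_sUnion
      (c := Set.range fun n => (forcedNext T)^[n] A) (Set.range_nonempty _) ?_ hfin ?_).elim ?_
    · rintro _ ⟨m, rfl⟩ _ ⟨n, rfl⟩
      exact ⟨_, ⟨max m n, rfl⟩, iterate_mono (le_max_left _ _), iterate_mono (le_max_right _ _)⟩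
    · rw [Set.sUnion_range]
    · rintro _ ⟨⟨n, rfl⟩, h⟩
      exact ⟨n, h⟩
  obtain ⟨x, hx, hB, -⟩ := hF n
  exact hx.notMem (hn (Set.mem_iUnion.2 ⟨n + 1, by rw [hB]; exact Set.mem_insert _ _⟩))

end Producible

end Growth

end PolyTAM

namespace PolyTAM

/-! ### Dominoes that form a path -/

/-- The position of a glue inside a gadget. -/
inductive Stage
  | enter | w1 | w2 | v1 | v2 | x1 | y1 | y2 | t1
  deriving DecidableEq

instance : Fintype Stage where
  elems := {.enter, .w1, .w2, .v1, .v2, .x1, .y1, .y2, .t1}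
  complete := by rintro (_ | _) <;> simp

/-- Glue labels: a walking direction, a base label and a stage. -/
structure Label (B : Type) where
  right : Bool
  base : B
  stage : Stage

/-- The walking direction as a side. -/
def fwd (r : Bool) : Side := if r then .east else .west

variable {B : Type}

/-- The side on which a path leaves a tile through a glue with the given label. -/
def Label.side (g : Label B) : Side :=
  match g.stage with
  | .v2 => .south
  | .y1 => .north
  | .t1 => .north
  | _ => fwd g.right

/-- A domino on a path: the direction from its entry square to its other square, the label through
which the path enters, whether it leaves from the other square, and the label through which it
leaves. -/
structure Spec (B : Type) where
  ext : Side
  gin : Option (Label B)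
  far : Bool
  gout : Label B

instance [Finite B] : Finite (Label B) :=
  Finite.of_injective (fun g : Label B => (g.right, g.base, g.stage)) (by
    rintro ⟨_, _, _⟩ ⟨_, _, _⟩ h
    simpa using h)

instance [Finite B] : Finite (Spec B) :=
  Finite.of_injective (fun g : Spec B => (g.ext, g.gin, g.far, g.gout)) (by
    rintro ⟨_, _, _, _⟩ ⟨_, _, _, _⟩ h
    simpa using h)

/-- The entry square of a domino that extends in the given direction. -/
def entrySquare : Side → ℤ × ℤ
  | .north => (0, 0)
  | .east => (0, 0)
  | .south => (0, 1)
  | .west => (1, 0)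

/-- The domino that extends in the given direction. -/
def dominoShape : Side → Finset (ℤ × ℤ)
  | .north => verticalDomino
  | .east => horizontalDomino
  | .south => verticalDomino
  | .west => horizontalDomino

theorem mem_dominoShape (e : Side) (p : ℤ × ℤ) :
    p ∈ dominoShape e ↔ p = entrySquare e ∨ p = entrySquare e + e.vec := by
  cases e <;> simp [dominoShape, verticalDomino, horizontalDomino, entrySquare, Side.vec, or_comm]

theorem dominoShape_connected (e : Side) :
    (gridGraph.induce (dominoShape e : Set (ℤ × ℤ))).Connected := by
  have h1 : entrySquare e ∈ dominoShape e := (mem_dominoShape _ _).2 (Or.inl rfl)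
  have h2 : entrySquare e + e.vec ∈ dominoShape e := (mem_dominoShape _ _).2 (Or.inr rfl)
  have : Nonempty ↑(dominoShape e : Set (ℤ × ℤ)) := ⟨⟨_, h1⟩⟩
  have hadj : (gridGraph.induce (dominoShape e : Set (ℤ × ℤ))).Adj ⟨_, h1⟩ ⟨_, h2⟩ := ⟨e, rfl⟩
  refine ⟨fun u v => ?_⟩
  have key : ∀ u : ↑(dominoShape e : Set (ℤ × ℤ)),
      (gridGraph.induce (dominoShape e : Set (ℤ × ℤ))).Reachable ⟨_, h1⟩ u := by
    rintro ⟨u, hu⟩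
    rcases (mem_dominoShape e u).1 hu with rfl | rfl
    · exact .refl _
    · exact hadj.reachable
  exact (key u).symm.trans (key v)

namespace Spec

/-- The square from which the path leaves the domino that it enters in `q`. -/
def exit (sp : Spec B) (q : ℤ × ℤ) : ℤ × ℤ := if sp.far then q + sp.ext.vec else q

open Classical in
/-- The polyomino tile described by `sp`. -/
noncomputable def tile (sp : Spec B) : PolyominoTile (Label B) where
  shape := dominoShape sp.ext
  connected := dominoShape_connected sp.ext
  glue p s :=
    if p ∈ dominoShape sp.ext ∧ p + s.vec ∉ dominoShape sp.ext then
      if p = sp.exit (entrySquare sp.ext) ∧ s = sp.gout.side then some sp.gout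
      else if p = entrySquare sp.ext ∧ ∃ g, sp.gin = some g ∧ s = g.side.opp then sp.gin
      else none
    else none
  glue_edge p s h := by
    by_contra hne
    exact h (if_neg hne)

/-- The glues of `sp` lie on distinct boundary edges. -/
structure WF (sp : Spec B) : Prop where
  gin_ext : ∀ g, sp.gin = some g → g.side.opp ≠ sp.ext
  gout_ext : sp.gout.side ≠ if sp.far then sp.ext.opp else sp.ext
  ne : sp.far = false → ∀ g, sp.gin = some g → g.side.opp ≠ sp.gout.side

/-- The placed tile through which a path runs that enters the square `q`. -/
noncomputable def place (sp : Spec B) (q : ℤ × ℤ) : PlacedTile (Label B) :=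
  ⟨sp.tile, q - entrySquare sp.ext⟩

theorem mem_cells_place (sp : Spec B) (q p : ℤ × ℤ) :
    p ∈ (sp.place q).cells ↔ p = q ∨ p = q + sp.ext.vec := by
  simp only [PlacedTile.cells, place, tile, Set.mem_ofPred_eq, mem_dominoShape]
  constructor
  · rintro (h | h)
    · left; linear_combination h
    · right; linear_combination h
  · rintro (rfl | rfl)
    · left; ring
    · right; ring

theorem boundary_iff (e s : Side) (p : ℤ × ℤ) :
    (p ∈ dominoShape e ∧ p + s.vec ∉ dominoShape e) ↔
      (p = entrySquare e ∧ s ≠ e) ∨ (p = entrySquare e + e.vec ∧ s ≠ e.opp) := by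
  rw [mem_dominoShape, mem_dominoShape]
  obtain ⟨a, b⟩ := p
  cases e <;> cases s <;>
    simp [entrySquare, Side.vec, Side.opp] <;> omega

/-- By `WF` the edges meant for the two glues are boundary edges and are distinct, so neither the
boundary test nor the order of the cases in `tile` suppresses a glue. -/
theorem glueAt_place {sp : Spec B} (h : sp.WF) (q p : ℤ × ℤ) (s : Side) (g : Label B) :
    (sp.place q).glueAt p s = some g ↔
      (p = sp.exit q ∧ s = sp.gout.side ∧ g = sp.gout) ∨
        (p = q ∧ sp.gin = some g ∧ s = g.side.opp) := by
  have hq : p - (q - entrySquare sp.ext) = entrySquare sp.ext ↔ p = q := by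
    rw [← sub_add, add_eq_right, sub_eq_zero]
  have hx : p - (q - entrySquare sp.ext) = sp.exit (entrySquare sp.ext) ↔ p = sp.exit q := by
    unfold exit
    split_ifs
    · constructor
      · intro h; linear_combination h
      · rintro rfl; ring
    · exact hq
  have hne : entrySquare sp.ext + sp.ext.vec ≠ entrySquare sp.ext := by
    cases sp.ext <;> simp [entrySquare, Side.vec]
  simp only [PlacedTile.glueAt, place, tile, boundary_iff, hx, hq]
  obtain ⟨h1, h2, h3⟩ := h
  constructor
  · intro hg
    split_ifs at hg with ha hb hc
    · exact Or.inl ⟨hb.1, hb.2, (Option.some_injective _ hg).symm⟩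
    · obtain ⟨hc1, g', hc2, hc3⟩ := hc
      have : g' = g := Option.some_injective _ (hc2.symm.trans hg)
      subst this
      exact Or.inr ⟨hc1, hg, hc3⟩
  · rintro (⟨rfl, rfl, rfl⟩ | ⟨rfl, hg, rfl⟩)
    · rw [if_pos, if_pos ⟨rfl, rfl⟩]
      unfold exit
      cases hf : sp.far
      · left
        exact ⟨by simp, by simpa [hf] using h2⟩
      · right
        exact ⟨by simp; abel, by simpa [hf] using h2⟩
    · rw [if_pos (Or.inl ⟨rfl, h1 g hg⟩), if_neg, if_pos ⟨rfl, g, hg, rfl⟩, hg]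
      rintro ⟨he, hs⟩
      cases hf : sp.far
      · exact h3 hf g hg hs
      · simp only [exit, hf, if_true] at he
        apply hne
        have : sp.ext.vec = 0 := by
          rw [left_eq_add] at he
          exact he
        rw [this, add_zero]

end Spec

/-! ### Column programs -/

/-- What a path does when it enters a column: read the bit that is encoded there, write a bit, or
turn round. -/
inductive Instr (B : Type)
  | read (next : Bool → B)
  | write (b : Bool) (next : B)
  | turn (next : B)

/-- The dominoes that carry out a column program; `cap` is the label that starts the seed. -/
inductive Rule (prog : B → Set (Instr B)) (cap : B) : Spec B → Prop
  | writeFalse₁ (r β n) (h : Instr.write false n ∈ prog β) :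
      Rule prog cap ⟨.north, some ⟨r, β, .enter⟩, false, ⟨r, β, .w1⟩⟩
  | writeFalse₂ (r β n) (h : Instr.write false n ∈ prog β) :
      Rule prog cap ⟨.north, some ⟨r, β, .w1⟩, false, ⟨r, β, .w2⟩⟩
  | writeFalse₃ (r β n) (h : Instr.write false n ∈ prog β) :
      Rule prog cap ⟨.north, some ⟨r, β, .w2⟩, false, ⟨r, n, .enter⟩⟩
  | writeTrue₁ (r β n) (h : Instr.write true n ∈ prog β) :
      Rule prog cap ⟨.north, some ⟨r, β, .enter⟩, true, ⟨r, β, .v1⟩⟩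
  | writeTrue₂ (r β n) (h : Instr.write true n ∈ prog β) :
      Rule prog cap ⟨.north, some ⟨r, β, .v1⟩, false, ⟨r, β, .v2⟩⟩
  | writeTrue₃ (r β n) (h : Instr.write true n ∈ prog β) :
      Rule prog cap ⟨fwd r, some ⟨r, β, .v2⟩, true, ⟨r, n, .enter⟩⟩
  | readFalse₁ (r β f) (h : Instr.read f ∈ prog β) :
      Rule prog cap ⟨fwd r, some ⟨r, β, .enter⟩, true, ⟨r, β, .x1⟩⟩
  | readFalse₂ (r β f) (h : Instr.read f ∈ prog β) :
      Rule prog cap ⟨.north, some ⟨r, β, .x1⟩, false, ⟨r, f false, .enter⟩⟩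
  | readTrue₁ (r β f) (h : Instr.read f ∈ prog β) :
      Rule prog cap ⟨.south, some ⟨r, β, .enter⟩, false, ⟨r, β, .y1⟩⟩
  | readTrue₂ (r β f) (h : Instr.read f ∈ prog β) :
      Rule prog cap ⟨fwd r, some ⟨r, β, .y1⟩, true, ⟨r, β, .y2⟩⟩
  | readTrue₃ (r β f) (h : Instr.read f ∈ prog β) :
      Rule prog cap ⟨.south, some ⟨r, β, .y2⟩, true, ⟨r, f true, .enter⟩⟩
  | turn₁ (r β n) (h : Instr.turn n ∈ prog β) :
      Rule prog cap ⟨.north, some ⟨r, β, .enter⟩, true, ⟨r, β, .t1⟩⟩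
  | turn₂ (r β n) (h : Instr.turn n ∈ prog β) :
      Rule prog cap ⟨.north, some ⟨r, β, .t1⟩, false, ⟨!r, n, .enter⟩⟩
  | cap : Rule prog cap ⟨.north, none, false, ⟨false, cap, .enter⟩⟩

variable {prog : B → Set (Instr B)} {cap : B}

theorem Rule.wf {sp : Spec B} (h : Rule prog cap sp) : sp.WF := by
  cases h <;> constructor <;> (try rename_i r _ _ _; cases r) <;>
    simp [Label.side, fwd, Side.opp]

/-- The tile set of a column program. -/
def tileSet (prog : B → Set (Instr B)) (cap : B) : Set (PolyominoTile (Label B)) :=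
  Spec.tile '' {sp | Rule prog cap sp}

theorem tileSet_finite [Finite B] (prog : B → Set (Instr B)) (cap : B) :
    (tileSet prog cap).Finite :=
  (Set.toFinite _).image _

theorem tileSet_domino {t : PolyominoTile (Label B)} (h : t ∈ tileSet prog cap) :
    t.shape = horizontalDomino ∨ t.shape = verticalDomino := by
  obtain ⟨sp, -, rfl⟩ := h
  simp only [Spec.tile]
  cases sp.ext <;> simp [dominoShape]

/-- The squares covered by an assembly. -/
def occ {G : Type*} (A : Set (PlacedTile G)) : Set (ℤ × ℤ) := {p | ∃ x ∈ A, p ∈ x.cells}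

theorem occ_insert_place (A : Set (PlacedTile (Label B))) (sp : Spec B) (q : ℤ × ℤ) :
    occ (insert (sp.place q) A) = insert q (insert (q + sp.ext.vec) (occ A)) := by
  ext p
  simp [occ, Spec.mem_cells_place, or_assoc]

/-- The only glue of `A` that does not face a covered square has label `g` and faces `q`. -/
structure Front (A : Set (PlacedTile (Label B))) (q : ℤ × ℤ) (g : Label B) : Prop where
  has : ∃ y ∈ A, y.glueAt (q - g.side.vec) g.side = some g
  only : ∀ y ∈ A, ∀ p s g', y.glueAt p s = some g' →
    p + s.vec ∈ occ A ∨ (p + s.vec = q ∧ s = g.side ∧ g' = g)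

/-- Any other glue of `A` faces a covered square, hence cannot bind a tile that avoids `A`. A new
tile cannot bind by its output glue either: an output glue labelled `g` lies on side `g.side`, and
the edge abutting the front is on the opposite side. -/
theorem Front.attaches_iff {A : Set (PlacedTile (Label B))} {q : ℤ × ℤ} {g : Label B}
    (hF : Front A q g) (x : PlacedTile (Label B)) :
    Attaches (tileSet prog cap) A x ↔ ∃ sp, Rule prog cap sp ∧ sp.gin = some g ∧
      x = sp.place q ∧ q ∉ occ A ∧ q + sp.ext.vec ∉ occ A := by
  constructor
  · rintro ⟨⟨sp, hsp, hx⟩, hd, y, hy, p, s, g', hg1, hg2⟩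
    have hxp : x = sp.place (x.pos + entrySquare sp.ext) := by
      ext1
      · exact hx.symm
      · simp [Spec.place]
    have hfree : ∀ p ∈ x.cells, p ∉ occ A := by
      rintro p hp ⟨z, hz, hpz⟩
      exact Set.disjoint_left.1 (hd z hz) hp hpz
    rcases hF.only y hy _ _ _ hg2 with h | ⟨h1, h2, rfl⟩
    · exact absurd h (hfree _ (by simpa using PlacedTile.mem_cells_of_glueAt hg1))
    · simp only [Side.opp_vec, add_neg_cancel_right] at h1
      subst h1
      rw [hxp, Spec.glueAt_place hsp.wf] at hg1
      rcases hg1 with ⟨-, h4, h5⟩ | ⟨h3, h4, h5⟩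
      · rw [← h5, ← h2] at h4
        exact absurd h4.symm (Side.opp_ne s)
      · rw [← h3] at hxp
        have hc := Spec.mem_cells_place sp p
        rw [← hxp] at hc
        exact ⟨sp, hsp, h4, hxp, hfree _ ((hc _).2 (Or.inl rfl)), hfree _ ((hc _).2 (Or.inr rfl))⟩
  · rintro ⟨sp, hsp, hg, rfl, h1, h2⟩
    refine ⟨⟨sp, hsp, rfl⟩, fun y hy => Set.disjoint_left.2 fun p hp hpy => ?_, ?_⟩
    · rcases (Spec.mem_cells_place _ _ _).1 hp with rfl | rfl
      · exact h1 ⟨y, hy, hpy⟩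
      · exact h2 ⟨y, hy, hpy⟩
    · obtain ⟨y, hy, hyg⟩ := hF.has
      refine ⟨y, hy, q, g.side.opp, g, ?_, by simpa [sub_eq_add_neg] using hyg⟩
      rw [Spec.glueAt_place hsp.wf]
      exact Or.inr ⟨rfl, hg, rfl⟩

/-- The old front and the input glue of the new tile now face each other, so the output glue is the
only one left exposed. -/
theorem Front.attach {A : Set (PlacedTile (Label B))} {q : ℤ × ℤ} {g : Label B}
    (hF : Front A q g) {sp : Spec B} (hsp : Rule prog cap sp) (hg : sp.gin = some g) :
    Front (insert (sp.place q) A) (sp.exit q + sp.gout.side.vec) sp.gout := by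
  constructor
  · refine ⟨_, Set.mem_insert _ _, ?_⟩
    rw [Spec.glueAt_place hsp.wf]
    exact Or.inl ⟨by simp, rfl, rfl⟩
  · rintro y (rfl | hy) p s g' h
    · rw [Spec.glueAt_place hsp.wf] at h
      rcases h with ⟨rfl, rfl, rfl⟩ | ⟨rfl, h1, rfl⟩
      · exact Or.inr ⟨rfl, rfl, rfl⟩
      · left
        obtain ⟨y, hy, hyg⟩ := hF.has
        obtain rfl : g = g' := Option.some_injective _ (hg.symm.trans h1)
        refine ⟨y, Or.inr hy, ?_⟩
        simpa [sub_eq_add_neg] using PlacedTile.mem_cells_of_glueAt hyg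
    · left
      rw [occ_insert_place]
      rcases hF.only y hy p s g' h with h | ⟨h, -⟩
      · exact Or.inr (Or.inr h)
      · exact Or.inl h

theorem Front.stuck {A : Set (PlacedTile (Label B))} {q : ℤ × ℤ} {g : Label B}
    (hF : Front A q g) (h : ∀ sp, Rule prog cap sp → sp.gin ≠ some g) :
    Stuck (tileSet prog cap) A := by
  intro x hx
  obtain ⟨sp, hsp, hg, -⟩ := hF.attaches_iff x |>.1 hx
  exact h sp hsp hg

/-- `B` arises from `A` by an attachment, which is the only possible one if `det` holds. -/
def Grows {G : Type*} (T : Set (PolyominoTile G)) (det : Prop) (A B : Set (PlacedTile G)) : Prop :=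
  ∃ x, Attaches T A x ∧ B = insert x A ∧ (det → ∀ y, Attaches T A y → y = x)

/-- The positions at which a path has entered a column with a marked label. -/
def marks {Mk : Type*} (mark : B → Option Mk) (A : Set (PlacedTile (Label B))) :
    Set ((ℤ × ℤ) × Mk) :=
  {h | ∃ y ∈ A, ∃ r β, y.glueAt h.1 (fwd r).opp = some ⟨r, β, .enter⟩ ∧ mark β = some h.2}

/-- Marks sit on the edge that faces against the walking direction, where input glues are. An output
glue with an `enter` stage is on the opposite side, so a tile contributes only the mark of its own
input label. -/
theorem marks_insert {Mk : Type*} (mark : B → Option Mk) (A : Set (PlacedTile (Label B)))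
    {sp : Spec B} (hsp : Rule prog cap sp) (q : ℤ × ℤ) :
    marks mark (insert (sp.place q) A) = marks mark A ∪
      {h | h.1 = q ∧ ∃ r β, sp.gin = some ⟨r, β, .enter⟩ ∧ mark β = some h.2} := by
  ext ⟨p, μ⟩
  simp only [marks, Set.mem_insert_iff, Set.mem_ofPred_eq, Set.mem_union]
  constructor
  · rintro ⟨y, rfl | hy, r, β, h1, h2⟩
    · rw [Spec.glueAt_place hsp.wf] at h1
      rcases h1 with ⟨-, h3, h4⟩ | ⟨h3, h4, -⟩
      · rw [← h4] at h3
        exact absurd h3 (Side.opp_ne _)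
      · exact Or.inr ⟨h3, r, β, h4, h2⟩
    · exact Or.inl ⟨y, hy, r, β, h1, h2⟩
  · rintro (⟨y, hy, r, β, h1, h2⟩ | ⟨rfl, r, β, h1, h2⟩)
    · exact ⟨y, Or.inr hy, r, β, h1, h2⟩
    · refine ⟨_, Or.inl rfl, r, β, ?_, h2⟩
      rw [Spec.glueAt_place hsp.wf]
      exact Or.inr ⟨rfl, h1, rfl⟩

theorem marks_insert_inner {Mk : Type*} (mark : B → Option Mk) (A : Set (PlacedTile (Label B)))
    {sp : Spec B} (hsp : Rule prog cap sp) (q : ℤ × ℤ)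
    (h : ∀ r β, sp.gin ≠ some ⟨r, β, .enter⟩) :
    marks mark (insert (sp.place q) A) = marks mark A := by
  rw [marks_insert mark A hsp]
  simp [h]

end PolyTAM

namespace PolyTAM

variable {B : Type} {prog : B → Set (Instr B)} {cap : B}

/-! ### The geometry of columns -/

/-- The displacement to the next column. -/
def sg (r : Bool) : ℤ := if r then 1 else -1

/-- The abscissa of the `u`-th square, in walking order, of column `j`. -/
def xpos (r : Bool) (j u : ℤ) : ℤ := if r then 3 * j + u else 3 * j + 2 - u

/-- A path that walks in direction `r` and enters column `j` has passed column `c`. -/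
def Passed (r : Bool) (j c : ℤ) : Prop := if r then c < j else j < c

instance (r : Bool) (j c : ℤ) : Decidable (Passed r j c) := by unfold Passed; infer_instance

theorem Passed.ne {r : Bool} {j c : ℤ} (h : Passed r j c) : c ≠ j := by
  rintro rfl
  cases r <;> simp [Passed] at h

theorem passed_next_iff (r : Bool) (j c : ℤ) : Passed r (j + sg r) c ↔ Passed r j c ∨ c = j := by
  cases r <;> simp [Passed, sg] <;> omega

/-- A turn exchanges ahead and behind; the column `j` in which the path turns lies behind
afterwards. -/
theorem passed_turn_iff (r : Bool) (j c : ℤ) : Passed (!r) (j - sg r) c ↔ ¬ Passed r j c := by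
  cases r <;> simp [Passed, sg]

theorem xpos_not (r : Bool) (j u : ℤ) : xpos (!r) j u = xpos r j (2 - u) := by
  cases r <;> simp [xpos] <;> ring

@[simp]
theorem xpos_inj {r : Bool} {j u v : ℤ} : xpos r j u = xpos r j v ↔ u = v := by
  cases r <;> simp [xpos]

theorem xpos_ne {r : Bool} {j c u v : ℤ} (hc : c ≠ j) (hu : 0 ≤ u) (hu' : u < 3) (hv : 0 ≤ v)
    (hv' : v < 3) : xpos r c u ≠ xpos r j v := by
  cases r <;> simp only [xpos, Bool.false_eq_true, if_true, if_false] <;> omega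

theorem xpos_add_fwd {r : Bool} {j u v y : ℤ} (h : u + 1 = v) :
    (xpos r j u, y) + (fwd r).vec = (xpos r j v, y) := by
  subst h
  cases r <;> simp [xpos, fwd, Side.vec] <;> ring

theorem xpos_two_add_fwd {r : Bool} {j y : ℤ} :
    (xpos r j 2, y) + (fwd r).vec = (xpos r (j + sg r) 0, y) := by
  cases r <;> simp [xpos, fwd, sg, Side.vec] <;> ring

theorem xpos_add_fwd_not {r : Bool} {j y : ℤ} :
    (xpos r j 0, y) + (fwd (!r)).vec = (xpos (!r) (j - sg r) 0, y) := by
  cases r <;> simp [xpos, fwd, sg, Side.vec] <;> ring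

theorem xpos_add_north {r : Bool} {j u y z : ℤ} (h : y + 1 = z) :
    (xpos r j u, y) + Side.north.vec = (xpos r j u, z) := by
  subst h
  simp [Side.vec]

theorem xpos_add_south {r : Bool} {j u y z : ℤ} (h : z + 1 = y) :
    (xpos r j u, y) + Side.south.vec = (xpos r j u, z) := by
  subst h
  simp [Side.vec]

/-- The set `O` of covered squares encodes the bits `cols` in the columns; a path in direction `r`
that walks on the rows `h + 1` and `h + 2` is about to enter column `j`. -/
structure Geom (O : Set (ℤ × ℤ)) (r : Bool) (h j : ℤ) (cols : ℤ → Option Bool) : Prop where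
  ahead_bound : ∀ c u y, ¬ Passed r j c → 0 ≤ u → u < 3 → (xpos r c u, y) ∈ O →
    y ≤ h ∨ (y = h + 1 ∧ u = 1 ∧ cols c = some true)
  ahead_hole : ∀ c b, ¬ Passed r j c → cols c = some b → ((xpos r c 0, h) ∈ O ↔ b = false)
  ahead_bump : ∀ c, ¬ Passed r j c → cols c = some true → (xpos r c 1, h + 1) ∈ O
  behind_bound : ∀ c u y, Passed r j c → 0 ≤ u → u < 3 → (xpos r c u, y) ∈ O →
    y ≤ h + 2 ∨ (y = h + 3 ∧ u = 1 ∧ cols c = some true)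
  behind_hole : ∀ c b, Passed r j c → cols c = some b → ((xpos r c 2, h + 2) ∈ O ↔ b = false)
  behind_bump : ∀ c, Passed r j c → cols c = some true → (xpos r c 1, h + 3) ∈ O

namespace Geom

variable {O O' : Set (ℤ × ℤ)} {r : Bool} {h j : ℤ} {cols : ℤ → Option Bool}

/-- Crossing column `j` alters the covered squares in this column only and moves it from ahead to
behind. The hypotheses `h1`, `h2`, `h3` say that its new outline encodes `v`. -/
theorem update (hG : Geom O r h j cols) (v : Option Bool)
    (hO : ∀ c u y, c ≠ j → 0 ≤ u → u < 3 → ((xpos r c u, y) ∈ O' ↔ (xpos r c u, y) ∈ O))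
    (h1 : ∀ u y, 0 ≤ u → u < 3 → (xpos r j u, y) ∈ O' →
      y ≤ h + 2 ∨ (y = h + 3 ∧ u = 1 ∧ v = some true))
    (h2 : ∀ b, v = some b → ((xpos r j 2, h + 2) ∈ O' ↔ b = false))
    (h3 : v = some true → (xpos r j 1, h + 3) ∈ O') :
    Geom O' r h (j + sg r) (Function.update cols j v) := by
  constructor <;> intro c <;> simp only [passed_next_iff] <;> rcases eq_or_ne c j with rfl | hc
  · simp
  · intro u y hp hu hu'
    simp only [hc, or_false] at hp
    rw [hO c u y hc hu hu', Function.update_of_ne hc]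
    exact hG.ahead_bound c u y hp hu hu'
  · simp
  · intro b hp
    simp only [hc, or_false] at hp
    rw [hO c 0 h hc (by omega) (by omega), Function.update_of_ne hc]
    exact hG.ahead_hole c b hp
  · simp
  · intro hp
    simp only [hc, or_false] at hp
    rw [hO c 1 _ hc (by omega) (by omega), Function.update_of_ne hc]
    exact hG.ahead_bump c hp
  · intro u y _ hu hu'
    rw [Function.update_self]
    exact h1 u y hu hu'
  · intro u y hp hu hu'
    simp only [hc, or_false] at hp
    rw [hO c u y hc hu hu', Function.update_of_ne hc]
    exact hG.behind_bound c u y hp hu hu'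
  · intro b _
    rw [Function.update_self]
    exact h2 b
  · intro b hp
    simp only [hc, or_false] at hp
    rw [hO c 2 _ hc (by omega) (by omega), Function.update_of_ne hc]
    exact hG.behind_hole c b hp
  · intro _
    rw [Function.update_self]
    exact h3
  · intro hp
    simp only [hc, or_false] at hp
    rw [hO c 1 _ hc (by omega) (by omega), Function.update_of_ne hc]
    exact hG.behind_bump c hp

/-- The base row rises by 2 and square `u` becomes square `2 - u`. A hole in the last square of a
passed column thus becomes a hole below the entry square of the new sweep, and a bump in row `h + 3`
stands one row above the new base. The remaining columns, including the one with the turn, now lie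
behind and need not encode anything. -/
theorem turn (hG : Geom O r h j cols)
    (hO : ∀ c u y, c ≠ j → 0 ≤ u → u < 3 → ((xpos r c u, y) ∈ O' ↔ (xpos r c u, y) ∈ O))
    (h1 : ∀ u y, 0 ≤ u → u < 3 → (xpos r j u, y) ∈ O' → y ≤ h + 4) :
    Geom O' (!r) (h + 2) (j - sg r) fun c => if Passed r j c then cols c else none := by
  constructor <;> intro c <;> simp only [passed_turn_iff, not_not, xpos_not]
  · intro u y hp hu hu'
    rw [hO c _ y hp.ne (by omega) (by omega), if_pos hp]
    intro hm
    rcases hG.behind_bound c _ y hp (by omega) (by omega) hm with h | ⟨h, h', h''⟩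
    · exact Or.inl h
    · exact Or.inr ⟨by omega, by omega, h''⟩
  · intro b hp
    rw [if_pos hp, hO c _ _ hp.ne (by omega) (by omega)]
    exact hG.behind_hole c b hp
  · intro hp
    rw [if_pos hp, hO c _ _ hp.ne (by omega) (by omega), show h + 2 + 1 = h + 3 by ring]
    exact hG.behind_bump c hp
  · intro u y hp hu hu' hm
    left
    rcases eq_or_ne c j with rfl | hc
    · have := h1 _ y (by omega) (by omega) hm
      omega
    · rw [hO c _ y hc (by omega) (by omega)] at hm
      rcases hG.ahead_bound c _ y hp (by omega) (by omega) hm with h | ⟨h, -⟩ <;> omega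
  · intro b hp
    simp [hp]
  · intro hp
    simp [hp]

theorem bound_self (hG : Geom O r h j cols) {u y : ℤ} (hu : 0 ≤ u) (hu' : u < 3)
    (hm : (xpos r j u, y) ∈ O) : y ≤ h ∨ (y = h + 1 ∧ u = 1 ∧ cols j = some true) :=
  hG.ahead_bound j u y (fun hp => hp.ne rfl) hu hu' hm

theorem notMem_of_lt (hG : Geom O r h j cols) (hj : cols j ≠ some true) {u y : ℤ} (hu : 0 ≤ u)
    (hu' : u < 3) (hy : h < y) : (xpos r j u, y) ∉ O := by
  intro hm
  have := hG.bound_self hu hu' hm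
  simp only [hj, and_false, or_false] at this
  omega

end Geom

/-! ### Gadgets -/

/-- In `hu` a competitor has to be excluded only if its second square is free; this is where
blocking enters. -/
theorem Front.grow {A : Set (PlacedTile (Label B))} {q : ℤ × ℤ} {g : Label B}
    (hF : Front A q g) {sp : Spec B} (hsp : Rule prog cap sp) (hg : sp.gin = some g)
    {q₂ q' : ℤ × ℤ} (hq₂ : q + sp.ext.vec = q₂) (hq' : sp.exit q + sp.gout.side.vec = q')
    (h1 : q ∉ occ A) (h2 : q₂ ∉ occ A) {det : Prop}
    (hu : det → ∀ sp', Rule prog cap sp' → sp'.gin = some g → q + sp'.ext.vec ∉ occ A → sp' = sp) :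
    Grows (tileSet prog cap) det A (insert (sp.place q) A) ∧
      Front (insert (sp.place q) A) q' sp.gout ∧
      occ (insert (sp.place q) A) = insert q (insert q₂ (occ A)) := by
  subst hq₂ hq'
  refine ⟨⟨sp.place q, ?_, rfl, fun hd y hy => ?_⟩, hF.attach hsp hg, occ_insert_place _ _ _⟩
  · rw [hF.attaches_iff]
    exact ⟨sp, hsp, hg, rfl, h1, h2⟩
  · obtain ⟨sp', hsp', hg', rfl, -, h3⟩ := (hF.attaches_iff y).1 hy
    rw [hu hd sp' hsp' hg' h3]

/-- The tiles that write a bit in column `j` on top of row `h`. -/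
noncomputable def writeTiles (r : Bool) (h j : ℤ) (β : B) (b : Bool) (n : B) :
    Set (PlacedTile (Label B)) :=
  if b then
    {Spec.place ⟨fwd r, some ⟨r, β, .v2⟩, true, ⟨r, n, .enter⟩⟩ (xpos r j 1, h + 1),
      Spec.place ⟨.north, some ⟨r, β, .v1⟩, false, ⟨r, β, .v2⟩⟩ (xpos r j 1, h + 2),
      Spec.place ⟨.north, some ⟨r, β, .enter⟩, true, ⟨r, β, .v1⟩⟩ (xpos r j 0, h + 1)}
  else
    {Spec.place ⟨.north, some ⟨r, β, .w2⟩, false, ⟨r, n, .enter⟩⟩ (xpos r j 2, h + 1),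
      Spec.place ⟨.north, some ⟨r, β, .w1⟩, false, ⟨r, β, .w2⟩⟩ (xpos r j 1, h + 1),
      Spec.place ⟨.north, some ⟨r, β, .enter⟩, false, ⟨r, β, .w1⟩⟩ (xpos r j 0, h + 1)}

variable {Mk : Type*} {mark : B → Option Mk} {A : Set (PlacedTile (Label B))} {r : Bool} {h j : ℤ}
  {β n : B} {cols : ℤ → Option Bool} {det : Prop}

/-- The marks that are added when a path enters the square `q` with label `β`. -/
def newMarks (mark : B → Option Mk) (q : ℤ × ℤ) (β : B) : Set ((ℤ × ℤ) × Mk) :=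
  {m | m.1 = q ∧ mark β = some m.2}

theorem marks_insert_enter {sp : Spec B} (hsp : Rule prog cap sp) (q : ℤ × ℤ)
    (hg : sp.gin = some ⟨r, β, .enter⟩) :
    marks mark (insert (sp.place q) A) = marks mark A ∪ newMarks mark q β := by
  rw [marks_insert mark A hsp]
  simp [hg, newMarks]

/-- `A` is the assembly of a path that enters column `j` with label `β` in direction `r` above row
`h`, and it encodes the bits `cols`. -/
structure AtColumn (A : Set (PlacedTile (Label B))) (r : Bool) (h j : ℤ) (β : B)
    (cols : ℤ → Option Bool) : Prop where
  front : Front A (xpos r j 0, h + 1) ⟨r, β, .enter⟩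
  geom : Geom (occ A) r h j cols

/-- Three vertical dominoes side by side fill rows `h + 1` and `h + 2`: no bump, and no hole in the
last square. -/
theorem AtColumn.writeFalse (hA : AtColumn A r h j β cols) (hj : cols j ≠ some true)
    (hp : Instr.write false n ∈ prog β) (hd : det → prog β = {Instr.write false n}) :
    Relation.TransGen (Grows (tileSet prog cap) det) A (writeTiles r h j β false n ∪ A) ∧
      AtColumn (writeTiles r h j β false n ∪ A) r h (j + sg r) n
        (Function.update cols j (some false)) ∧
      marks mark (writeTiles r h j β false n ∪ A) =
        marks mark A ∪ newMarks mark (xpos r j 0, h + 1) β := by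
  obtain ⟨hF, hG⟩ := hA
  have hno : ∀ u y, 0 ≤ u → u < 3 → h < y → (xpos r j u, y) ∉ occ A :=
    fun u y hu hu' hy => hG.notMem_of_lt hj hu hu' hy
  obtain ⟨g1, hF1, hO1⟩ := hF.grow (det := det) (.writeFalse₁ (cap := cap) r β n hp) rfl
    (q₂ := (xpos r j 0, h + 2)) (q' := (xpos r j 1, h + 1)) (xpos_add_north (by ring)) (xpos_add_fwd (by ring))
    (by simp [hno])
    (by simp [hno])
    (by
      intro hd' sp' h' hg' _
      have := hd hd'
      cases h' <;> simp_all)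
  have hm1 := marks_insert_enter (mark := mark) (A := A)
    (.writeFalse₁ (cap := cap) r β n hp) (xpos r j 0, h + 1) rfl
  obtain ⟨g2, hF2, hO2⟩ := hF1.grow (det := det) (.writeFalse₂ (cap := cap) r β n hp) rfl
    (q₂ := (xpos r j 1, h + 2)) (q' := (xpos r j 2, h + 1)) (xpos_add_north (by ring)) (xpos_add_fwd (by ring))
    (by rw [hO1]; simp [hno])
    (by rw [hO1]; simp [hno])
    (by
      intro hd' sp' h' hg' _
      have := hd hd'
      cases h' <;> simp_all)
  obtain ⟨g3, hF3, hO3⟩ := hF2.grow (det := det) (.writeFalse₃ (cap := cap) r β n hp) rfl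
    (q₂ := (xpos r j 2, h + 2)) (q' := (xpos r (j + sg r) 0, h + 1)) (xpos_add_north (by ring)) xpos_two_add_fwd
    (by rw [hO2, hO1]; simp [hno])
    (by rw [hO2, hO1]; simp [hno])
    (by
      intro hd' sp' h' hg' _
      have := hd hd'
      cases h' <;> simp_all)
  rw [hO2, hO1] at hO3
  rw [show writeTiles r h j β false n ∪ A = insert _ (insert _ (insert _ A)) by
    simp only [writeTiles, Bool.false_eq_true, if_false, Set.insert_union, Set.singleton_union]; rfl]
  refine ⟨.tail (.tail (.single g1) g2) g3, ⟨hF3, ?_⟩, ?_⟩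
  · rw [hO3]
    refine hG.update _ ?_ ?_ ?_ (by simp)
    · intro c u y hc hu hu'
      simp [xpos_ne hc hu hu']
    · intro u y hu hu' hm
      left
      by_contra hy
      simp only [Set.mem_insert_iff, Prod.mk.injEq, hno u y hu hu' (by omega), or_false] at hm
      omega
    · intro b hb
      cases hb
      simp
  · rw [marks_insert_inner mark _ (.writeFalse₃ (cap := cap) r β n hp) _ (by simp),
      marks_insert_inner mark _ (.writeFalse₂ (cap := cap) r β n hp) _ (by simp), hm1]

/-- The first domino lifts the path to row `h + 2`, the second stands in the middle on rows `h + 2`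
and `h + 3` and is the bump, and the third continues below it along row `h + 1`. The last square of
row `h + 2` stays free and is the hole. -/
theorem AtColumn.writeTrue (hA : AtColumn A r h j β cols) (hj : cols j ≠ some true)
    (hp : Instr.write true n ∈ prog β) (hd : det → prog β = {Instr.write true n}) :
    Relation.TransGen (Grows (tileSet prog cap) det) A (writeTiles r h j β true n ∪ A) ∧
      AtColumn (writeTiles r h j β true n ∪ A) r h (j + sg r) n
        (Function.update cols j (some true)) ∧
      marks mark (writeTiles r h j β true n ∪ A) =
        marks mark A ∪ newMarks mark (xpos r j 0, h + 1) β := by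
  obtain ⟨hF, hG⟩ := hA
  have hno : ∀ u y, 0 ≤ u → u < 3 → h < y → (xpos r j u, y) ∉ occ A :=
    fun u y hu hu' hy => hG.notMem_of_lt hj hu hu' hy
  obtain ⟨g1, hF1, hO1⟩ := hF.grow (det := det) (.writeTrue₁ (cap := cap) r β n hp) rfl
    (q₂ := (xpos r j 0, h + 2)) (q' := (xpos r j 1, h + 2)) (xpos_add_north (by ring)) (by
      simp only [Spec.exit, if_true, xpos_add_north (show h + 1 + 1 = h + 2 by ring)]
      exact xpos_add_fwd (by ring))
    (by simp [hno])
    (by simp [hno])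
    (by
      intro hd' sp' h' hg' _
      have := hd hd'
      cases h' <;> simp_all)
  have hm1 := marks_insert_enter (mark := mark) (A := A)
    (.writeTrue₁ (cap := cap) r β n hp) (xpos r j 0, h + 1) rfl
  obtain ⟨g2, hF2, hO2⟩ := hF1.grow (det := det) (.writeTrue₂ (cap := cap) r β n hp) rfl
    (q₂ := (xpos r j 1, h + 3)) (q' := (xpos r j 1, h + 1)) (xpos_add_north (by ring)) (xpos_add_south (by ring))
    (by rw [hO1]; simp [hno])
    (by rw [hO1]; simp [hno])
    (by
      intro hd' sp' h' hg' _
      have := hd hd'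
      cases h' <;> simp_all)
  obtain ⟨g3, hF3, hO3⟩ := hF2.grow (det := det) (.writeTrue₃ (cap := cap) r β n hp) rfl
    (q₂ := (xpos r j 2, h + 1)) (q' := (xpos r (j + sg r) 0, h + 1)) (xpos_add_fwd (by ring)) (by
      simp only [Spec.exit, if_true, xpos_add_fwd (show (1 : ℤ) + 1 = 2 by ring)]
      exact xpos_two_add_fwd)
    (by rw [hO2, hO1]; simp [hno])
    (by rw [hO2, hO1]; simp [hno])
    (by
      intro hd' sp' h' hg' _
      have := hd hd'
      cases h' <;> simp_all)
  rw [hO2, hO1] at hO3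
  rw [show writeTiles r h j β true n ∪ A = insert _ (insert _ (insert _ A)) by
    simp only [writeTiles, if_true, Set.insert_union, Set.singleton_union]; rfl]
  refine ⟨.tail (.tail (.single g1) g2) g3, ⟨hF3, ?_⟩, ?_⟩
  · rw [hO3]
    refine hG.update _ ?_ ?_ ?_ (by simp)
    · intro c u y hc hu hu'
      simp [xpos_ne hc hu hu']
    · intro u y hu hu' hm
      by_contra hy
      have hy' : ¬ (y ≤ h + 2) ∧ ¬ (y = h + 3 ∧ u = 1) := by
        simpa only [not_or, and_true] using hy
      simp only [Set.mem_insert_iff, Prod.mk.injEq, hno u y hu hu' (by omega), or_false,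
        xpos_inj] at hm
      omega
    · intro b hb
      cases hb
      simp [hno]
  · rw [marks_insert_inner mark _ (.writeTrue₃ (cap := cap) r β n hp) _ (by simp),
      marks_insert_inner mark _ (.writeTrue₂ (cap := cap) r β n hp) _ (by simp), hm1]

/-- The square below the entry square is covered, so the domino of `readTrue₁`, which points down,
does not fit. -/
theorem AtColumn.readFalse {f : Bool → B} (hA : AtColumn A r h j β cols)
    (hj : cols j = some false) (hp : Instr.read f ∈ prog β) (hd : det → prog β = {Instr.read f}) :
    ∃ A', Relation.TransGen (Grows (tileSet prog cap) det) A A' ∧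
      AtColumn A' r h (j + sg r) (f false) (Function.update cols j none) ∧
      marks mark A' = marks mark A ∪ newMarks mark (xpos r j 0, h + 1) β := by
  obtain ⟨hF, hG⟩ := hA
  have hno : ∀ u y, 0 ≤ u → u < 3 → h < y → (xpos r j u, y) ∉ occ A :=
    fun u y hu hu' hy => hG.notMem_of_lt (by simp [hj]) hu hu' hy
  have hhole : (xpos r j 0, h) ∈ occ A := (hG.ahead_hole j false (fun hp => hp.ne rfl) hj).2 rfl
  obtain ⟨g1, hF1, hO1⟩ := hF.grow (det := det) (.readFalse₁ (cap := cap) r β f hp) rfl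
    (q₂ := (xpos r j 1, h + 1)) (q' := (xpos r j 2, h + 1)) (xpos_add_fwd (by ring)) (by
      simp only [Spec.exit, if_true, xpos_add_fwd (show (0 : ℤ) + 1 = 1 by ring)]
      exact xpos_add_fwd (by ring))
    (by simp [hno])
    (by simp [hno])
    (by
      intro hd' sp' h' hg' hfree
      have := hd hd'
      cases h' <;> simp_all [xpos_add_south (show h + 1 = h + 1 from rfl)])
  have hm1 := marks_insert_enter (mark := mark) (A := A)
    (.readFalse₁ (cap := cap) r β f hp) (xpos r j 0, h + 1) rfl
  obtain ⟨g2, hF2, hO2⟩ := hF1.grow (det := det) (.readFalse₂ (cap := cap) r β f hp) rfl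
    (q₂ := (xpos r j 2, h + 2)) (q' := (xpos r (j + sg r) 0, h + 1)) (xpos_add_north (by ring)) xpos_two_add_fwd
    (by rw [hO1]; simp [hno])
    (by rw [hO1]; simp [hno])
    (by
      intro hd' sp' h' hg' _
      have := hd hd'
      cases h' <;> simp_all)
  rw [hO1] at hO2
  refine ⟨_, .tail (.single g1) g2, ⟨hF2, ?_⟩, ?_⟩
  · rw [hO2]
    refine hG.update _ ?_ ?_ (by simp) (by simp)
    · intro c u y hc hu hu'
      simp [xpos_ne hc hu hu']
    · intro u y hu hu' hm
      left
      by_contra hy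
      simp only [Set.mem_insert_iff, Prod.mk.injEq, hno u y hu hu' (by omega), or_false] at hm
      omega
  · rw [marks_insert_inner mark _ (.readFalse₂ (cap := cap) r β f hp) _ (by simp), hm1]

/-- The bump covers the second square of the domino of `readFalse₁`. The path puts a domino into the
hole instead, crosses the bump in row `h + 2` and comes down again to row `h + 1`, so both gadgets
leave the column in the same row. -/
theorem AtColumn.readTrue {f : Bool → B} (hA : AtColumn A r h j β cols)
    (hj : cols j = some true) (hp : Instr.read f ∈ prog β) (hd : det → prog β = {Instr.read f}) :
    ∃ A', Relation.TransGen (Grows (tileSet prog cap) det) A A' ∧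
      AtColumn A' r h (j + sg r) (f true) (Function.update cols j none) ∧
      marks mark A' = marks mark A ∪ newMarks mark (xpos r j 0, h + 1) β := by
  obtain ⟨hF, hG⟩ := hA
  have hno : ∀ u y, 0 ≤ u → u < 3 → h + 1 < y → (xpos r j u, y) ∉ occ A := by
    intro u y hu hu' hy hm
    have := hG.bound_self hu hu' hm
    omega
  have hno' : ∀ u, 0 ≤ u → u < 3 → u ≠ 1 → (xpos r j u, h + 1) ∉ occ A := by
    intro u hu hu' hy hm
    have := hG.bound_self hu hu' hm
    omega
  have hhole : (xpos r j 0, h) ∉ occ A := by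
    simpa using hG.ahead_hole j true (fun hp => hp.ne rfl) hj
  have hbump : (xpos r j 1, h + 1) ∈ occ A := hG.ahead_bump j (fun hp => hp.ne rfl) hj
  obtain ⟨g1, hF1, hO1⟩ := hF.grow (det := det) (.readTrue₁ (cap := cap) r β f hp) rfl
    (q₂ := (xpos r j 0, h)) (q' := (xpos r j 0, h + 2)) (xpos_add_south (by ring)) (xpos_add_north (by ring))
    (by simp [hno'])
    hhole
    (by
      intro hd' sp' h' hg' hfree
      have := hd hd'
      cases h' <;> simp_all [xpos_add_fwd (show (0 : ℤ) + 1 = 1 by ring)])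
  have hm1 := marks_insert_enter (mark := mark) (A := A)
    (.readTrue₁ (cap := cap) r β f hp) (xpos r j 0, h + 1) rfl
  obtain ⟨g2, hF2, hO2⟩ := hF1.grow (det := det) (.readTrue₂ (cap := cap) r β f hp) rfl
    (q₂ := (xpos r j 1, h + 2)) (q' := (xpos r j 2, h + 2)) (xpos_add_fwd (by ring)) (by
      simp only [Spec.exit, if_true, xpos_add_fwd (show (0 : ℤ) + 1 = 1 by ring)]
      exact xpos_add_fwd (by ring))
    (by rw [hO1]; simp [hno])
    (by rw [hO1]; simp [hno])
    (by
      intro hd' sp' h' hg' _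
      have := hd hd'
      cases h' <;> simp_all)
  obtain ⟨g3, hF3, hO3⟩ := hF2.grow (det := det) (.readTrue₃ (cap := cap) r β f hp) rfl
    (q₂ := (xpos r j 2, h + 1)) (q' := (xpos r (j + sg r) 0, h + 1)) (xpos_add_south (by ring)) (by
      simp only [Spec.exit, if_true, xpos_add_south (show h + 1 + 1 = h + 2 by ring)]
      exact xpos_two_add_fwd)
    (by rw [hO2, hO1]; simp [hno])
    (by rw [hO2, hO1]; simp [hno'])
    (by
      intro hd' sp' h' hg' _
      have := hd hd'
      cases h' <;> simp_all)
  rw [hO2, hO1] at hO3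
  refine ⟨_, .tail (.tail (.single g1) g2) g3, ⟨hF3, ?_⟩, ?_⟩
  · rw [hO3]
    refine hG.update _ ?_ ?_ (by simp) (by simp)
    · intro c u y hc hu hu'
      simp [xpos_ne hc hu hu']
    · intro u y hu hu' hm
      left
      by_contra hy
      simp only [Set.mem_insert_iff, Prod.mk.injEq, hno u y hu hu' (by omega), or_false] at hm
      omega
  · rw [marks_insert_inner mark _ (.readTrue₃ (cap := cap) r β f hp) _ (by simp),
      marks_insert_inner mark _ (.readTrue₂ (cap := cap) r β f hp) _ (by simp), hm1]

/-- Two vertical dominoes are stacked; the path leaves the upper one from its lower square, in row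
`h + 3`, which is the entry row above the new base `h + 2`. -/
theorem AtColumn.turn (hA : AtColumn A r h j β cols) (hj : cols j ≠ some true)
    (hp : Instr.turn n ∈ prog β) (hd : det → prog β = {Instr.turn n}) :
    ∃ A', Relation.TransGen (Grows (tileSet prog cap) det) A A' ∧
      AtColumn A' (!r) (h + 2) (j - sg r) n (fun c => if Passed r j c then cols c else none) ∧
      marks mark A' = marks mark A ∪ newMarks mark (xpos r j 0, h + 1) β := by
  obtain ⟨hF, hG⟩ := hA
  have hno : ∀ u y, 0 ≤ u → u < 3 → h < y → (xpos r j u, y) ∉ occ A :=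
    fun u y hu hu' hy => hG.notMem_of_lt hj hu hu' hy
  obtain ⟨g1, hF1, hO1⟩ := hF.grow (det := det) (.turn₁ (cap := cap) r β n hp) rfl
    (q₂ := (xpos r j 0, h + 2)) (q' := (xpos r j 0, h + 3)) (xpos_add_north (by ring)) (by
      simp only [Spec.exit, if_true, xpos_add_north (show h + 1 + 1 = h + 2 by ring)]
      exact xpos_add_north (by ring))
    (by simp [hno])
    (by simp [hno])
    (by
      intro hd' sp' h' hg' _
      have := hd hd'
      cases h' <;> simp_all)
  have hm1 := marks_insert_enter (mark := mark) (A := A)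
    (.turn₁ (cap := cap) r β n hp) (xpos r j 0, h + 1) rfl
  obtain ⟨g2, hF2, hO2⟩ := hF1.grow (det := det) (.turn₂ (cap := cap) r β n hp) rfl
    (q₂ := (xpos r j 0, h + 4)) (q' := (xpos (!r) (j - sg r) 0, h + 2 + 1)) (xpos_add_north (by ring)) (by
      rw [show h + 2 + 1 = h + 3 by ring]
      exact xpos_add_fwd_not)
    (by rw [hO1]; simp [hno])
    (by rw [hO1]; simp [hno])
    (by
      intro hd' sp' h' hg' _
      have := hd hd'
      cases h' <;> simp_all)
  rw [hO1] at hO2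
  refine ⟨_, .tail (.single g1) g2, ⟨hF2, ?_⟩, ?_⟩
  · rw [hO2]
    refine hG.turn ?_ ?_
    · intro c u y hc hu hu'
      simp [xpos_ne hc hu hu']
    · intro u y hu hu' hm
      by_contra hy
      simp only [Set.mem_insert_iff, Prod.mk.injEq, hno u y hu hu' (by omega), or_false] at hm
      omega
  · rw [marks_insert_inner mark _ (.turn₂ (cap := cap) r β n hp) _ (by simp), hm1]

theorem AtColumn.stuck (hA : AtColumn A r h j β cols) (hp : prog β = ∅) :
    Stuck (tileSet prog cap) A := by
  refine hA.front.stuck fun sp hsp => ?_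
  rintro hg
  cases hsp <;> simp_all

end PolyTAM

namespace PolyTAM

/-! ### The column machine -/

/-- A configuration of the column machine: the walking direction, the row below the path, the
column that the path enters, its label, the bits encoded in the columns and the marks so far. -/
structure ColCfg (B Mk : Type*) where
  r : Bool
  h : ℤ
  j : ℤ
  β : B
  cols : ℤ → Option Bool
  marks : Set ((ℤ × ℤ) × Mk)

section ColumnMachine

variable {B : Type} {Mk : Type*} {prog : B → Set (Instr B)} {cap : B} {mark : B → Option Mk}

/-- One step of the column machine. -/
inductive ColStep (prog : B → Set (Instr B)) (mark : B → Option Mk) :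
    ColCfg B Mk → ColCfg B Mk → Prop
  | read (r h j β cols H f b) (hp : prog β = {Instr.read f}) (hj : cols j = some b) :
      ColStep prog mark ⟨r, h, j, β, cols, H⟩
        ⟨r, h, j + sg r, f b, Function.update cols j none,
          H ∪ newMarks mark (xpos r j 0, h + 1) β⟩
  | write (r h j β cols H b n) (hp : prog β = {Instr.write b n}) (hj : cols j ≠ some true) :
      ColStep prog mark ⟨r, h, j, β, cols, H⟩
        ⟨r, h, j + sg r, n, Function.update cols j (some b),
          H ∪ newMarks mark (xpos r j 0, h + 1) β⟩
  | turn (r h j β cols H n) (hp : prog β = {Instr.turn n}) (hj : cols j ≠ some true) :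
      ColStep prog mark ⟨r, h, j, β, cols, H⟩
        ⟨!r, h + 2, j - sg r, n, fun c => if Passed r j c then cols c else none,
          H ∪ newMarks mark (xpos r j 0, h + 1) β⟩

/-- The assembly `A` represents the configuration `C` of the column machine. -/
structure Represents (mark : B → Option Mk) (A : Set (PlacedTile (Label B)))
    (C : ColCfg B Mk) : Prop where
  atColumn : AtColumn A C.r C.h C.j C.β C.cols
  marks_eq : marks mark A = C.marks

theorem grows_true_iff {G : Type*} {T : Set (PolyominoTile G)} {A A' : Set (PlacedTile G)} :
    Grows T True A A' ↔ Forced T A A' := by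
  simp [Grows, Forced]

/-- A step of the column machine requires a program with a single instruction, so the gadgets apply
with `det := True` and all their attachments are forced. Afterwards the tiles can be forgotten. -/
theorem Represents.step {A : Set (PlacedTile (Label B))} {C C' : ColCfg B Mk}
    (hA : Represents mark A C) (hC : ColStep prog mark C C') :
    ∃ A', Relation.TransGen (Forced (tileSet prog cap)) A A' ∧ Represents mark A' C' := by
  obtain ⟨hA, hm⟩ := hA
  have hG : Grows (tileSet prog cap) True = Forced (tileSet prog cap) := by
    ext A A'
    exact grows_true_iff
  cases hC with
  | read r h j β cols H f b hp hj =>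
    cases b with
    | false =>
      obtain ⟨A', h1, h2, h3⟩ := hA.readFalse (cap := cap) (det := True) (mark := mark) hj
        (by rw [hp]; rfl) fun _ => hp
      exact ⟨A', hG ▸ h1, h2, by rw [h3, hm]⟩
    | true =>
      obtain ⟨A', h1, h2, h3⟩ := hA.readTrue (cap := cap) (det := True) (mark := mark) hj
        (by rw [hp]; rfl) fun _ => hp
      exact ⟨A', hG ▸ h1, h2, by rw [h3, hm]⟩
  | write r h j β cols H b n hp hj =>
    cases b with
    | false =>
      obtain ⟨h1, h2, h3⟩ := hA.writeFalse (cap := cap) (det := True) (mark := mark) hj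
        (by rw [hp]; rfl) fun _ => hp
      exact ⟨_, hG ▸ h1, h2, by rw [h3, hm]⟩
    | true =>
      obtain ⟨h1, h2, h3⟩ := hA.writeTrue (cap := cap) (det := True) (mark := mark) hj
        (by rw [hp]; rfl) fun _ => hp
      exact ⟨_, hG ▸ h1, h2, by rw [h3, hm]⟩
  | turn r h j β cols H n hp hj =>
    obtain ⟨A', h1, h2, h3⟩ := hA.turn (cap := cap) (det := True) (mark := mark) hj
      (by rw [hp]; rfl) fun _ => hp
    exact ⟨A', hG ▸ h1, h2, by rw [h3, hm]⟩

theorem Represents.steps {A : Set (PlacedTile (Label B))} {C C' : ColCfg B Mk}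
    (hA : Represents mark A C) (hC : Relation.ReflTransGen (ColStep prog mark) C C') :
    ∃ A', Relation.ReflTransGen (Forced (tileSet prog cap)) A A' ∧ Represents mark A' C' := by
  induction hC with
  | refl => exact ⟨A, .refl, hA⟩
  | tail _ h ih =>
    obtain ⟨A₁, h1, h2⟩ := ih
    obtain ⟨A₂, h3, h4⟩ := h2.step (cap := cap) h
    exact ⟨A₂, h1.trans h3.to_reflTransGen, h4⟩

theorem Represents.trans_steps {A : Set (PlacedTile (Label B))} {C C' : ColCfg B Mk}
    (hA : Represents mark A C) (hC : Relation.TransGen (ColStep prog mark) C C') :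
    ∃ A', Relation.TransGen (Forced (tileSet prog cap)) A A' ∧ Represents mark A' C' := by
  obtain ⟨D, hD, hDC⟩ := Relation.TransGen.head'_iff.1 hC
  obtain ⟨A₁, h1, h2⟩ := hA.step (cap := cap) hD
  obtain ⟨A₂, h3, h4⟩ := h2.steps (cap := cap) hDC
  exact ⟨A₂, h1.trans_left h3, h4⟩

theorem Represents.stuck {A : Set (PlacedTile (Label B))} {C : ColCfg B Mk}
    (hA : Represents mark A C) (hp : prog C.β = ∅) : Stuck (tileSet prog cap) A :=
  hA.atColumn.stuck hp

theorem newMarks_eq_empty {β : B} (h : mark β = none) (q : ℤ × ℤ) : newMarks mark q β = ∅ := by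
  simp [newMarks, h]

end ColumnMachine

/-! ### The block machine -/

/-- How a path goes on in a state: it reads a block, fills an empty block, turns round, stops, or
fills a block for one of several states. -/
inductive Mode (S : Type)
  | read
  | fill
  | turn (s : S)
  | quit
  | choice (F : Set S)

/-- A machine that sweeps over blocks, each of which encodes a symbol in `K` columns. -/
structure BlockMachine (S Sym : Type) (Mk : Type*) where
  K : ℕ
  code : Sym ≃ Fin K
  dflt : Sym
  tr : S → Sym → Sym × S
  mode : S → Mode S
  mark : S → Sym → Option Mk

/-- The labels of a block machine: reading, writing or filling a block, or entering one. -/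
inductive BlockLabel (S Sym : Type) (K : ℕ)
  | rd (s : S) (m : Fin (K + 1)) (o : Sym)
  | wr (s : S) (m : Fin (K + 1)) (o : Sym)
  | fl (s : S) (m : Fin (K + 1))
  | en (s : S)

instance {S Sym : Type} {K : ℕ} [Finite S] [Finite Sym] : Finite (BlockLabel S Sym K) :=
  Finite.of_injective (β := (S × Fin (K + 1) × Sym) ⊕ (S × Fin (K + 1) × Sym) ⊕
      (S × Fin (K + 1)) ⊕ S)
    (fun
      | .rd s m o => .inl (s, m, o)
      | .wr s m o => .inr (.inl (s, m, o))
      | .fl s m => .inr (.inr (.inl (s, m)))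
      | .en s => .inr (.inr (.inr s)))
    (by rintro (_ | _ | _ | _) (_ | _ | _ | _) h <;> simp_all)

namespace BlockMachine

variable {S Sym : Type} {Mk : Type*} (P : BlockMachine S Sym Mk)

theorem K_pos : 0 < P.K := (P.code P.dflt).pos

/-- A counter in a label. -/
def cnt (m : ℕ) : Fin (P.K + 1) := ⟨min m P.K, by omega⟩

/-- The `m`-th bit of the code of `a`. -/
def bit (a : Sym) (m : ℕ) : Bool := decide ((P.code a : ℕ) = m)

/-- The symbol whose code has its only nonzero bit in position `m`. -/
def sym (m : ℕ) : Sym := if h : m < P.K then P.code.symm ⟨m, h⟩ else P.dflt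

/-- The label with which a path in state `s` enters a block. -/
def entry (s : S) : BlockLabel S Sym P.K :=
  match P.mode s with
  | .read => .rd s (P.cnt 0) P.dflt
  | .fill => .fl s (P.cnt P.K)
  | _ => .en s

/-- The label after `m` bits have been read. -/
def rdLabel (s : S) (m : ℕ) (o : Sym) : BlockLabel S Sym P.K :=
  if m < P.K then .rd s (P.cnt m) o else .wr s (P.cnt P.K) o

/-- The label when `m` bits are still to be written. -/
def wrLabel (s : S) (m : ℕ) (o : Sym) : BlockLabel S Sym P.K :=
  if m = 0 then P.entry (P.tr s o).2 else .wr s (P.cnt m) o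

/-- The label when `m` columns are still to be filled. -/
def flLabel (s : S) (m : ℕ) : BlockLabel S Sym P.K :=
  if m = 0 then .wr s (P.cnt P.K) P.dflt else .fl s (P.cnt m)

/-- The column program of a block machine. -/
def prog : BlockLabel S Sym P.K → Set (Instr (BlockLabel S Sym P.K))
  | .rd s m o => {.read fun b => P.rdLabel s (m + 1) (if b then P.sym m else o)}
  | .wr s m o => {.write (P.bit (P.tr s o).1 (m - 1)) (P.wrLabel s (m - 1) o)}
  | .fl s m => {.write false (P.flLabel s (m - 1))}
  | .en s =>
    match P.mode s with
    | .turn s' => {.turn (P.entry s')}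
    | .choice F => {i | ∃ s' ∈ F, i = .write false (P.flLabel s' (P.K - 1))}
    | _ => ∅

/-- The marks are on the labels with which the writing of a block starts. -/
def markLabel : BlockLabel S Sym P.K → Option Mk
  | .wr s m o => if (m : ℕ) = P.K then P.mark s o else none
  | _ => none

theorem cnt_val {m : ℕ} (h : m ≤ P.K) : (P.cnt m : ℕ) = m := by simp [cnt, h]

theorem sym_code (a : Sym) : P.sym (P.code a) = a := by simp [sym]

theorem markLabel_entry (s : S) : P.markLabel (P.entry s) = none := by
  unfold entry
  split <;> rfl

theorem markLabel_wrLabel {s : S} {m : ℕ} {o : Sym} (h : m < P.K) :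
    P.markLabel (P.wrLabel s m o) = none := by
  unfold wrLabel
  split_ifs
  · exact P.markLabel_entry _
  · simp [markLabel, P.cnt_val h.le, h.ne]

/-- The `p`-th column, in walking order, of block `i`. -/
def col (r : Bool) (i p : ℤ) : ℤ :=
  if r then 2 * P.K * i + p else 2 * P.K * i + (2 * P.K - 1 - p)

/-- Column `c` belongs to block `i`. -/
def InBlock (i c : ℤ) : Prop := 2 * P.K * i ≤ c ∧ c < 2 * P.K * i + 2 * P.K

theorem col_add_sg (r : Bool) (i p : ℤ) : P.col r i p + sg r = P.col r i (p + 1) := by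
  cases r <;> simp [col, sg] <;> ring

theorem col_inj {r : Bool} {i p q : ℤ} : P.col r i p = P.col r i q ↔ p = q := by
  cases r <;> simp [col]

theorem col_not (r : Bool) (i p : ℤ) : P.col (!r) i p = P.col r i (2 * P.K - 1 - p) := by
  cases r <;> simp [col]

theorem inBlock_col {r : Bool} {i p : ℤ} (h : 0 ≤ p) (h' : p < 2 * P.K) :
    P.InBlock i (P.col r i p) := by
  cases r <;> simp only [col, InBlock, Bool.false_eq_true, if_true, if_false] <;> omega

theorem col_next (r : Bool) (i : ℤ) : P.col r i (2 * P.K) = P.col r (i + sg r) 0 := by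
  cases r <;> simp [col, sg] <;> ring

theorem not_inBlock_of_ne {i i' c : ℤ} (hi : i ≠ i') (h : P.InBlock i c) : ¬ P.InBlock i' c := by
  have hK := P.K_pos
  rintro ⟨h1, h2⟩
  obtain ⟨h3, h4⟩ := h
  rcases lt_or_gt_of_ne hi with h | h
  · have : 2 * (P.K : ℤ) * (i + 1) ≤ 2 * P.K * i' :=
      mul_le_mul_of_nonneg_left (by omega) (by positivity)
    rw [mul_add] at this
    omega
  · have : 2 * (P.K : ℤ) * (i' + 1) ≤ 2 * P.K * i :=
      mul_le_mul_of_nonneg_left (by omega) (by positivity)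
    rw [mul_add] at this
    omega

/-- Block `i` is ready for a path in direction `r` to read the symbol `a` in it. -/
def Ready (r : Bool) (cols : ℤ → Option Bool) (i : ℤ) (a : Sym) : Prop :=
  ∀ m : ℕ, m < P.K →
    cols (P.col r i m) = some (P.bit a m) ∧ cols (P.col r i (P.K + m)) ≠ some true

/-- Block `i` does not obstruct a path. -/
def Clear (cols : ℤ → Option Bool) (i : ℤ) : Prop := ∀ c, P.InBlock i c → cols c ≠ some true

/-- The steps of the column machine that carries out `P`. -/
abbrev Reach := Relation.ReflTransGen (ColStep P.prog P.markLabel)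

variable {P} {r : Bool} {h i : ℤ} {s : S} {cols : ℤ → Option Bool} {H : Set ((ℤ × ℤ) × Mk)}

/-- Only one bit of a code is `true`, so the path need not remember the bits: a counter and one
symbol are enough. The symbol is the default until position `P.code a` has been read, and `a` from
then on. -/
theorem reach_read (a : Sym) (hr : ∀ m : ℕ, m < P.K → cols (P.col r i m) = some (P.bit a m))
    {m : ℕ} (hm : m ≤ P.K) :
    ∃ cols', P.Reach ⟨r, h, P.col r i 0, P.rdLabel s 0 P.dflt, cols, H⟩
        ⟨r, h, P.col r i m, P.rdLabel s m (if (P.code a : ℕ) < m then a else P.dflt), cols', H⟩ ∧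
      (∀ p : ℕ, p < m → cols' (P.col r i p) = none) ∧
      ∀ c, (∀ p : ℕ, p < m → c ≠ P.col r i p) → cols' c = cols c := by
  induction m with
  | zero => exact ⟨cols, by simpa using .refl, by simp, by simp⟩
  | succ m ih =>
    obtain ⟨cols', h1, h2, h3⟩ := ih (by omega)
    have hlt : m < P.K := by omega
    refine ⟨Function.update cols' (P.col r i m) none, h1.tail ?_, ?_, ?_⟩
    · have key := ColStep.read (prog := P.prog) (mark := P.markLabel) r h (P.col r i m)
        (P.rdLabel s m (if (P.code a : ℕ) < m then a else P.dflt)) cols' H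
        (fun b => P.rdLabel s (m + 1) (if b then P.sym m else
          (if (P.code a : ℕ) < m then a else P.dflt))) (P.bit a m)
        (by simp [rdLabel, hlt, prog, P.cnt_val hlt.le])
        (by
          rw [h3 _ fun p hp => ?_, hr m hlt]
          rw [Ne, col_inj]
          omega)
      rw [newMarks_eq_empty (by simp [rdLabel, hlt, markLabel]), Set.union_empty, col_add_sg] at key
      convert key using 2
      · push_cast; rfl
      · congr 1
        by_cases hc : (P.code a : ℕ) = m
        · have hs : P.sym m = a := by rw [← hc, P.sym_code]
          simp [bit, hc, hs]
        · simp only [bit, hc, decide_false, Bool.false_eq_true, if_false]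
          congr 1
          exact propext ⟨fun h => by omega, fun h => by omega⟩
    · intro p hp
      rcases Nat.lt_succ_iff_lt_or_eq.1 hp with hp | rfl
      · rw [Function.update_of_ne (by rw [Ne, col_inj]; omega), h2 p hp]
      · simp
    · intro c hc
      rw [Function.update_of_ne (hc m (by omega)), h3 c fun p hp => hc p (by omega)]

/-- Bit `p` goes to position `2 * K - 1 - p`, because the next sweep meets the columns in reverse
order. The induction is on the number of bits still to be written; only the label with all `K` bits
left can carry a mark. -/
theorem reach_write (a : Sym) {m : ℕ} (hm : m ≤ P.K)
    (hc : ∀ p : ℕ, p < m → cols (P.col r i (2 * P.K - 1 - p)) ≠ some true) :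
    ∃ cols', P.Reach ⟨r, h, P.col r i (2 * P.K - m), P.wrLabel s m a, cols, H⟩
        ⟨r, h, P.col r i (2 * P.K), P.entry (P.tr s a).2, cols',
          H ∪ newMarks P.markLabel (xpos r (P.col r i (2 * P.K - m)) 0, h + 1) (P.wrLabel s m a)⟩ ∧
      (∀ p : ℕ, p < m → cols' (P.col r i (2 * P.K - 1 - p)) = some (P.bit (P.tr s a).1 p)) ∧
      ∀ c, (∀ p : ℕ, p < m → c ≠ P.col r i (2 * P.K - 1 - p)) → cols' c = cols c := by
  induction m generalizing cols H with
  | zero =>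
    have hK := P.K_pos
    rw [newMarks_eq_empty (markLabel_wrLabel P hK), Set.union_empty]
    exact ⟨cols, by simpa [wrLabel] using .refl, by simp, by simp⟩
  | succ m ih =>
    have key := ColStep.write (prog := P.prog) (mark := P.markLabel) r h
      (P.col r i (2 * P.K - (m + 1 : ℕ))) (P.wrLabel s (m + 1) a) cols H
      (P.bit (P.tr s a).1 m) (P.wrLabel s m a)
      (by
        rw [wrLabel, if_neg (Nat.succ_ne_zero m)]
        simp [prog, P.cnt_val hm])
      (by
        have := hc m (by omega)
        rwa [show 2 * (P.K : ℤ) - (m + 1 : ℕ) = 2 * P.K - 1 - m by push_cast; ring])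
    obtain ⟨cols', h1, h2, h3⟩ := ih (H := H ∪ newMarks P.markLabel
        (xpos r (P.col r i (2 * P.K - (m + 1 : ℕ))) 0, h + 1) (P.wrLabel s (m + 1) a))
      (cols := Function.update cols (P.col r i (2 * P.K - (m + 1 : ℕ)))
        (some (P.bit (P.tr s a).1 m))) (by omega) fun p hp => by
        rw [Function.update_of_ne (by rw [Ne, col_inj]; push_cast; omega)]
        exact hc p (by omega)
    rw [newMarks_eq_empty (markLabel_wrLabel P (show m < P.K by omega)), Set.union_empty] at h1
    rw [col_add_sg, show 2 * (P.K : ℤ) - (m + 1 : ℕ) + 1 = 2 * P.K - m by push_cast; ring] at key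
    refine ⟨cols', .head key h1, ?_, ?_⟩
    · intro p hp
      rcases Nat.lt_succ_iff_lt_or_eq.1 hp with hp | rfl
      · exact h2 p hp
      · rw [h3 _ fun q hq => by rw [Ne, col_inj]; omega,
          show 2 * (P.K : ℤ) - 1 - p = 2 * P.K - (p + 1 : ℕ) by push_cast; ring,
          Function.update_self]
    · intro c hc'
      rw [h3 c fun p hp => hc' p (by omega), Function.update_of_ne]
      rw [show 2 * (P.K : ℤ) - (m + 1 : ℕ) = 2 * P.K - 1 - m by push_cast; ring]
      exact hc' m (by omega)

/-- A fresh block has no bits to read, so flat columns take the place of the reading gadgets in its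
first half. With nothing left to fill, the label is the one that starts writing after the default
symbol. -/
theorem reach_fill {m : ℕ} (hm : m ≤ P.K)
    (hc : ∀ p : ℕ, p < m → cols (P.col r i (P.K - 1 - p)) ≠ some true) :
    ∃ cols', P.Reach ⟨r, h, P.col r i (P.K - m), P.flLabel s m, cols, H⟩
        ⟨r, h, P.col r i P.K, P.flLabel s 0, cols', H⟩ ∧
      (∀ p : ℕ, p < m → cols' (P.col r i (P.K - 1 - p)) = some false) ∧
      ∀ c, (∀ p : ℕ, p < m → c ≠ P.col r i (P.K - 1 - p)) → cols' c = cols c := by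
  induction m generalizing cols with
  | zero => exact ⟨cols, by simpa using .refl, by simp, by simp⟩
  | succ m ih =>
    have key := ColStep.write (prog := P.prog) (mark := P.markLabel) r h
      (P.col r i (P.K - (m + 1 : ℕ))) (P.flLabel s (m + 1)) cols H false (P.flLabel s m)
      (by
        rw [flLabel, if_neg (Nat.succ_ne_zero m)]
        simp [prog, P.cnt_val hm])
      (by
        have := hc m (by omega)
        rwa [show (P.K : ℤ) - (m + 1 : ℕ) = P.K - 1 - m by push_cast; ring])
    obtain ⟨cols', h1, h2, h3⟩ := ih
      (cols := Function.update cols (P.col r i (P.K - (m + 1 : ℕ))) (some false))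
      (by omega) fun p hp => by
        rw [Function.update_of_ne (by rw [Ne, col_inj]; push_cast; omega)]
        exact hc p (by omega)
    rw [newMarks_eq_empty (by rw [flLabel, if_neg (Nat.succ_ne_zero m)]; rfl), Set.union_empty,
      col_add_sg, show (P.K : ℤ) - (m + 1 : ℕ) + 1 = P.K - m by push_cast; ring] at key
    refine ⟨cols', .head key h1, ?_, ?_⟩
    · intro p hp
      rcases Nat.lt_succ_iff_lt_or_eq.1 hp with hp | rfl
      · exact h2 p hp
      · rw [h3 _ fun q hq => by rw [Ne, col_inj]; omega,
          show (P.K : ℤ) - 1 - p = P.K - (p + 1 : ℕ) by push_cast; ring, Function.update_self]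
    · intro c hc'
      rw [h3 c fun p hp => hc' p (by omega), Function.update_of_ne]
      rw [show (P.K : ℤ) - (m + 1 : ℕ) = P.K - 1 - m by push_cast; ring]
      exact hc' m (by omega)

/-- The mark that a path in state `s` leaves in block `i` when it has read `a`. -/
def blockMarks (P : BlockMachine S Sym Mk) (r : Bool) (h i : ℤ) (s : S) (a : Sym) :
    Set ((ℤ × ℤ) × Mk) :=
  {m | m.1 = (xpos r (P.col r i P.K) 0, h + 1) ∧ P.mark s a = some m.2}

theorem newMarks_wr (q : ℤ × ℤ) (a : Sym) :
    newMarks P.markLabel q (P.wrLabel s P.K a) = {m | m.1 = q ∧ P.mark s a = some m.2} := by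
  simp [newMarks, wrLabel, P.K_pos.ne', markLabel, P.cnt_val le_rfl]

/-- Seen from the other direction, the half just written comes first and is ready to be read. The
half just read encodes nothing and is free to be written on. -/
theorem reach_block {a : Sym} (hs : P.mode s = .read) (hr : P.Ready r cols i a) :
    ∃ cols', P.Reach ⟨r, h, P.col r i 0, P.entry s, cols, H⟩
        ⟨r, h, P.col r (i + sg r) 0, P.entry (P.tr s a).2, cols', H ∪ P.blockMarks r h i s a⟩ ∧
      P.Ready (!r) cols' i (P.tr s a).1 ∧ ∀ c, ¬ P.InBlock i c → cols' c = cols c := by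
  have hK := P.K_pos
  obtain ⟨c1, h1, h2, h3⟩ := reach_read (h := h) (s := s) (H := H) a (fun m hm => (hr m hm).1) le_rfl
  obtain ⟨c2, h4, h5, h6⟩ := reach_write (P := P) (r := r) (i := i) (h := h) (s := s) (H := H)
    (cols := c1) a le_rfl (fun p hp => by
      rw [h3 _ fun q hq => by rw [Ne, col_inj]; omega]
      have := (hr (P.K - 1 - p) (by omega)).2
      rwa [show (P.K : ℤ) + (P.K - 1 - p : ℕ) = 2 * P.K - 1 - p by omega] at this)
  rw [newMarks_wr, show 2 * (P.K : ℤ) - P.K = P.K by ring] at h4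
  refine ⟨c2, ?_, ?_, ?_⟩
  · rw [← col_next]
    refine .trans ?_ h4
    simpa [rdLabel, hK, hK.ne', entry, hs, wrLabel] using h1
  · intro m hm
    rw [col_not, col_not, h5 m hm, h6 _ fun q hq => by rw [Ne, col_inj]; omega]
    refine ⟨rfl, ?_⟩
    have := h2 (P.K - 1 - m) (by omega)
    rw [show ((P.K - 1 - m : ℕ) : ℤ) = 2 * P.K - 1 - (P.K + m) by omega] at this
    simp [this]
  · intro c hc
    rw [h6 c fun p hp => ?_, h3 c fun p hp => ?_]
    · rintro rfl
      exact hc (P.inBlock_col (by omega) (by omega))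
    · rintro rfl
      exact hc (P.inBlock_col (by omega) (by omega))

/-- As for reading a block, with filling in place of reading: the first half now holds only `false`,
which does not obstruct later writing. -/
theorem reach_extend (hs : P.mode s = .fill) (hr : P.Clear cols i) :
    ∃ cols', P.Reach ⟨r, h, P.col r i 0, P.entry s, cols, H⟩
        ⟨r, h, P.col r (i + sg r) 0, P.entry (P.tr s P.dflt).2, cols',
          H ∪ P.blockMarks r h i s P.dflt⟩ ∧
      P.Ready (!r) cols' i (P.tr s P.dflt).1 ∧ ∀ c, ¬ P.InBlock i c → cols' c = cols c := by
  have hK := P.K_pos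
  obtain ⟨c1, h1, h2, h3⟩ := reach_fill (P := P) (r := r) (i := i) (h := h) (s := s) (H := H)
    (cols := cols) le_rfl (fun p hp => hr _ (P.inBlock_col (by omega) (by omega)))
  obtain ⟨c2, h4, h5, h6⟩ := reach_write (P := P) (r := r) (i := i) (h := h) (s := s) (H := H)
    (cols := c1) P.dflt le_rfl (fun p hp => by
      rw [h3 _ fun q hq => by rw [Ne, col_inj]; omega]
      exact hr _ (P.inBlock_col (by omega) (by omega)))
  rw [newMarks_wr, show 2 * (P.K : ℤ) - P.K = P.K by ring] at h4
  refine ⟨c2, ?_, ?_, ?_⟩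
  · rw [← col_next]
    refine .trans ?_ h4
    simpa [flLabel, hK.ne', entry, hs, wrLabel] using h1
  · intro m hm
    rw [col_not, col_not, h5 m hm, h6 _ fun q hq => by rw [Ne, col_inj]; omega]
    refine ⟨rfl, ?_⟩
    have := h2 m hm
    rw [show (P.K : ℤ) - 1 - m = 2 * P.K - 1 - (P.K + m) by ring] at this
    simp [this]
  · intro c hc
    rw [h6 c fun p hp => ?_, h3 c fun p hp => ?_]
    · rintro rfl
      exact hc (P.inBlock_col (by omega) (by omega))
    · rintro rfl
      exact hc (P.inBlock_col (by omega) (by omega))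

end BlockMachine

end PolyTAM

/-! ### Sweeps over intervals of blocks, and turns -/

namespace PolyTAM

namespace BlockMachine

variable {S Sym : Type} {Mk : Type*} {P : BlockMachine S Sym Mk} {r : Bool} {h i : ℤ} {s : S}
  {cols : ℤ → Option Bool} {H : Set ((ℤ × ℤ) × Mk)}

theorem Ready.congr {cols' : ℤ → Option Bool} {a : Sym} (hr : P.Ready r cols i a)
    (hc : ∀ c, P.InBlock i c → cols' c = cols c) : P.Ready r cols' i a := by
  intro m hm
  rw [hc _ (P.inBlock_col (by omega) (by omega)), hc _ (P.inBlock_col (by omega) (by omega))]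
  exact hr m hm

theorem Clear.congr {cols' : ℤ → Option Bool} (hr : P.Clear cols i)
    (hc : ∀ c, P.InBlock i c → cols' c = cols c) : P.Clear cols' i := by
  intro c h
  rw [hc c h]
  exact hr c h

/-- A sweep over `n` blocks. -/
theorem reach_sweep (st : ℤ → S) (sy : ℤ → Sym) (n : ℕ)
    (hs : ∀ p : ℕ, p < n → P.mode (st (i + sg r * p)) = .read)
    (hn : ∀ p : ℕ, p < n →
      (P.tr (st (i + sg r * p)) (sy (i + sg r * p))).2 = st (i + sg r * (p + 1)))
    (hr : ∀ p : ℕ, p < n → P.Ready r cols (i + sg r * p) (sy (i + sg r * p))) :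
    ∃ cols', P.Reach ⟨r, h, P.col r i 0, P.entry (st i), cols, H⟩
        ⟨r, h, P.col r (i + sg r * n) 0, P.entry (st (i + sg r * n)), cols',
          H ∪ {m | ∃ p : ℕ, p < n ∧
            m ∈ P.blockMarks r h (i + sg r * p) (st (i + sg r * p)) (sy (i + sg r * p))}⟩ ∧
      (∀ p : ℕ, p < n → P.Ready (!r) cols' (i + sg r * p)
        (P.tr (st (i + sg r * p)) (sy (i + sg r * p))).1) ∧
      ∀ c, (∀ p : ℕ, p < n → ¬ P.InBlock (i + sg r * p) c) → cols' c = cols c := by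
  have hne : ∀ p q : ℕ, p ≠ q → i + sg r * p ≠ i + sg r * q := by
    intro p q hpq
    cases r <;> simp [sg] <;> omega
  induction n with
  | zero => exact ⟨cols, by simpa using .refl, by simp, by simp⟩
  | succ n ih =>
    obtain ⟨c1, h1, h2, h3⟩ := ih (fun p hp => hs p (by omega)) (fun p hp => hn p (by omega))
      (fun p hp => hr p (by omega))
    obtain ⟨c2, h4, h5, h6⟩ := reach_block (P := P) (cols := c1) (h := h)
      (H := H ∪ {m | ∃ p : ℕ, p < n ∧
            m ∈ P.blockMarks r h (i + sg r * p) (st (i + sg r * p)) (sy (i + sg r * p))})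
      (hs n (by omega))
      ((hr n (by omega)).congr fun c hc => h3 c fun p hp =>
        P.not_inBlock_of_ne (hne n p (by omega)) hc)
    refine ⟨c2, ?_, ?_, ?_⟩
    · have key := h1.trans h4
      rw [hn n (by omega)] at key
      convert key using 2
      · push_cast
        congr 1
        ring
      · push_cast
        rfl
      · ext m
        simp only [Set.mem_union, Set.mem_ofPred_eq, or_assoc]
        refine or_congr_right ?_
        constructor
        · rintro ⟨p, hp, hm⟩
          rcases Nat.lt_succ_iff_lt_or_eq.1 hp with hp | rfl
          · exact Or.inl ⟨p, hp, hm⟩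
          · exact Or.inr hm
        · rintro (⟨p, hp, hm⟩ | hm)
          · exact ⟨p, by omega, hm⟩
          · exact ⟨n, by omega, hm⟩
    · intro p hp
      rcases Nat.lt_succ_iff_lt_or_eq.1 hp with hp | rfl
      · exact (h2 p hp).congr fun c hc => h6 c (P.not_inBlock_of_ne (hne p n (by omega)) hc)
      · exact h5
    · intro c hc
      rw [h6 c (hc n (by omega)), h3 c fun p hp => hc p (by omega)]

/-- The general sweep with blocks indexed by an interval of integers instead of the number of blocks
already crossed. -/
theorem reach_sweep_right {lo hi : ℤ} (hlh : lo ≤ hi) (st : ℤ → S) (sy : ℤ → Sym)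
    (hs : ∀ i, lo ≤ i → i ≤ hi → P.mode (st i) = .read)
    (hn : ∀ i, lo ≤ i → i ≤ hi → (P.tr (st i) (sy i)).2 = st (i + 1))
    (hr : ∀ i, lo ≤ i → i ≤ hi → P.Ready true cols i (sy i)) :
    ∃ cols', P.Reach ⟨true, h, P.col true lo 0, P.entry (st lo), cols, H⟩
        ⟨true, h, P.col true (hi + 1) 0, P.entry (st (hi + 1)), cols',
          H ∪ {m | ∃ i, lo ≤ i ∧ i ≤ hi ∧ m ∈ P.blockMarks true h i (st i) (sy i)}⟩ ∧
      (∀ i, lo ≤ i → i ≤ hi → P.Ready false cols' i (P.tr (st i) (sy i)).1) ∧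
      ∀ c, (∀ i, lo ≤ i → i ≤ hi → ¬ P.InBlock i c) → cols' c = cols c := by
  obtain ⟨n, rfl⟩ : ∃ n : ℕ, hi = lo + n := ⟨(hi - lo).toNat, by omega⟩
  obtain ⟨c1, h1, h2, h3⟩ := reach_sweep (P := P) (r := true) (i := lo) (h := h) (H := H)
    (cols := cols) st sy (n + 1)
    (fun p hp => by simpa [sg] using hs (lo + p) (by omega) (by omega))
    (fun p hp => by simpa [sg, add_assoc] using hn (lo + p) (by omega) (by omega))
    (fun p hp => by simpa [sg] using hr (lo + p) (by omega) (by omega))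
  simp only [sg, if_true, one_mul, Bool.not_true, Nat.cast_add, Nat.cast_one] at h1 h2 h3
  refine ⟨c1, ?_, ?_, ?_⟩
  · convert h1 using 2
    · rw [add_assoc]
    · rw [add_assoc]
    · ext m
      simp only [Set.mem_union, Set.mem_ofPred_eq]
      refine or_congr_right ⟨?_, ?_⟩
      · rintro ⟨i, hi1, hi2, hm⟩
        obtain ⟨p, rfl⟩ : ∃ p : ℕ, i = lo + p := ⟨(i - lo).toNat, by omega⟩
        exact ⟨p, by omega, hm⟩
      · rintro ⟨p, hp, hm⟩
        exact ⟨lo + p, by omega, by omega, hm⟩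
  · intro i hi1 hi2
    obtain ⟨p, rfl⟩ : ∃ p : ℕ, i = lo + p := ⟨(i - lo).toNat, by omega⟩
    exact h2 p (by omega)
  · intro c hc
    exact h3 c fun p hp => hc _ (by omega) (by omega)

theorem reach_sweep_left {lo hi : ℤ} (hlh : lo ≤ hi) (st : ℤ → S) (sy : ℤ → Sym)
    (hs : ∀ i, lo ≤ i → i ≤ hi → P.mode (st i) = .read)
    (hn : ∀ i, lo ≤ i → i ≤ hi → (P.tr (st i) (sy i)).2 = st (i - 1))
    (hr : ∀ i, lo ≤ i → i ≤ hi → P.Ready false cols i (sy i)) :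
    ∃ cols', P.Reach ⟨false, h, P.col false hi 0, P.entry (st hi), cols, H⟩
        ⟨false, h, P.col false (lo - 1) 0, P.entry (st (lo - 1)), cols',
          H ∪ {m | ∃ i, lo ≤ i ∧ i ≤ hi ∧ m ∈ P.blockMarks false h i (st i) (sy i)}⟩ ∧
      (∀ i, lo ≤ i → i ≤ hi → P.Ready true cols' i (P.tr (st i) (sy i)).1) ∧
      ∀ c, (∀ i, lo ≤ i → i ≤ hi → ¬ P.InBlock i c) → cols' c = cols c := by
  obtain ⟨n, rfl⟩ : ∃ n : ℕ, lo = hi - n := ⟨(hi - lo).toNat, by omega⟩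
  have e : ∀ p : ℤ, hi + sg false * p = hi - p := fun p => by simp [sg]; ring
  obtain ⟨c1, h1, h2, h3⟩ := reach_sweep (P := P) (r := false) (i := hi) (h := h) (H := H)
    (cols := cols) st sy (n + 1)
    (fun p hp => by rw [e]; exact hs (hi - p) (by omega) (by omega))
    (fun p hp => by
      rw [e, e, hn (hi - p) (by omega) (by omega)]
      congr 1
      ring)
    (fun p hp => by rw [e]; exact hr (hi - p) (by omega) (by omega))
  simp only [e, Bool.not_false, Nat.cast_add, Nat.cast_one] at h1 h2 h3
  have e' : hi - n - 1 = hi - (n + 1 : ℤ) := by ring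
  refine ⟨c1, ?_, ?_, ?_⟩
  · rw [e']
    convert h1 using 2
    ext m
    simp only [Set.mem_union, Set.mem_ofPred_eq]
    refine or_congr_right ⟨?_, ?_⟩
    · rintro ⟨i, hi1, hi2, hm⟩
      obtain ⟨p, rfl⟩ : ∃ p : ℕ, i = hi - p := ⟨(hi - i).toNat, by omega⟩
      exact ⟨p, by omega, hm⟩
    · rintro ⟨p, hp, hm⟩
      exact ⟨hi - p, by omega, by omega, hm⟩
  · intro i hi1 hi2
    obtain ⟨p, rfl⟩ : ∃ p : ℕ, i = hi - p := ⟨(hi - i).toNat, by omega⟩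
    exact h2 p (by omega)
  · intro c hc
    exact h3 c fun p hp => hc _ (by omega) (by omega)

/-- At the end of a sweep a path turns round. -/
theorem reach_turn {s' : S} (hs : P.mode s = .turn s') (hc : P.Clear cols i) :
    P.Reach ⟨r, h, P.col r i 0, P.entry s, cols, H⟩
      ⟨!r, h + 2, P.col (!r) (i - sg r) 0, P.entry s',
        fun c => if Passed r (P.col r i 0) c then cols c else none, H⟩ := by
  have hK := P.K_pos
  have key := ColStep.turn (prog := P.prog) (mark := P.markLabel) r h (P.col r i 0) (P.entry s)
    cols H (P.entry s') (by simp [entry, hs, prog])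
    (hc _ (P.inBlock_col (by omega) (by omega)))
  rw [newMarks_eq_empty (P.markLabel_entry s), Set.union_empty] at key
  -- The turn takes place in the first column of block `i`; the column before it is the first column
  -- of the preceding block in the new direction.
  convert Relation.ReflTransGen.single key using 2
  cases r <;> simp [col, sg] <;> ring

theorem clear_ite {p : ℤ → Prop} [DecidablePred p] (hc : P.Clear cols i) :
    P.Clear (fun c => if p c then cols c else none) i := by
  intro c h
  by_cases hp : p c
  · simpa [hp] using hc c h
  · simp [hp]

end BlockMachine

/-! ### The block machine of a Turing machine -/

/-- What remains to be done when a sweep to the right has met the head: nothing, a move to the left,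
or the machine has halted. -/
inductive Todo
  | keep | move | halt

/-- The states of the block machine of a Turing machine. -/
inductive SweepState (Q Γ : Type)
  | rBegin (o : Option Q)
  | scan (o : Option Q)
  | carryR (q : Q)
  | copyR (m : Todo)
  | lBegin (mv : Bool)
  | lScan (mv : Bool)
  | carryL (q : Q)
  | extR (m : Todo)
  | extL
  | turnR (m : Todo)
  | turnL
  | turnSeed
  | seedLetter (a : Γ)
  | seedRight
  | seedLeft
  | seedNext

instance : Finite Todo :=
  Finite.of_injective (β := Option Bool)
    (fun | .keep => none | .move => some true | .halt => some false)
    (by rintro (_ | _) (_ | _) h <;> simp_all)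

instance {Q Γ : Type} [Finite Q] [Finite Γ] : Finite (SweepState Q Γ) :=
  Finite.of_injective
    (β := Fin 16 × Option (Option Q) × Option Γ × Option Todo × Option Bool)
    (fun
      | .rBegin o => (0, some o, none, none, none)
      | .scan o => (1, some o, none, none, none)
      | .carryR q => (2, some (some q), none, none, none)
      | .copyR m => (3, none, none, some m, none)
      | .lBegin mv => (4, none, none, none, some mv)
      | .lScan mv => (5, none, none, none, some mv)
      | .carryL q => (6, some (some q), none, none, none)
      | .extR m => (7, none, none, some m, none)
      | .extL => (8, none, none, none, none)
      | .turnR m => (9, none, none, some m, none)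
      | .turnL => (10, none, none, none, none)
      | .turnSeed => (11, none, none, none, none)
      | .seedLetter a => (12, none, some a, none, none)
      | .seedRight => (13, none, none, none, none)
      | .seedLeft => (14, none, none, none, none)
      | .seedNext => (15, none, none, none, none))
    (by
      intro x y h
      cases x <;> cases y <;> simp_all [Prod.ext_iff, Fin.ext_iff])

/-- The symbols of the block machine: contents of tape cells, and `none` for the two ends. -/
abbrev SweepSym (Q Γ : Type) := Option (Γ × Option Q)

namespace Sweep

open SweepState

variable {Q Γ : Type} [Finite Q] [Finite Γ] (M : TuringMachine Q Γ)

/-- A sweep to the right carries out a step of `M` with the head on a cell with symbol `a`. -/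
def exec (q : Q) (a : Γ) : SweepSym Q Γ × SweepState Q Γ :=
  match M.δ q a with
  | none => (some (a, none), copyR .halt)
  | some (q', b, .right) => (some (b, none), carryR q')
  | some (q', b, .left) => (some (b, some q'), copyR .move)

/-- The transition function of the block machine. -/
def tr : SweepState Q Γ → SweepSym Q Γ → SweepSym Q Γ × SweepState Q Γ
  | rBegin o, _ => (none, scan o)
  | scan _, none => (none, scan none)
  | scan none, some (a, none) => (some (a, none), scan none)
  | scan none, some (a, some q) => exec M q a
  | scan (some q), some (a, _) => exec M q a
  | carryR q, some (a, _) => (some (a, some q), copyR .keep)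
  | carryR q, none => (some (M.blank, some q), extR .keep)
  | copyR m, some x => (some x, copyR m)
  | copyR m, none => (some (M.blank, none), extR m)
  | lBegin mv, _ => (none, lScan mv)
  | lScan true, some (a, some q) => (some (a, none), carryL q)
  | lScan mv, some x => (some x, lScan mv)
  | lScan _, none => (some (M.blank, none), extL)
  | carryL q, some (a, _) => (some (a, some q), lScan false)
  | carryL q, none => (some (M.blank, some q), extL)
  | extR m, _ => (none, turnR m)
  | extL, _ => (none, turnL)
  | seedLetter a, _ => (some (a, none), seedNext)
  | seedRight, _ => (none, seedNext)
  | seedLeft, _ => (none, turnSeed)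
  | s, x => (x, s)

/-- How a path goes on in a state. -/
def mode : SweepState Q Γ → Mode (SweepState Q Γ)
  | extR _ | extL | seedLetter _ | seedRight | seedLeft => .fill
  | turnR .halt => .quit
  | turnR .move => .turn (lBegin true)
  | turnR .keep => .turn (lBegin false)
  | turnL => .turn (rBegin none)
  | turnSeed => .turn (rBegin (some M.start))
  | seedNext => .choice (insert seedLeft (Set.range seedLetter))
  | _ => .read

/-- The content of a cell as seen by a sweep to the right. -/
def mark : SweepState Q Γ → SweepSym Q Γ → Option (Γ × Option Q)
  | scan o, some (a, hd) => some (a, o <|> hd)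
  | carryR _, x => x
  | copyR _, x => x
  | _, _ => none

/-- The block machine of a Turing machine. -/
noncomputable def machine : BlockMachine (SweepState Q Γ) (SweepSym Q Γ) (Γ × Option Q) where
  K := Nat.card (SweepSym Q Γ)
  code := Finite.equivFin _
  dflt := none
  tr := tr M
  mode := mode M
  mark := mark

end Sweep

end PolyTAM

/-! ### The sweep to the right -/

namespace PolyTAM

namespace Sweep

open SweepState

variable {Q Γ : Type} [Finite Q] [Finite Γ] {M : TuringMachine Q Γ}

/-- The columns encode the configuration `C` in the blocks between the two ends `lo` and `hi`; at
the start the state `o` is not yet encoded. -/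
structure Row (M : TuringMachine Q Γ) (cols : ℤ → Option Bool) (lo hi : ℤ) (o : Option Q)
    (C : TuringMachine.Config Q Γ) : Prop where
  lo_lt : lo < C.head
  lt_hi : C.head < hi
  left : (machine M).Ready true cols lo none
  right : (machine M).Ready true cols hi none
  cell : ∀ i, lo < i → i < hi → (machine M).Ready true cols i
    (some (C.tape i, if i = C.head ∧ o = none then some C.state else none))
  fresh : ∀ q, o = some q → q = C.state ∧ C.head = lo + 1
  clear : ∀ i, i < lo ∨ hi < i → (machine M).Clear cols i
  blank : ∀ i, i ≤ lo ∨ hi ≤ i → C.tape i = M.blank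

variable {cols : ℤ → Option Bool} {lo hi h : ℤ} {o : Option Q} {C : TuringMachine.Config Q Γ}
  {H : Set ((ℤ × ℤ) × (Γ × Option Q))}

/-- The position of the mark for the content of cell `i`. -/
noncomputable def markPos (M : TuringMachine Q Γ) (h i : ℤ) : ℤ × ℤ :=
  (3 * (2 * (machine M).K * i + (machine M).K), h + 1)

theorem blockMarks_true (i : ℤ) (s : SweepState Q Γ) (a : SweepSym Q Γ) :
    (machine M).blockMarks true h i s a = {m | m.1 = markPos M h i ∧ mark s a = some m.2} := by
  simp [BlockMachine.blockMarks, markPos, xpos, BlockMachine.col, machine]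

/-- Here `hd` is the state left on the current cell and `cr` the state handed to its right
neighbour. A move to the right has only `cr`, a move to the left only `hd` (and `m = .move`),
halting neither. The marker at `hi` becomes a tape cell and a new marker is put in block `hi + 1`,
so a carried head always finds a cell. -/
theorem reach_right (hR : Row M cols lo hi o C) {b : Γ} {hd cr : Option Q} {m : Todo}
    (hex : exec M C.state (C.tape C.head) = (some (b, hd), cr.elim (copyR m) carryR))
    (hcr : ∀ q, cr = some q → m = .keep) :
    ∃ cols', (machine M).Reach
        ⟨true, h, (machine M).col true lo 0, (machine M).entry (rBegin o), cols, H⟩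
        ⟨true, h, (machine M).col true (hi + 2) 0, (machine M).entry (turnR m), cols',
          H ∪ {x | ∃ i, lo < i ∧ i < hi ∧ x = (markPos M h i, C.cell i)}⟩ ∧
      (machine M).Ready false cols' lo none ∧ (machine M).Ready false cols' (hi + 1) none ∧
      (∀ i, lo < i → i ≤ hi → (machine M).Ready false cols' i
        (some (Function.update C.tape C.head b i,
          if i = C.head then hd else if i = C.head + 1 then cr else none))) ∧
      ∀ i, i < lo ∨ hi + 1 < i → (machine M).Clear cols' i := by
  obtain ⟨h1, h2, h3, h4, h5, h6, h7, h8⟩ := hR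
  set st : ℤ → SweepState Q Γ := fun i =>
    if i = lo then rBegin o else if i ≤ C.head then scan o else if i = hi + 1 then extR m
    else if i = C.head + 1 then cr.elim (copyR m) carryR else copyR m with hst
  set sy : ℤ → SweepSym Q Γ := fun i =>
    if i = lo ∨ i = hi then none
    else some (C.tape i, if i = C.head ∧ o = none then some C.state else none) with hsy
  set out : ℤ → SweepSym Q Γ := fun i =>
    if i = lo then none else some (Function.update C.tape C.head b i,
          if i = C.head then hd else if i = C.head + 1 then cr else none) with hout
  have key : ∀ i, lo ≤ i → i ≤ hi → tr M (st i) (sy i) = (out i, st (i + 1)) := by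
    intro i hi1 hi2
    rcases eq_or_lt_of_le hi1 with rfl | hi1
    · simp [hst, hsy, hout, tr, show lo + 1 ≤ C.head by omega]
    have a1 : i ≠ lo := by omega
    have a2 : i + 1 ≠ lo := by omega
    rcases lt_trichotomy i C.head with hc | hc | hc
    -- A start state that is still pending puts the head right after the marker, so there would be
    -- no cell before the head.
    · have ho : o = none := by
        cases o with
        | none => rfl
        | some q => have := (h6 q rfl).2; omega
      simp [hst, hsy, hout, tr, a1, a2, hc.le, hc.ne, ho, show i + 1 ≤ C.head by omega,
        show i ≠ hi by omega, show i ≠ C.head + 1 by omega]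
    · subst hc
      have : tr M (scan o) (some (C.tape C.head, if o = none then some C.state else none)) =
          exec M C.state (C.tape C.head) := by
        cases o with
        | none => simp [tr]
        | some q => simp [tr, (h6 q rfl).1]
      simp [hst, hsy, hout, a1, a2, h2.ne, this, hex]
    · rcases eq_or_lt_of_le hi2 with rfl | hi2
      · have hb := h8 i (Or.inr le_rfl)
        by_cases hc' : i = C.head + 1
        · cases cr with
          | none =>
            simp [hst, hsy, hout, tr, a1, a2, hc.not_ge, hb, hc.ne',
              show ¬ i + 1 ≤ C.head by omega]
          | some q =>
            simp [hst, hsy, hout, tr, a1, a2, hc.not_ge, eq_true hc', hb, hc.ne', hcr q rfl,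
              show ¬ i + 1 ≤ C.head by omega]
        · simp [hst, hsy, hout, tr, a1, a2, hc.not_ge, hc', hb, hc.ne',
            show ¬ i + 1 ≤ C.head by omega]
      · by_cases hc' : i = C.head + 1
        · cases cr with
          | none =>
            simp [hst, hsy, hout, tr, a1, a2, hc.not_ge, hc.ne', hi2.ne,
              show ¬ i + 1 ≤ C.head by omega, show i ≠ hi + 1 by omega]
          | some q =>
            simp [hst, hsy, hout, tr, a1, a2, hc.not_ge, eq_true hc', hc.ne', hi2.ne, hcr q rfl,
              show ¬ i + 1 ≤ C.head by omega, show i ≠ hi + 1 by omega]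
        · simp [hst, hsy, hout, tr, a1, a2, hc.not_ge, hc', hc.ne', hi2.ne,
            show ¬ i + 1 ≤ C.head by omega, show i ≠ hi + 1 by omega]
  have hmode : ∀ i, lo ≤ i → i ≤ hi → (machine M).mode (st i) = .read := by
    intro i hi1 hi2
    have : i ≠ hi + 1 := by omega
    simp only [hst, this, if_false]
    split_ifs <;> first | rfl | (cases cr <;> rfl)
  have hready : ∀ i, lo ≤ i → i ≤ hi → (machine M).Ready true cols i (sy i) := by
    intro i hi1 hi2
    rcases eq_or_ne i lo with rfl | a1
    · simpa [hsy] using h3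
    rcases eq_or_ne i hi with rfl | a2
    · simpa [hsy] using h4
    · simpa [hsy, a1, a2] using h5 i (by omega) (by omega)
  -- The two ends leave no marks: `rBegin` is not a marking state, and the symbol of the marker at
  -- `hi` is `none`.
  have hmark : ∀ i, lo ≤ i → i ≤ hi →
      mark (st i) (sy i) = if lo < i ∧ i < hi then some (C.cell i) else none := by
    intro i hi1 hi2
    rcases eq_or_lt_of_le hi1 with rfl | hi1
    · simp [hst, mark]
    have a1 : i ≠ lo := by omega
    have a3 : i ≠ hi + 1 := by omega
    rcases eq_or_lt_of_le hi2 with rfl | hi2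
    · simp only [hst, hsy, a1, a3, h2.not_ge, if_false, or_true, if_true, lt_irrefl, and_false]
      split_ifs <;> first | rfl | (cases cr <;> rfl)
    simp only [hst, hsy, a1, hi1, hi2, hi2.ne, or_self, if_false, and_self, if_true,
      TuringMachine.Config.cell, a3]
    rcases lt_trichotomy i C.head with hc | hc | hc
    · have ho : o = none := by
        cases o with
        | none => rfl
        | some q => have := (h6 q rfl).2; omega
      simp [hc.le, hc.ne, mark, ho]
    · cases o with
      | none => simp [hc, mark]
      | some q => simp [hc, mark, (h6 q rfl).1]
    · simp only [hc.not_ge, hc.ne', if_false, false_and]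
      split_ifs <;> first | rfl | (cases cr <;> rfl)
  obtain ⟨c1, e1, e2, e3⟩ := BlockMachine.reach_sweep_right (P := machine M) (h := h) (H := H)
    (by omega) st sy hmode (fun i hi1 hi2 => by
      rw [show (machine M).tr = tr M from rfl, key i hi1 hi2]) hready
  have hcl : ∀ i, i < lo ∨ hi < i → (machine M).Clear c1 i := fun i hi' =>
    (h7 i hi').congr fun c hc => e3 c fun j hj1 hj2 =>
      (machine M).not_inBlock_of_ne (by omega) hc
  have est : st (hi + 1) = extR m := by
    simp [hst, show hi + 1 ≠ lo by omega, show ¬ hi + 1 ≤ C.head by omega]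
  obtain ⟨c2, e4, e5, e6⟩ := BlockMachine.reach_extend (P := machine M) (r := true) (h := h)
    (i := hi + 1) (s := extR m) (cols := c1)
    (H := H ∪ {x | ∃ i, lo ≤ i ∧ i ≤ hi ∧ x ∈ (machine M).blockMarks true h i (st i) (sy i)})
    rfl (hcl _ (by omega))
  have hkeep : ∀ i, i ≠ hi + 1 → ∀ c, (machine M).InBlock i c → c2 c = c1 c :=
    fun i hi' c hc => e6 c ((machine M).not_inBlock_of_ne hi' hc)
  refine ⟨c2, ?_, ?_, e5, ?_, ?_⟩
  · rw [est] at e1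
    have e := e1.trans e4
    convert e using 2
    · simp [hst]
    · simp [sg, add_assoc]
    · rfl
    · ext x
      simp only [blockMarks_true, Set.mem_union, Set.mem_ofPred_eq]
      rw [show mark (extR m : SweepState Q Γ) (machine M).dflt = none from rfl]
      simp only [reduceCtorEq, and_false, or_false]
      refine or_congr_right (exists_congr fun i => ?_)
      constructor
      · rintro ⟨hi1, hi2, rfl⟩
        refine ⟨hi1.le, hi2.le, rfl, ?_⟩
        rw [hmark i hi1.le hi2.le, if_pos ⟨hi1, hi2⟩]
      · rintro ⟨hi1, hi2, hx, hx'⟩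
        rw [hmark i hi1 hi2] at hx'
        split_ifs at hx' with hlt
        exact ⟨hlt.1, hlt.2, Prod.ext hx (Option.some_injective _ hx').symm⟩
  · have := e2 lo le_rfl (by omega)
    rw [show (machine M).tr = tr M from rfl, key lo le_rfl (by omega)] at this
    simp only [hout, if_true] at this
    exact this.congr (hkeep lo (by omega))
  · intro i hi1 hi2
    have := e2 i hi1.le hi2
    rw [show (machine M).tr = tr M from rfl, key i hi1.le hi2] at this
    simp only [hout, hi1.ne', if_false] at this
    exact this.congr (hkeep i (by omega))
  · intro i hi'
    exact (hcl i (by omega)).congr (hkeep i (by omega))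

end Sweep

end PolyTAM

/-! ### The sweep to the left and a whole step of the Turing machine -/

namespace PolyTAM

namespace BlockMachine

variable {S Sym : Type} {Mk : Type*} {P : BlockMachine S Sym Mk}

theorem passed_right_of_lt {i i' c : ℤ} (hi : i < i') (hc : P.InBlock i c) :
    Passed true (P.col true i' 0) c := by
  have : 2 * (P.K : ℤ) * (i + 1) ≤ 2 * P.K * i' :=
    mul_le_mul_of_nonneg_left (by omega) (by positivity)
  have := hc.2
  simp only [Passed, col, if_true, add_zero]
  linarith

theorem passed_left_of_lt {i i' c : ℤ} (hi : i' < i) (hc : P.InBlock i c) :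
    Passed false (P.col false i' 0) c := by
  have : 2 * (P.K : ℤ) * (i' + 1) ≤ 2 * P.K * i :=
    mul_le_mul_of_nonneg_left (by omega) (by positivity)
  have := hc.1
  simp only [Passed, col, Bool.false_eq_true, if_false, sub_zero]
  linarith

end BlockMachine

namespace Sweep

open SweepState

variable {Q Γ : Type} [Finite Q] [Finite Γ] {M : TuringMachine Q Γ}
  {cols : ℤ → Option Bool} {lo hi h : ℤ} {o : Option Q} {C : TuringMachine.Config Q Γ}
  {H : Set ((ℤ × ℤ) × (Γ × Option Q))}

/-- If `mv` holds, the state is picked up at `hd` and put down in the next block visited, which is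
the left neighbour. If that block is the marker `lo`, it becomes a blank cell with the head. The
marker is turned into a blank cell in any case, which agrees with the tape by `hblank`. This sweep
leaves no marks. -/
theorem reach_left (mv : Bool) (tape : ℤ → Γ) (hd : ℤ) (q : Q) (h1 : lo < hd) (h2 : hd ≤ hi)
    (hlo : (machine M).Ready false cols lo none)
    (hhi : (machine M).Ready false cols (hi + 1) none)
    (hrow : ∀ i, lo < i → i ≤ hi → (machine M).Ready false cols i
      (some (tape i, if i = hd then some q else none)))
    (hclear : ∀ i, i < lo ∨ hi + 1 < i → (machine M).Clear cols i)
    (hblank : tape lo = M.blank) :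
    ∃ cols', (machine M).Reach
        ⟨false, h, (machine M).col false (hi + 1) 0, (machine M).entry (lBegin mv), cols, H⟩
        ⟨false, h, (machine M).col false (lo - 2) 0, (machine M).entry turnL, cols', H⟩ ∧
      (machine M).Ready true cols' (lo - 1) none ∧ (machine M).Ready true cols' (hi + 1) none ∧
      (∀ i, lo ≤ i → i ≤ hi → (machine M).Ready true cols' i
        (some (tape i, if i = (if mv then hd - 1 else hd) then some q else none))) ∧
      ∀ i, i < lo - 1 ∨ hi + 1 < i → (machine M).Clear cols' i := by
  set st : ℤ → SweepState Q Γ := fun i =>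
    if i = hi + 1 then lBegin mv else if i = lo - 1 then extL else if hd ≤ i then lScan mv
    else if i = hd - 1 ∧ mv = true then carryL q else lScan false with hst
  set sy : ℤ → SweepSym Q Γ := fun i =>
    if i = lo ∨ i = hi + 1 then none
    else some (tape i, if i = hd then some q else none) with hsy
  set out : ℤ → SweepSym Q Γ := fun i =>
    if i = hi + 1 then none
    else some (tape i, if i = (if mv then hd - 1 else hd) then some q else none) with hout
  have key : ∀ i, lo ≤ i → i ≤ hi + 1 → tr M (st i) (sy i) = (out i, st (i - 1)) := by
    intro i hi1 hi2
    rcases eq_or_lt_of_le hi2 with rfl | hi2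
    · simp [hst, hsy, hout, tr, h2, show hi ≠ lo - 1 by omega]
    have a1 : i ≠ hi + 1 := by omega
    have a2 : i - 1 ≠ hi + 1 := by omega
    have a3 : i ≠ lo - 1 := by omega
    rcases eq_or_lt_of_le hi1 with rfl | hi1
    · by_cases hc : lo = hd - 1
      · cases mv
        · simp [hst, hsy, hout, tr, a1, a2, a3, hblank, h1.ne]
        · simp [hst, hsy, hout, tr, a1, a2, a3, hblank, h1.not_ge, eq_true hc]
      · cases mv <;> simp [hst, hsy, hout, tr, a1, a2, a3, hblank, h1.not_ge, h1.ne, hc]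
    have a4 : i ≠ lo := by omega
    have a5 : i - 1 ≠ lo - 1 := by omega
    rcases lt_trichotomy i hd with hc | rfl | hc
    · have b1 : ¬ hd ≤ i - 1 := by omega
      have b2 : i - 1 ≠ hd - 1 := by omega
      by_cases hc' : i = hd - 1
      · cases mv
        · simp [hst, hsy, hout, tr, a1, a2, a3, a4, a5, hc.ne]
        · simp [hst, hsy, hout, tr, a1, a2, a3, a4, a5, b1, b2, hc.not_ge, eq_true hc']
      · cases mv <;> simp [hst, hsy, hout, tr, a1, a2, a3, a4, a5, b1, b2, hc.not_ge, hc.ne, hc']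
    · cases mv <;> simp [hst, hsy, hout, tr, a1, a2, a3, a4, a5, show i ≠ i - 1 by omega]
    · have b1 : hd ≤ i - 1 := by omega
      have b2 : i ≠ hd - 1 := by omega
      cases mv <;> simp [hst, hsy, hout, tr, a1, a2, a3, a4, a5, b1, b2, hc.le, hc.ne']
  have hmode : ∀ i, lo ≤ i → i ≤ hi + 1 → (machine M).mode (st i) = .read := by
    intro i hi1 hi2
    have : i ≠ lo - 1 := by omega
    simp only [hst, this, if_false]
    split_ifs <;> rfl
  have hready : ∀ i, lo ≤ i → i ≤ hi + 1 → (machine M).Ready false cols i (sy i) := by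
    intro i hi1 hi2
    rcases eq_or_ne i lo with rfl | a1
    · simpa [hsy] using hlo
    rcases eq_or_ne i (hi + 1) with rfl | a2
    · simpa [hsy] using hhi
    · simpa [hsy, a1, a2] using hrow i (by omega) (by omega)
  have hmark : ∀ i, lo ≤ i → i ≤ hi + 1 → mark (st i) (sy i) = none := by
    intro i hi1 hi2
    have : i ≠ lo - 1 := by omega
    simp only [hst, this, if_false]
    split_ifs <;> rfl
  obtain ⟨c1, e1, e2, e3⟩ := BlockMachine.reach_sweep_left (P := machine M) (h := h) (H := H)
    (by omega) st sy hmode (fun i hi1 hi2 => by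
      rw [show (machine M).tr = tr M from rfl, key i hi1 hi2]) hready
  have hcl : ∀ i, i < lo ∨ hi + 1 < i → (machine M).Clear c1 i := fun i hi' =>
    (hclear i hi').congr fun c hc => e3 c fun j hj1 hj2 =>
      (machine M).not_inBlock_of_ne (by omega) hc
  have est : st (lo - 1) = extL := by simp [hst, show lo - 1 ≠ hi + 1 by omega]
  have emark : {x | ∃ i, lo ≤ i ∧ i ≤ hi + 1 ∧
      x ∈ (machine M).blockMarks false h i (st i) (sy i)} = ∅ := by
    ext x
    simp only [BlockMachine.blockMarks, Set.mem_ofPred_eq, Set.mem_empty_iff_false, iff_false,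
      not_exists, not_and]
    intro i hi1 hi2 _
    rw [show (machine M).mark = mark from rfl, hmark i hi1 hi2]
    simp
  obtain ⟨c2, e4, e5, e6⟩ := BlockMachine.reach_extend (P := machine M) (r := false) (h := h)
    (i := lo - 1) (s := extL) (cols := c1) (H := H) rfl (hcl _ (by omega))
  have hkeep : ∀ i, i ≠ lo - 1 → ∀ c, (machine M).InBlock i c → c2 c = c1 c :=
    fun i hi' c hc => e6 c ((machine M).not_inBlock_of_ne hi' hc)
  refine ⟨c2, ?_, e5, ?_, ?_, ?_⟩
  · rw [est, emark, Set.union_empty] at e1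
    have e := e1.trans e4
    convert e using 2
    · simp [hst]
    · simp [sg]
      congr 1
      ring
    · rfl
    · simp [BlockMachine.blockMarks, show (machine M).mark = mark from rfl, mark]
  · have := e2 (hi + 1) (by omega) le_rfl
    rw [show (machine M).tr = tr M from rfl, key (hi + 1) (by omega) le_rfl] at this
    simp only [hout, if_true] at this
    exact this.congr (hkeep (hi + 1) (by omega))
  · intro i hi1 hi2
    have := e2 i hi1 (by omega)
    rw [show (machine M).tr = tr M from rfl, key i hi1 (by omega)] at this
    simp only [hout, show i ≠ hi + 1 by omega, if_false] at this
    exact this.congr (hkeep i (by omega))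
  · intro i hi'
    exact (hcl i (by omega)).congr (hkeep i (by omega))

/-- The marks that a sweep to the right over the configuration `C` leaves. -/
def rowMarks (M : TuringMachine Q Γ) (C : TuringMachine.Config Q Γ) (lo hi h : ℤ) :
    Set ((ℤ × ℤ) × (Γ × Option Q)) :=
  {x | ∃ i, lo < i ∧ i < hi ∧ x = (markPos M h i, C.cell i)}

/-- The missing transition is noticed at the head, but the sweep is completed before the path ends,
so that all cells of the last configuration are marked. -/
theorem reach_halt (hR : Row M cols lo hi o C) (hM : M.step C = none) :
    ∃ D, (machine M).Reach
        ⟨true, h, (machine M).col true lo 0, (machine M).entry (rBegin o), cols, H⟩ D ∧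
      (machine M).prog D.β = ∅ ∧ D.marks = H ∪ rowMarks M C lo hi h := by
  have hex : exec M C.state (C.tape C.head) =
      (some (C.tape C.head, none), (none : Option Q).elim (copyR .halt) carryR) := by
    simp only [TuringMachine.step, Option.map_eq_none_iff] at hM
    simp [exec, hM]
  obtain ⟨c1, e1, -⟩ := reach_right (h := h) (H := H) hR hex (by simp)
  exact ⟨_, e1, rfl, rfl⟩

theorem reach_step {C' : TuringMachine.Config Q Γ} (hR : Row M cols lo hi o C)
    (hM : M.step C = some C') :
    ∃ cols', (machine M).Reach
        ⟨true, h, (machine M).col true lo 0, (machine M).entry (rBegin o), cols, H⟩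
        ⟨true, h + 4, (machine M).col true (lo - 1) 0, (machine M).entry (rBegin none), cols',
          H ∪ rowMarks M C lo hi h⟩ ∧
      Row M cols' (lo - 1) (hi + 1) none C' := by
  obtain ⟨⟨q', b, d⟩, hδ, rfl⟩ : ∃ x, M.δ C.state (C.tape C.head) = some x ∧
      C' = { state := x.1, head := C.head + TuringMachine.dirVal x.2.2,
              tape := Function.update C.tape C.head x.2.1 } := by
    simp only [TuringMachine.step, Option.map_eq_some_iff] at hM
    obtain ⟨x, hx, rfl⟩ := hM
    exact ⟨x, hx, rfl⟩
  have hlo := hR.lo_lt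
  have hhi := hR.lt_hi
  -- Both directions in one form: `hd` is the block that holds the new state after the sweep to the
  -- right, and `mv` says whether it still has to move to the left. For a left move `hd` is the old
  -- head position, for a right move the next one.
  obtain ⟨mv, hd, hd', hmd⟩ : ∃ (mv : Bool) (hd : ℤ), lo < hd ∧ hd ≤ hi ∧
      C.head + TuringMachine.dirVal d = (if mv then hd - 1 else hd) ∧
      ∃ cols', (machine M).Reach
        ⟨true, h, (machine M).col true lo 0, (machine M).entry (rBegin o), cols, H⟩
        ⟨true, h, (machine M).col true (hi + 2) 0,
          (machine M).entry (turnR (if mv then .move else .keep)), cols',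
          H ∪ rowMarks M C lo hi h⟩ ∧
      (machine M).Ready false cols' lo none ∧ (machine M).Ready false cols' (hi + 1) none ∧
      (∀ i, lo < i → i ≤ hi → (machine M).Ready false cols' i
        (some (Function.update C.tape C.head b i, if i = hd then some q' else none))) ∧
      ∀ i, i < lo ∨ hi + 1 < i → (machine M).Clear cols' i := by
    cases d with
    | left =>
      have hex : exec M C.state (C.tape C.head) =
          (some (b, some q'), (none : Option Q).elim (copyR .move) carryR) := by
        simp [exec, hδ]
      obtain ⟨c1, e⟩ := reach_right (h := h) (H := H) hR hex (by simp)
      refine ⟨true, C.head, hlo, hhi.le, by simp [TuringMachine.dirVal, sub_eq_add_neg], c1, ?_⟩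
      simpa [rowMarks] using e
    | right =>
      have hex : exec M C.state (C.tape C.head) =
          (some (b, none), (some q').elim (copyR .keep) carryR) := by
        simp [exec, hδ]
      obtain ⟨c1, e1, e2, e3, e4, e5⟩ := reach_right (h := h) (H := H) hR hex (by simp)
      refine ⟨false, C.head + 1, by omega, by omega, by simp [TuringMachine.dirVal], c1, e1, e2, e3,
        fun i hi1 hi2 => ?_, e5⟩
      have := e4 i hi1 hi2
      rwa [show (if i = C.head then none else if i = C.head + 1 then some q' else none) =
        if i = C.head + 1 then some q' else none by split_ifs <;> first | rfl | omega] at this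
  obtain ⟨hd2, hhead, c1, e1, e2, e3, e4, e5⟩ := hmd
  have e6 := BlockMachine.reach_turn (P := machine M) (r := true) (h := h)
    (H := H ∪ rowMarks M C lo hi h) (s := turnR (if mv then .move else .keep)) (s' := lBegin mv)
    (cols := c1) (i := hi + 2) (by cases mv <;> rfl) (e5 _ (by omega))
  rw [show hi + 2 - sg true = hi + 1 by simp [sg]; ring] at e6
  -- The turn clears only columns that were not passed, hence none in the blocks of the row.
  have hk : ∀ i, i ≤ hi + 1 → ∀ c, (machine M).InBlock i c →
      (if Passed true ((machine M).col true (hi + 2) 0) c then c1 c else none) = c1 c :=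
    fun i hi' c hc => if_pos (BlockMachine.passed_right_of_lt (by omega) hc)
  obtain ⟨c2, f1, f2, f3, f4, f5⟩ := reach_left (M := M) (h := h + 2) (lo := lo) (hi := hi)
    (H := H ∪ rowMarks M C lo hi h)
    (cols := fun c => if Passed true ((machine M).col true (hi + 2) 0) c then c1 c else none)
    mv (Function.update C.tape C.head b) hd q' hd' hd2 (e2.congr (hk _ (by omega)))
    (e3.congr (hk _ le_rfl)) (fun i hi1 hi2 => (e4 i hi1 hi2).congr (hk _ (by omega)))
    (fun i hi' => BlockMachine.clear_ite (e5 i hi'))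
    (by rw [Function.update_of_ne hlo.ne]; exact hR.blank lo (Or.inl le_rfl))
  have e7 := BlockMachine.reach_turn (P := machine M) (r := false) (h := h + 2)
    (H := H ∪ rowMarks M C lo hi h) (s := turnL) (s' := rBegin none)
    (cols := c2) (i := lo - 2) rfl (f5 _ (by omega))
  rw [show lo - 2 - sg false = lo - 1 by simp [sg]; ring, add_assoc] at e7
  have hk' : ∀ i, lo - 1 ≤ i → ∀ c, (machine M).InBlock i c →
      (if Passed false ((machine M).col false (lo - 2) 0) c then c2 c else none) = c2 c :=
    fun i hi' c hc => if_pos (BlockMachine.passed_left_of_lt (by omega) hc)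
  refine ⟨_, ((e1.trans e6).trans f1).trans e7, ?_⟩
  constructor
  · simp only [hhead]
    cases mv <;> simp <;> omega
  · simp only [hhead]
    cases mv <;> simp <;> omega
  · exact f2.congr (hk' _ le_rfl)
  · exact f3.congr (hk' _ (by omega))
  · intro i hi1 hi2
    simp only [hhead, and_true]
    exact (f4 i (by omega) (by omega)).congr (hk' _ (by omega))
  · simp
  · intro i hi'
    exact BlockMachine.clear_ite (f5 i (by omega))
  · intro i hi'
    simp only
    rw [Function.update_of_ne (by omega)]
    exact hR.blank i (by omega)

end Sweep

end PolyTAM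

/-! ### The blocks of the seed -/

namespace PolyTAM

theorem Built.grows {G : Type*} {T : Set (PolyominoTile G)} {det : Prop}
    {A A' : Set (PlacedTile G)} (h : Built T A) (hA : Relation.TransGen (Grows T det) A A') :
    Built T A' := by
  induction hA with
  | single hx =>
    obtain ⟨x, hx, rfl, -⟩ := hx
    exact .attach _ x h hx
  | tail _ hx ih =>
    obtain ⟨x, hx, rfl, -⟩ := hx
    exact .attach _ x ih hx

theorem AtColumn.write {B : Type} {Mk : Type*} {prog : B → Set (Instr B)} {cap : B}
    {mark : B → Option Mk} {A : Set (PlacedTile (Label B))} {r : Bool} {h j : ℤ} {β n : B}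
    {cols : ℤ → Option Bool} {det : Prop} {b : Bool}
    (hA : AtColumn A r h j β cols) (hj : cols j ≠ some true)
    (hp : Instr.write b n ∈ prog β) (hd : det → prog β = {Instr.write b n}) :
    Relation.TransGen (Grows (tileSet prog cap) det) A (writeTiles r h j β b n ∪ A) ∧
      AtColumn (writeTiles r h j β b n ∪ A) r h (j + sg r) n (Function.update cols j (some b)) ∧
      marks mark (writeTiles r h j β b n ∪ A) =
        marks mark A ∪ newMarks mark (xpos r j 0, h + 1) β := by
  cases b
  · exact hA.writeFalse hj hp hd
  · exact hA.writeTrue hj hp hd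

theorem writeTiles_finite {B : Type} (r : Bool) (h j : ℤ) (β : B) (b : Bool) (n : B) :
    (writeTiles r h j β b n).Finite := by
  unfold writeTiles
  split_ifs <;> exact Set.toFinite _

theorem translate_place {B : Type} (sp : Spec B) (q v : ℤ × ℤ) :
    (sp.place q).translate v = sp.place (q + v) := by
  ext1
  · rfl
  · simp only [PlacedTile.translate, Spec.place]
    ring

theorem translate_writeTiles {B : Type} (r : Bool) (h j d : ℤ) (β : B) (b : Bool) (n : B) :
    PlacedTile.translate (3 * d, 0) '' writeTiles r h j β b n =
      writeTiles r h (j + d) β b n := by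
  have hx : ∀ u, xpos r j u + 3 * d = xpos r (j + d) u := by
    intro u
    cases r <;> simp [xpos] <;> ring
  cases b <;> simp [writeTiles, Set.image_insert_eq, translate_place, hx]

namespace BlockMachine

variable {S Sym : Type} {Mk : Type*} (P : BlockMachine S Sym Mk)

/-- The label in the `p`-th column of a block that is filled in state `s`. -/
def fillLabel (s : S) (p : ℕ) : BlockLabel S Sym P.K :=
  if p < P.K then P.flLabel s (P.K - p) else P.wrLabel s (2 * P.K - p) P.dflt

/-- The bit in the `p`-th column of a block that is filled in state `s`. -/
def fillBit (s : S) (p : ℕ) : Bool :=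
  if p < P.K then false else P.bit (P.tr s P.dflt).1 (2 * P.K - 1 - p)

/-- The tiles of block `i` of the seed; `β` is the label with which the block is entered. -/
noncomputable def seedBlock (β : BlockLabel S Sym P.K) (s : S) (i : ℤ) :
    Set (PlacedTile (Label (BlockLabel S Sym P.K))) :=
  ⋃ p ∈ Finset.range (2 * P.K), writeTiles false 0 (P.col false i p)
    (if p = 0 then β else P.fillLabel s p) (P.fillBit s p) (P.fillLabel s (p + 1))

theorem seedBlock_finite (β : BlockLabel S Sym P.K) (s : S) (i : ℤ) :
    (P.seedBlock β s i).Finite :=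
  Set.Finite.biUnion (Finset.finite_toSet _) fun _ _ => writeTiles_finite _ _ _ _ _ _

theorem translate_seedBlock (β : BlockLabel S Sym P.K) (s : S) (i k : ℤ) :
    PlacedTile.translate ((6 * P.K : ℕ) * k, 0) '' P.seedBlock β s i =
      P.seedBlock β s (i + k) := by
  simp only [seedBlock, Set.image_iUnion]
  refine Set.iUnion_congr fun p => Set.iUnion_congr fun _ => ?_
  rw [show (((6 * P.K : ℕ) : ℤ) * k, (0 : ℤ)) = (3 * (2 * P.K * k), 0) by push_cast; ring_nf,
    translate_writeTiles]
  congr 1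
  simp only [col, Bool.false_eq_true, if_false]
  ring

/-- For `p = K` both descriptions give the label that starts writing: no columns left to fill means
`K` bits left to write. -/
theorem fillLabel_eq_flLabel (s : S) {p : ℕ} (hp : p ≤ P.K) :
    P.fillLabel s p = P.flLabel s (P.K - p) := by
  rcases hp.lt_or_eq with hp | rfl
  · simp [fillLabel, hp]
  · simp [fillLabel, flLabel, wrLabel, P.K_pos.ne', show 2 * P.K - P.K = P.K by omega]

theorem prog_fillLabel (s : S) {p : ℕ} (hp : p < 2 * P.K) :
    P.prog (P.fillLabel s p) = {.write (P.fillBit s p) (P.fillLabel s (p + 1))} := by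
  by_cases h : p < P.K
  · rw [P.fillLabel_eq_flLabel s h.le, P.fillLabel_eq_flLabel s (show p + 1 ≤ P.K from h), flLabel,
      if_neg (by omega)]
    simp [prog, fillBit, h, P.cnt_val (Nat.sub_le _ _), Nat.sub_sub]
  · rw [fillLabel, fillLabel, if_neg h, if_neg (by omega), wrLabel, if_neg (by omega)]
    simp [prog, fillBit, h, P.cnt_val (show 2 * P.K - p ≤ P.K by omega), Nat.sub_sub, Nat.add_comm]

theorem fillLabel_end (s : S) : P.fillLabel s (2 * P.K) = P.entry (P.tr s P.dflt).2 := by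
  have := P.K_pos
  rw [fillLabel, if_neg (by omega), Nat.sub_self, wrLabel, if_pos rfl]

theorem markLabel_fillLabel {s : S} (hs : P.mark s P.dflt = none) (p : ℕ) :
    P.markLabel (P.fillLabel s p) = none := by
  unfold fillLabel flLabel wrLabel
  split_ifs
  · simp [markLabel, hs]
  · rfl
  · exact P.markLabel_entry _
  · simp [markLabel, hs]

variable {P} {s : S} {cols : ℤ → Option Bool} {i : ℤ} {β cap : BlockLabel S Sym P.K}
  {A : Set (PlacedTile (Label (BlockLabel S Sym P.K)))}

/-- The growth of a block of the seed. -/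
theorem seedBlock_grow (hB : Built (tileSet P.prog cap) A)
    (hA : AtColumn A false 0 (P.col false i 0) β cols)
    (hβ : Instr.write false (P.fillLabel s 1) ∈ P.prog β) (hβm : P.markLabel β = none)
    (hs : P.mark s P.dflt = none) (hc : P.Clear cols i) :
    Built (tileSet P.prog cap) (P.seedBlock β s i ∪ A) ∧
      marks P.markLabel (P.seedBlock β s i ∪ A) = marks P.markLabel A ∧
      ∃ cols', AtColumn (P.seedBlock β s i ∪ A) false 0 (P.col false (i - 1) 0)
          (P.entry (P.tr s P.dflt).2) cols' ∧
        P.Ready true cols' i (P.tr s P.dflt).1 ∧ ∀ c, ¬ P.InBlock i c → cols' c = cols c := by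
  have hK := P.K_pos
  have key : ∀ m : ℕ, m ≤ 2 * P.K → ∃ A', A' = (⋃ p ∈ Finset.range m,
      writeTiles false 0 (P.col false i p) (if p = 0 then β else P.fillLabel s p) (P.fillBit s p)
        (P.fillLabel s (p + 1))) ∪ A ∧ Built (tileSet P.prog cap) A' ∧
      marks P.markLabel A' = marks P.markLabel A ∧
      ∃ cols', AtColumn A' false 0 (P.col false i m) (if m = 0 then β else P.fillLabel s m) cols' ∧
        (∀ p : ℕ, p < m → cols' (P.col false i p) = some (P.fillBit s p)) ∧
        ∀ c, (∀ p : ℕ, p < m → c ≠ P.col false i p) → cols' c = cols c := by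
    intro m hm
    induction m with
    | zero => exact ⟨A, by simp, hB, rfl, cols, by simpa using hA, by simp, by simp⟩
    | succ m ih =>
      obtain ⟨A₁, hA₁, hB₁, hM₁, c1, h1, h2, h3⟩ := ih (by omega)
      have hfree : c1 (P.col false i m) ≠ some true := by
        rw [h3 _ fun p hp => by rw [Ne, col_inj]; omega]
        exact hc _ (P.inBlock_col (by omega) (by omega))
      have hmem : Instr.write (P.fillBit s m) (P.fillLabel s (m + 1)) ∈
          P.prog (if m = 0 then β else P.fillLabel s m) := by
        rcases eq_or_ne m 0 with rfl | h0
        · simpa [fillBit, hK] using hβ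
        · rw [if_neg h0, P.prog_fillLabel s (by omega)]
          rfl
      -- The entry label of a seed block may offer several letters, so this growth is possible but
      -- not forced; hence `det := False`.
      obtain ⟨g1, g2, g3⟩ := h1.write (cap := cap) (det := False) (mark := P.markLabel) hfree hmem
        (by simp)
      rw [col_add_sg] at g2
      refine ⟨_, ?_, hB₁.grows g1, ?_, _, by simpa using g2, ?_, ?_⟩
      · rw [hA₁, Finset.range_add_one, Finset.set_biUnion_insert, Set.union_assoc]
      · rw [g3, hM₁, newMarks_eq_empty, Set.union_empty]
        split_ifs
        · exact hβm
        · exact P.markLabel_fillLabel hs m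
      · intro p hp
        rcases Nat.lt_succ_iff_lt_or_eq.1 hp with hp | rfl
        · rw [Function.update_of_ne (by rw [Ne, col_inj]; omega), h2 p hp]
        · simp
      · intro c hc'
        rw [Function.update_of_ne (hc' m (by omega)), h3 c fun p hp => hc' p (by omega)]
  obtain ⟨A', hA', h1, h2, c1, h3, h4, h5⟩ := key (2 * P.K) le_rfl
  subst hA'
  refine ⟨h1, h2, c1, ?_, ?_, ?_⟩
  · rw [if_neg (by omega), fillLabel_end] at h3
    push_cast at h3
    rw [col_next] at h3
    exact h3
  · intro m hm
    rw [show true = !false from rfl, col_not, col_not]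
    have e1 := h4 (2 * P.K - 1 - m) (by omega)
    have e2 := h4 (P.K - 1 - m) (by omega)
    rw [show ((2 * P.K - 1 - m : ℕ) : ℤ) = 2 * P.K - 1 - m by omega] at e1
    rw [show ((P.K - 1 - m : ℕ) : ℤ) = 2 * P.K - 1 - (P.K + m) by omega] at e2
    rw [e1, e2]
    simp [fillBit, show ¬ 2 * P.K - 1 - m < P.K by omega, show P.K - 1 - m < P.K by omega,
      show 2 * P.K - 1 - (2 * P.K - 1 - m) = m by omega]
  · intro c hc'
    refine h5 c fun p hp => ?_
    rintro rfl
    exact hc' (P.inBlock_col (by omega) (by omega))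

/-- The tile at the right end of the seed. -/
noncomputable def capTile (P : BlockMachine S Sym Mk) (cap : BlockLabel S Sym P.K) (i : ℤ) :
    PlacedTile (Label (BlockLabel S Sym P.K)) :=
  Spec.place ⟨.north, none, false, ⟨false, cap, .enter⟩⟩ (6 * P.K * i, 1)

theorem translate_capTile (i k : ℤ) :
    (P.capTile cap i).translate ((6 * P.K : ℕ) * k, 0) = P.capTile cap (i + k) := by
  rw [capTile, translate_place, capTile]
  congr 1
  simp only [Prod.mk_add_mk, add_zero, Prod.mk.injEq, and_true]
  push_cast
  ring

/-- The cap has no input glue and lies just to the right of the first column, so its output glue is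
a front above untouched columns. -/
theorem atColumn_capTile (i : ℤ) :
    AtColumn {P.capTile cap (i + 1)} false 0 (P.col false i 0) cap fun _ => none := by
  have hwf : Spec.WF (B := BlockLabel S Sym P.K) ⟨.north, none, false, ⟨false, cap, .enter⟩⟩ :=
    (Rule.cap (prog := P.prog) (cap := cap)).wf
  have hx : 6 * (P.K : ℤ) * (i + 1) = 3 * P.col false i 0 + 3 := by
    simp only [col, Bool.false_eq_true, if_false]
    ring
  have hocc : ∀ p, p ∈ occ {P.capTile cap (i + 1)} ↔
      p = (3 * P.col false i 0 + 3, 1) ∨ p = (3 * P.col false i 0 + 3, 2) := by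
    intro p
    simp [occ, capTile, Spec.mem_cells_place, Side.vec, hx]
  have hno : ∀ c u y, ¬ Passed false (P.col false i 0) c → 0 ≤ u → u < 3 →
      (xpos false c u, y) ∉ occ {P.capTile cap (i + 1)} := by
    intro c u y hc hu hu'
    simp only [Passed, Bool.false_eq_true, if_false] at hc
    simp only [hocc, xpos, Bool.false_eq_true, if_false, Prod.mk.injEq]
    omega
  refine ⟨⟨⟨_, rfl, ?_⟩, ?_⟩, ?_, by simp, by simp, ?_, by simp, by simp⟩
  · rw [capTile, Spec.glueAt_place hwf]
    left
    refine ⟨?_, rfl, rfl⟩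
    simp only [Spec.exit, xpos, Label.side, fwd, Side.vec, Bool.false_eq_true, if_false, hx]
    ext <;> simp; ring
  · rintro y rfl p s g hg
    rw [capTile, Spec.glueAt_place hwf] at hg
    right
    rcases hg with ⟨rfl, rfl, rfl⟩ | ⟨-, h, -⟩
    · refine ⟨?_, rfl, rfl⟩
      simp only [Spec.exit, xpos, Label.side, fwd, Side.vec, Bool.false_eq_true, if_false, hx]
      ext <;> simp; ring
    · simp at h
  · intro c u y hc hu hu' hm
    exact absurd hm (hno c u y hc hu hu')
  · intro c u y hc hu hu' hm
    left
    rw [hocc] at hm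
    simp only [Prod.mk.injEq] at hm
    omega

theorem marks_capTile (i : ℤ) : marks P.markLabel {P.capTile cap i} = ∅ := by
  have := marks_insert_inner P.markLabel ∅ (Rule.cap (prog := P.prog) (cap := cap))
    (6 * P.K * i, 1) (by simp)
  rw [insert_empty_eq] at this
  rw [capTile, this]
  simp [marks]

end BlockMachine

end PolyTAM

/-! ### Initial tapes and runs of a Turing machine -/

namespace TuringMachine

variable {Q Γ : Type*} {M : TuringMachine Q Γ}

theorem init_tape_of_length_le {w : List Γ} {i : ℤ} (h : w.length ≤ i) :
    (M.init w).tape i = M.blank := by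
  simp only [init]
  split_ifs
  · rw [List.getD_eq_default]
    omega
  · rfl

theorem init_tape_of_neg {w : List Γ} {i : ℤ} (h : i < 0) : (M.init w).tape i = M.blank := by
  simp only [init]
  rw [if_neg (by omega)]

theorem init_tape_get (w : List Γ) (k : Fin w.length) : (M.init w).tape (k : ℕ) = w.get k := by
  simp [init]

theorem run_isSome_of_not_halts {w : List Γ} (h : ¬ M.Halts w) (t : ℕ) :
    ∃ C, M.run w t = some C := by
  induction t with
  | zero => exact ⟨_, rfl⟩
  | succ t ih =>
    obtain ⟨C, hC⟩ := ih
    cases hs : M.step C with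
    | none => exact absurd ⟨t, C, hC, hs⟩ h
    | some C' => exact ⟨C', by simp [run, hC, hs]⟩

theorem run_eq_none_of_lt {w : List Γ} {t t' : ℕ} {C : Config Q Γ}
    (hC : M.run w t = some C) (hM : M.step C = none) (h : t < t') : M.run w t' = none := by
  obtain ⟨k, rfl⟩ := Nat.exists_eq_add_of_le (Nat.succ_le_of_lt h)
  induction k with
  | zero => simp [run, hC, hM]
  | succ k ih =>
    show (M.run w (t.succ + k)).bind M.step = none
    rw [ih (by omega)]
    rfl

end TuringMachine

namespace PolyTAM

namespace Sweep

open SweepState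

variable {Q Γ : Type} [Finite Q] [Finite Γ] (M : TuringMachine Q Γ)

/-! ### The seed -/

/-- The label at the right end of the seed. -/
noncomputable abbrev capLabel := (machine M).entry seedRight

/-- The tile set that simulates `M`. -/
noncomputable abbrev tiles := tileSet (machine M).prog (capLabel M)

/-- The state in which block `i` of the seed for the input `w` is filled. -/
def seedState (w : List Γ) (i : ℤ) : SweepState Q Γ :=
  if i = w.length + 1 then seedRight else if i = -1 then seedLeft
  else seedLetter ((M.init w).tape i)

/-- The label with which block `i` of the seed for the input `w` is entered. -/
noncomputable def seedLabel (w : List Γ) (i : ℤ) :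
    BlockLabel (SweepState Q Γ) (SweepSym Q Γ) (machine M).K :=
  (machine M).entry (if i = w.length + 1 then seedRight else seedNext)

/-- The part of the seed to the right of block `j`. -/
noncomputable def seedFrom (w : List Γ) (j : ℤ) :
    Set (PlacedTile (Label (BlockLabel (SweepState Q Γ) (SweepSym Q Γ) (machine M).K))) :=
  {x | x = (machine M).capTile (capLabel M) (w.length + 2) ∨
    ∃ i, j < i ∧ i ≤ w.length + 1 ∧
      x ∈ (machine M).seedBlock (seedLabel M w i) (seedState M w i) i}

variable {M}

/-- The seed is itself grown from right to left by the tile set, which shows that it is stable and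
free of overlaps. After the cap come `w.length + 3` blocks: the right marker in block `w.length +
1`, a blank cell, the letters, and the left marker in block `-1`. -/
theorem seedFrom_grow (w : List Γ) (p : ℕ) (hp : p ≤ w.length + 3) :
    Built (tiles M) (seedFrom M w (w.length + 1 - p)) ∧
      marks (machine M).markLabel (seedFrom M w (w.length + 1 - p)) = ∅ ∧
      ∃ cols, AtColumn (seedFrom M w (w.length + 1 - p)) false 0
          ((machine M).col false (w.length + 1 - p) 0)
          (if p = w.length + 3 then (machine M).entry turnSeed
            else seedLabel M w (w.length + 1 - p)) cols ∧
        (∀ i : ℤ, (w.length : ℤ) + 1 - p < i → i ≤ w.length + 1 →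
          (machine M).Ready true cols i (tr M (seedState M w i) none).1) ∧
        ∀ i : ℤ, i ≤ (w.length : ℤ) + 1 - p ∨ w.length + 1 < i → (machine M).Clear cols i := by
  induction p with
  | zero =>
    have e : seedFrom M w (w.length + 1 - (0 : ℕ)) =
        {(machine M).capTile (capLabel M) (w.length + 1 + 1)} := by
      ext x
      simp only [seedFrom, Set.mem_ofPred_eq, Set.mem_singleton_iff, add_assoc]
      constructor
      · rintro (h | ⟨i, h1, h2, -⟩)
        · exact h
        · omega
      · exact Or.inl
    rw [e]
    refine ⟨.single _ ⟨_, .cap, rfl⟩, (machine M).marks_capTile _, fun _ => none, ?_, ?_, ?_⟩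
    · simpa [seedLabel] using (machine M).atColumn_capTile (cap := capLabel M) (w.length + 1)
    · intro i h1 h2
      omega
    · intro i _ c _
      simp
  | succ p ih =>
    obtain ⟨h1, h2, cols, h3, h4, h5⟩ := ih (by omega)
    set i : ℤ := w.length + 1 - p with hi
    rw [if_neg (by omega)] at h3
    have hK := (machine M).K_pos
    have hi' : (w.length : ℤ) + 1 - (p + 1 : ℕ) = i - 1 := by push_cast; omega
    have hmem : Instr.write false ((machine M).fillLabel (seedState M w i) 1) ∈
        (machine M).prog (seedLabel M w i) := by
      by_cases hp0 : i = w.length + 1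
      · have e : seedLabel M w i = (machine M).fillLabel (seedState M w i) 0 := by
          rw [BlockMachine.fillLabel_eq_flLabel _ _ (Nat.zero_le _)]
          simp only [seedLabel, hp0, if_true, BlockMachine.entry, seedState, Nat.sub_zero,
            BlockMachine.flLabel, hK.ne', if_false]
          rfl
        rw [e, BlockMachine.prog_fillLabel _ _ (by omega)]
        simp [BlockMachine.fillBit, hK]
      -- All blocks but the rightmost are entered with the same label, so the tiles of a letter do
      -- not depend on its neighbours.
      · have e : seedLabel M w i = .en seedNext := by
          simp only [seedLabel, hp0, if_false]
          rfl
        rw [e, BlockMachine.fillLabel_eq_flLabel _ _ hK]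
        refine ⟨seedState M w i, ?_, rfl⟩
        simp only [seedState, hp0, if_false]
        split_ifs
        · exact Or.inl rfl
        · exact Or.inr ⟨_, rfl⟩
    obtain ⟨g1, g2, c1, g3, g4, g5⟩ := BlockMachine.seedBlock_grow h1 h3 hmem
      (BlockMachine.markLabel_entry _ _)
      (by unfold seedState; split_ifs <;> rfl) (h5 i (by omega))
    have eA : seedFrom M w (i - 1) =
        (machine M).seedBlock (seedLabel M w i) (seedState M w i) i ∪ seedFrom M w i := by
      ext x
      simp only [seedFrom, Set.mem_ofPred_eq, Set.mem_union]
      constructor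
      · rintro (h | ⟨i', a1, a2, a3⟩)
        · exact Or.inr (Or.inl h)
        · rcases eq_or_ne i' i with rfl | hne
          · exact Or.inl a3
          · exact Or.inr (Or.inr ⟨i', by omega, a2, a3⟩)
      · rintro (h | h | ⟨i', a1, a2, a3⟩)
        · exact Or.inr ⟨i, by omega, by omega, h⟩
        · exact Or.inl h
        · exact Or.inr ⟨i', by omega, a2, a3⟩
    rw [hi', eA]
    refine ⟨g1, g2.trans h2, c1, ?_, ?_, ?_⟩
    · convert g3 using 1
      by_cases hend : p + 1 = w.length + 3
      · have : i = -1 := by omega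
        simp only [hend, if_true, seedState, this, show (-1 : ℤ) ≠ w.length + 1 by omega, if_false]
        rfl
      · simp only [hend, if_false, seedLabel, show i - 1 ≠ w.length + 1 by omega, seedState,
          show i ≠ -1 by omega]
        split_ifs <;> rfl
    · intro i' a1 a2
      rcases eq_or_ne i' i with rfl | hne
      · exact g4
      · exact (h4 i' (by omega) a2).congr fun c hc =>
          g5 c ((machine M).not_inBlock_of_ne hne hc)
    · intro i' hi'
      exact (h5 i' (by omega)).congr fun c hc =>
        g5 c ((machine M).not_inBlock_of_ne (by omega) hc)

variable (M) in
/-- The seed for the input `w`. -/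
noncomputable def seed (w : List Γ) := seedFrom M w (-2)

theorem seed_built (w : List Γ) : Built (tiles M) (seed M w) := by
  have := (seedFrom_grow (M := M) w (w.length + 3) le_rfl).1
  rwa [show (w.length : ℤ) + 1 - (w.length + 3 : ℕ) = -2 by push_cast; ring] at this

/-- From the seed the path reaches the start of the first sweep. -/
theorem seed_reach (w : List Γ) :
    ∃ A cols, Relation.ReflTransGen (Forced (tiles M)) (seed M w) A ∧
      Represents (machine M).markLabel A ⟨true, 2, (machine M).col true (-1) 0,
        (machine M).entry (rBegin (some M.start)), cols, ∅⟩ ∧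
      Row M cols (-1) (w.length + 1) (some M.start) (M.init w) := by
  obtain ⟨-, h2, cols, h3, h4, h5⟩ := seedFrom_grow (M := M) w (w.length + 3) le_rfl
  rw [show (w.length : ℤ) + 1 - (w.length + 3 : ℕ) = -2 by push_cast; ring] at h2 h3 h4 h5
  rw [if_pos rfl] at h3
  have e := BlockMachine.reach_turn (P := machine M) (r := false) (h := 0) (i := -2)
    (s := turnSeed) (s' := rBegin (some M.start)) (cols := cols) (H := ∅) rfl (h5 _ (by omega))
  obtain ⟨A, hA, hR⟩ := Represents.steps (cap := capLabel M)
    (Represents.mk (C := ⟨false, 0, (machine M).col false (-2) 0, (machine M).entry turnSeed,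
      cols, ∅⟩) h3 h2) e
  have hk : ∀ i, -1 ≤ i → ∀ c, (machine M).InBlock i c →
      (if Passed false ((machine M).col false (-2) 0) c then cols c else none) = cols c :=
    fun i hi' c hc => if_pos (BlockMachine.passed_left_of_lt (by omega) hc)
  refine ⟨A, _, hA, hR, ?_⟩
  constructor
  · simp [TuringMachine.init]
  · simp only [TuringMachine.init]
    omega
  · have := h4 (-1) (by omega) (by omega)
    simp only [seedState, show (-1 : ℤ) ≠ w.length + 1 by omega, if_false, if_true, tr] at this
    exact this.congr (hk _ le_rfl)
  · have := h4 (w.length + 1) (by omega) le_rfl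
    simp only [seedState, if_true, tr] at this
    exact this.congr (hk _ (by omega))
  · intro i h6 h7
    have := h4 i (by omega) (by omega)
    simp only [seedState, show i ≠ w.length + 1 by omega, show i ≠ -1 by omega, if_false,
      tr] at this
    simpa using this.congr (hk _ (by omega))
  -- The seed encodes no head; the path brings the start state to cell `0`, the cell after the
  -- marker in block `-1`.
  · rintro q ⟨⟩
    exact ⟨rfl, rfl⟩
  · intro i hi
    exact BlockMachine.clear_ite (h5 i (by omega))
  · rintro i (hi | hi)
    · exact TuringMachine.init_tape_of_neg (by omega)
    · exact TuringMachine.init_tape_of_length_le (by omega)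

variable (M)

/-- The left end of the seeds. -/
noncomputable def leftEnd :=
  ((machine M).seedBlock_finite ((machine M).entry seedNext) seedLeft (-1)).toFinset

/-- The part of the seeds for a letter. -/
noncomputable def letterBlock (a : Γ) :=
  ((machine M).seedBlock_finite ((machine M).entry seedNext) (seedLetter a) 0).toFinset

/-- The right end of the seeds. -/
noncomputable def rightEnd :=
  ((((machine M).seedBlock_finite ((machine M).entry seedNext) (seedLetter M.blank) 0).union
    ((machine M).seedBlock_finite (capLabel M) seedRight 1)).insert
      ((machine M).capTile (capLabel M) 2)).toFinset

/-- The fixed right end consists of a blank cell, the right marker and the cap. The blank cell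
ensures that cell `0` exists even for the empty input. Blocks of equal letters are translates
because their labels do not mention the position. -/
theorem seed_eq_inputRow (w : List Γ) :
    seed M w = inputRow (6 * (machine M).K) (leftEnd M) (letterBlock M) (rightEnd M) w := by
  have hlet : ∀ k : ℤ, k ≠ w.length + 1 → k ≠ -1 →
      (machine M).seedBlock (seedLabel M w k) (seedState M w k) k =
        PlacedTile.translate (((6 * (machine M).K : ℕ) : ℤ) * k, 0) ''
          (letterBlock M ((M.init w).tape k) : Set _) := by
    intro k h1 h2
    simp only [letterBlock, Set.Finite.coe_toFinset, BlockMachine.translate_seedBlock, zero_add,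
      seedLabel, seedState, h1, h2, if_false]
  have hleft : (machine M).seedBlock (seedLabel M w (-1)) (seedState M w (-1)) (-1) =
      (leftEnd M : Set _) := by
    have : (-1 : ℤ) ≠ w.length + 1 := by omega
    simp only [leftEnd, Set.Finite.coe_toFinset, seedLabel, seedState, this, if_false, if_true]
  have hright : PlacedTile.translate (((6 * (machine M).K : ℕ) : ℤ) * w.length, 0) ''
        (rightEnd M : Set _) =
      insert ((machine M).capTile (capLabel M) (w.length + 2))
        ((machine M).seedBlock (seedLabel M w w.length) (seedState M w w.length) w.length ∪
          (machine M).seedBlock (seedLabel M w (w.length + 1)) (seedState M w (w.length + 1))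
            (w.length + 1)) := by
    rw [hlet w.length (by omega) (by omega), TuringMachine.init_tape_of_length_le le_rfl]
    simp only [rightEnd, letterBlock, Set.Finite.coe_toFinset, Set.image_insert_eq, Set.image_union,
      BlockMachine.translate_seedBlock, BlockMachine.translate_capTile, seedLabel, seedState,
      if_true]
    rw [add_comm (2 : ℤ), add_comm (1 : ℤ)]
  ext x
  simp only [seed, seedFrom, inputRow, Set.mem_union, Set.mem_iUnion, hright, Set.mem_insert_iff,
    Set.mem_ofPred_eq]
  constructor
  · rintro (h | ⟨i, h1, h2, h3⟩)
    · exact Or.inr (Or.inl h)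
    · rcases eq_or_ne i (-1) with rfl | hi1
      · rw [hleft] at h3
        exact Or.inl (Or.inl h3)
      rcases eq_or_ne i (w.length + 1) with rfl | hi2
      · exact Or.inr (Or.inr (Or.inr h3))
      rcases eq_or_ne i w.length with rfl | hi3
      · exact Or.inr (Or.inr (Or.inl h3))
      refine Or.inl (Or.inr ?_)
      lift i to ℕ using by omega
      have hi : i < w.length := by omega
      refine ⟨⟨i, hi⟩, ?_⟩
      rw [hlet i hi2 hi1] at h3
      rwa [← TuringMachine.init_tape_get (M := M) w ⟨i, hi⟩]
  · rintro ((h | ⟨k, h⟩) | h | h | h)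
    · rw [← hleft] at h
      exact Or.inr ⟨-1, by omega, by omega, h⟩
    · refine Or.inr ⟨(k : ℕ), by omega, by omega, ?_⟩
      rw [hlet _ (by omega) (by omega), TuringMachine.init_tape_get]
      exact h
    · exact Or.inl h
    · exact Or.inr ⟨_, by omega, by omega, h⟩
    · exact Or.inr ⟨_, by omega, by omega, h⟩

/-! ### The simulation -/

variable {M}

/-- With base row `4 * t' + 2` a mark sits at offset `(3 * K, 3)` in its block of size `6 * K` by
`4`, so its position determines the block. -/
theorem markPos_injective {t t' i i' : ℤ} {p : ℤ × ℤ} (h0 : 0 ≤ p.1)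
    (h1 : p.1 < (6 * (machine M).K : ℕ)) (h2 : 0 ≤ p.2) (h3 : p.2 < 4)
    (h : p + (((6 * (machine M).K : ℕ) : ℤ) * i, ((4 : ℕ) : ℤ) * t) = markPos M (4 * t' + 2) i') :
    i = i' ∧ t = t' := by
  have hK := (machine M).K_pos
  obtain ⟨x, y⟩ := p
  simp only [markPos, Prod.mk_add_mk, Prod.mk.injEq, Nat.cast_mul, Nat.cast_ofNat] at h h0 h1 h2 h3
  refine ⟨?_, by omega⟩
  have h4 : x - 3 * (machine M).K = 6 * (machine M).K * (i' - i) := by linarith [h.1]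
  rcases lt_trichotomy i i' with hi | hi | hi
  · have : (6 * (machine M).K : ℤ) * 1 ≤ 6 * (machine M).K * (i' - i) :=
      mul_le_mul_of_nonneg_left (by omega) (by positivity)
    omega
  · exact hi
  · have : (6 * (machine M).K : ℤ) * (i' - i) ≤ 6 * (machine M).K * (-1) :=
      mul_le_mul_of_nonneg_left (by omega) (by positivity)
    omega

/-- The mark `x` shows the content of a cell at some time. -/
def Correct (M : TuringMachine Q Γ) (w : List Γ) (x : (ℤ × ℤ) × (Γ × Option Q)) : Prop :=
  ∃ (t : ℕ) (i : ℤ) (C : TuringMachine.Config Q Γ), M.run w t = some C ∧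
    x = (markPos M (4 * t + 2) i, C.cell i)

/-- The marks in `X` are correct, and they show the run for all times before `t`. -/
structure Shows (M : TuringMachine Q Γ) (w : List Γ) (t : ℕ)
    (X : Set ((ℤ × ℤ) × (Γ × Option Q))) : Prop where
  correct : ∀ x ∈ X, Correct M w x
  complete : ∀ t' < t, ∀ C, M.run w t' = some C → ∀ i,
    C.cell i = (M.blank, none) ∨ (markPos M (4 * t' + 2) i, C.cell i) ∈ X

/-- Cells outside the interval from `lo` to `hi` need no mark: by `Row` they are blank and without
the head. -/
theorem Shows.union_rowMarks {w : List Γ} {t : ℕ} {H : Set ((ℤ × ℤ) × (Γ × Option Q))}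
    {cols : ℤ → Option Bool} {lo hi : ℤ} {o : Option Q} {C : TuringMachine.Config Q Γ}
    (hS : Shows M w t H) (hC : M.run w t = some C) (hR : Row M cols lo hi o C) :
    Shows M w (t + 1) (H ∪ rowMarks M C lo hi (4 * t + 2)) := by
  constructor
  · rintro x (hx | ⟨i, -, -, rfl⟩)
    · exact hS.correct x hx
    · exact ⟨t, i, C, hC, rfl⟩
  · intro t' ht' C' hC' i
    rcases Nat.lt_succ_iff_lt_or_eq.1 ht' with ht' | rfl
    · exact (hS.complete t' ht' C' hC' i).imp_right Or.inl
    · obtain rfl : C = C' := Option.some_injective _ (hC.symm.trans hC')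
      by_cases hi' : lo < i ∧ i < hi
      · exact Or.inr (Or.inr ⟨i, hi'.1, hi'.2, rfl⟩)
      · left
        have h1 := hR.lo_lt
        have h2 := hR.lt_hi
        rw [TuringMachine.Config.cell, if_neg (by omega), hR.blank i (by omega)]

/-- The assembly `A` is at the start of the sweep over the configuration `C` at time `t`. -/
def AtTime (M : TuringMachine Q Γ) (w : List Γ) (t : ℕ) (C : TuringMachine.Config Q Γ)
    (A : Set (PlacedTile (Label (BlockLabel (SweepState Q Γ) (SweepSym Q Γ) (machine M).K)))) :
    Prop :=
  ∃ cols lo hi o H, Represents (machine M).markLabel A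
      ⟨true, 4 * t + 2, (machine M).col true lo 0, (machine M).entry (rBegin o), cols, H⟩ ∧
    Row M cols lo hi o C ∧ Shows M w t H

/-- A machine step costs at least one attachment, hence `t ≤ n`; for a machine that does not halt
this makes the attachments of every index forced. -/
theorem exists_atTime (w : List Γ) (t : ℕ) (C : TuringMachine.Config Q Γ)
    (hC : M.run w t = some C) : ∃ n, t ≤ n ∧ ForcedUpTo (tiles M) (seed M w) n ∧
      AtTime M w t C ((forcedNext (tiles M))^[n] (seed M w)) := by
  induction t generalizing C with
  | zero =>
    obtain ⟨A, cols, h1, h2, h3⟩ := seed_reach (M := M) w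
    obtain ⟨n, hn, rfl, hF⟩ := ForcedUpTo.of_reflTransGen (T := tiles M) (A := seed M w) (n := 0)
      (by simp [ForcedUpTo]) h1
    obtain rfl : M.init w = C := Option.some_injective _ hC
    refine ⟨n, hn, hF, cols, -1, w.length + 1, _, ∅, ?_, h3, by simp, by simp⟩
    simpa only [Nat.cast_zero, mul_zero, zero_add] using h2
  | succ t ih =>
    simp only [TuringMachine.run, Option.bind_eq_some_iff] at hC
    obtain ⟨C', hC', hstep⟩ := hC
    obtain ⟨n, hn, hF, cols, lo, hi, o, H, h1, h2, h3⟩ := ih C' hC'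
    obtain ⟨cols', h4, h5⟩ := reach_step (h := 4 * t + 2) (H := H) h2 hstep
    -- The reflexive case is impossible, since a step raises the base row by 4.
    have h6 := (Relation.reflTransGen_iff_eq_or_transGen.1 h4).resolve_left (by simp)
    obtain ⟨A', h7, h8⟩ := h1.trans_steps (cap := capLabel M) h6
    obtain ⟨k, hk, rfl, hF'⟩ := hF.of_transGen h7
    refine ⟨k, by omega, hF', cols', _, _, _, _, ?_, h5, h3.union_rowMarks hC' h2⟩
    convert h8 using 2
    push_cast
    ring

theorem exists_stuck (w : List Γ) (t : ℕ) (C : TuringMachine.Config Q Γ)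
    (hC : M.run w t = some C) (hM : M.step C = none) :
    ∃ n, ForcedUpTo (tiles M) (seed M w) n ∧
      Stuck (tiles M) ((forcedNext (tiles M))^[n] (seed M w)) ∧
      Shows M w (t + 1)
        (marks (machine M).markLabel ((forcedNext (tiles M))^[n] (seed M w))) := by
  obtain ⟨n, -, hF, cols, lo, hi, o, H, h1, h2, h3⟩ := exists_atTime w t C hC
  obtain ⟨D, h4, h5, h6⟩ := reach_halt (h := 4 * t + 2) (H := H) h2 hM
  obtain ⟨A', h7, h8⟩ := h1.steps (cap := capLabel M) h4
  obtain ⟨k, -, rfl, hF'⟩ := hF.of_reflTransGen h7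
  refine ⟨k, hF', h8.stuck h5, ?_⟩
  rw [h8.marks_eq, h6]
  exact h3.union_rowMarks hC h2

theorem marks_mono {B : Type} {Mk : Type*} (mark : B → Option Mk)
    {A A' : Set (PlacedTile (Label B))} (h : A ⊆ A') : marks mark A ⊆ marks mark A' := by
  rintro x ⟨y, hy, hx⟩
  exact ⟨y, h hy, hx⟩

/-- The system that simulates `M` on `w`. -/
noncomputable def system (M : TuringMachine Q Γ) (w : List Γ) :=
  (seed_built (M := M) w).tas (tileSet_finite _ _)

theorem forall_forced_of_not_halts {w : List Γ} (h : ¬ M.Halts w) (n : ℕ) :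
    Forced (tiles M) ((forcedNext (tiles M))^[n] (seed M w))
      ((forcedNext (tiles M))^[n + 1] (seed M w)) := by
  obtain ⟨C, hC⟩ := TuringMachine.run_isSome_of_not_halts h (n + 1)
  obtain ⟨k, hk, hF, -⟩ := exists_atTime w (n + 1) C hC
  exact hF n (by omega)

theorem deterministic (w : List Γ) : Deterministic (tiles M) (seed M w) := by
  by_cases h : M.Halts w
  · obtain ⟨t, C, hC, hM⟩ := h
    obtain ⟨n, hF, hS, -⟩ := exists_stuck w t C hC hM
    exact hF.deterministic hS
  · exact fun n => Or.inl (forall_forced_of_not_halts h n)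

/-- Marks never disappear, so a stage in the middle of a sweep inherits correctness from a later
stage whose marks are known. -/
theorem correct_iterate (w : List Γ) (n : ℕ) :
    ∀ x ∈ marks (machine M).markLabel ((forcedNext (tiles M))^[n] (seed M w)), Correct M w x := by
  by_cases h : M.Halts w
  · obtain ⟨t, C, hC, hM⟩ := h
    obtain ⟨k, hF, hS, hm⟩ := exists_stuck w t C hC hM
    intro x hx
    refine hm.correct x (marks_mono _ ?_ hx)
    rcases le_total n k with hnk | hnk
    · exact iterate_mono hnk
    · rw [hS.iterate_eq_of_le hnk]
  · obtain ⟨C, hC⟩ := TuringMachine.run_isSome_of_not_halts h n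
    obtain ⟨k, hk, hF, cols, lo, hi, o, H, h1, h2, h3⟩ := exists_atTime w n C hC
    intro x hx
    have := marks_mono (machine M).markLabel (iterate_mono (T := tiles M) hk) hx
    rw [h1.marks_eq] at this
    exact h3.correct x this

theorem correct_of_producible {w : List Γ} {X} (hX : (system M w).Producible X) :
    ∀ x ∈ marks (machine M).markLabel X, Correct M w x := by
  rcases producible_cases _ (seed_built w) (deterministic w) X hX with ⟨n, rfl⟩ | ⟨rfl, -⟩
  · exact correct_iterate w n
  · rintro x ⟨y, hy, hx⟩
    obtain ⟨n, hn⟩ := Set.mem_iUnion.1 hy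
    exact correct_iterate w n x ⟨y, hn, hx⟩

/-- The terminal assembly is unique. If `M` halts, it is the stuck stage, which shows all times up
to the last one; otherwise it contains the stage at time `t + 1`, which shows time `t`. -/
theorem complete_of_terminal {w : List Γ} {X} (hX : (system M w).Terminal X) {t : ℕ}
    {C : TuringMachine.Config Q Γ} (hC : M.run w t = some C) (i : ℤ) :
    C.cell i = (M.blank, none) ∨
      (markPos M (4 * t + 2) i, C.cell i) ∈ marks (machine M).markLabel X := by
  by_cases h : M.Halts w
  · obtain ⟨t', C', hC', hM⟩ := h
    obtain ⟨k, hF, hS, hm⟩ := exists_stuck w t' C' hC' hM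
    rw [system, terminal_iff_of_stuck _ _ hF hS] at hX
    rw [hX]
    refine hm.complete t ?_ C hC i
    by_contra hlt
    rw [TuringMachine.run_eq_none_of_lt hC' hM (by omega)] at hC
    simp at hC
  · rw [system, terminal_iff_of_forall_forced _ _ (forall_forced_of_not_halts h)] at hX
    obtain ⟨C', hC'⟩ := TuringMachine.run_isSome_of_not_halts h (t + 1)
    obtain ⟨k, -, -, cols, lo, hi, o, H, h1, h2, h3⟩ := exists_atTime w (t + 1) C' hC'
    refine (h3.complete t (by omega) C hC i).imp_right fun hm => ?_
    rw [hX]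
    refine marks_mono _ (Set.subset_iUnion _ k) ?_
    rw [h1.marks_eq]
    exact hm

open Classical in
/-- The decoding: the content that a mark inside the block shows. -/
noncomputable def decode (M : TuringMachine Q Γ)
    (V : Set (PlacedTile (Label (BlockLabel (SweepState Q Γ) (SweepSym Q Γ) (machine M).K)))) :
    Option (Γ × Option Q) :=
  if h : ∃ a, ∃ p : ℤ × ℤ, (p, a) ∈ marks (machine M).markLabel V ∧
      0 ≤ p.1 ∧ p.1 < (6 * (machine M).K : ℕ) ∧ 0 ≤ p.2 ∧ p.2 < (4 : ℕ)
  then some h.choose else none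

theorem glueAt_translate {G : Type*} (x : PlacedTile G) (v p : ℤ × ℤ) (s : Side) :
    (x.translate v).glueAt (p + v) s = x.glueAt p s := by
  simp [PlacedTile.glueAt, PlacedTile.translate]

/-- A mark at `p` belongs to a tile that covers `p`, so this tile meets the block if `p` lies in it.
Tiles that protrude from neighbouring blocks do no harm, since the decoding looks at positions. -/
theorem mem_marks_blockView {B : Type} {Mk : Type*} {mark : B → Option Mk} {c h : ℕ}
    {A : Set (PlacedTile (Label B))} {i : ℤ} {t : ℕ} {p : ℤ × ℤ} {a : Mk} (h1 : 0 ≤ p.1)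
    (h2 : p.1 < c) (h3 : 0 ≤ p.2) (h4 : p.2 < h) :
    (p, a) ∈ marks mark (blockView c h A i t) ↔ (p + ((c : ℤ) * i, (h : ℤ) * t), a) ∈ marks mark A := by
  constructor
  · rintro ⟨y, ⟨hy, -⟩, r, β, hg, hm⟩
    exact ⟨_, hy, r, β, by rwa [glueAt_translate], hm⟩
  · rintro ⟨y, hy, r, β, hg, hm⟩
    have e : (y.translate (-((c : ℤ) * i, (h : ℤ) * t))).translate ((c : ℤ) * i, (h : ℤ) * t) = y := by
      simp only [PlacedTile.translate, neg_add_cancel_right]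
    have hg' : (y.translate (-((c : ℤ) * i, (h : ℤ) * t))).glueAt p (fwd r).opp = some ⟨r, β, .enter⟩ := by
      rw [← glueAt_translate _ ((c : ℤ) * i, (h : ℤ) * t), e]
      exact hg
    exact ⟨_, ⟨by rwa [e], p, PlacedTile.mem_cells_of_glueAt hg', h1, h2, h3, h4⟩, r, β, hg', hm⟩

/-- The choice made by `decode` is harmless: any mark inside the block is correct for some cell and
time, and its position forces these to be `i` and `t`. -/
theorem decode_sound {w : List Γ} {X} (hX : (system M w).Producible X) {i : ℤ} {t : ℕ}
    {a : Γ × Option Q} (h : decode M (blockView (6 * (machine M).K) 4 X i t) = some a) :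
    ∃ C, M.run w t = some C ∧ C.cell i = a := by
  unfold decode at h
  split_ifs at h with hex
  obtain ⟨p, hp, h1, h2, h3, h4⟩ := hex.choose_spec
  rw [Option.some_injective _ h, mem_marks_blockView h1 h2 h3 h4] at hp
  obtain ⟨t', i', C, hC, he⟩ := correct_of_producible hX _ hp
  obtain ⟨he1, he2⟩ := Prod.mk.inj he
  obtain ⟨rfl, ht⟩ := markPos_injective h1 h2 h3 h4 he1
  obtain rfl : t = t' := by exact_mod_cast ht
  exact ⟨C, hC, he2.symm⟩

theorem decode_ne_none {X : Set (PlacedTile _)} {i : ℤ} {t : ℕ} {a : Γ × Option Q}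
    (h : (markPos M (4 * t + 2) i, a) ∈ marks (machine M).markLabel X) :
    decode M (blockView (6 * (machine M).K) 4 X i t) ≠ none := by
  have hK := (machine M).K_pos
  have h1 : (0 : ℤ) ≤ 3 * (machine M).K := by omega
  have h2 : 3 * ((machine M).K : ℤ) < (6 * (machine M).K : ℕ) := by push_cast; omega
  unfold decode
  rw [dif_pos]
  · simp
  · refine ⟨a, (3 * (machine M).K, 3), ?_, h1, h2, by norm_num, by norm_num⟩
    rw [mem_marks_blockView h1 h2 (by norm_num) (by norm_num)]
    convert h using 2
    simp only [markPos, Prod.mk_add_mk, Prod.mk.injEq]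
    push_cast
    constructor <;> ring

theorem simulates (M : TuringMachine Q Γ) (w : List Γ) :
    Simulates (system M w) M w (6 * (machine M).K) 4 (decode M) where
  sound A hA i t a ha := decode_sound hA ha
  complete A hA t C hC i := by
    -- A decoded value is correct by soundness. If nothing is decoded there is no mark, and
    -- completeness leaves only a blank cell without the head.
    cases hd : decode M (blockView (6 * (machine M).K) 4 A i t) with
    | none =>
      refine Or.inr ⟨rfl, (complete_of_terminal hA hC i).resolve_right fun hm => ?_⟩
      exact decode_ne_none hm hd
    | some a =>
      obtain ⟨C', hC', rfl⟩ := decode_sound hA.1 hd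
      obtain rfl : C = C' := Option.some_injective _ (hC.symm.trans hC')
      exact Or.inl rfl
  exists_terminal := by
    by_cases h : M.Halts w
    · obtain ⟨t, C, hC, hM⟩ := h
      obtain ⟨k, hF, hS, -⟩ := exists_stuck w t C hC hM
      exact ⟨_, (terminal_iff_of_stuck _ _ hF hS _).2 rfl⟩
    · exact ⟨_, (terminal_iff_of_forall_forced _ _ (forall_forced_of_not_halts h) _).2 rfl⟩
  halting A hA := by
    by_cases h : M.Halts w
    · refine iff_of_true ?_ h
      obtain ⟨t, C, hC, hM⟩ := h
      obtain ⟨k, hF, hS, -⟩ := exists_stuck w t C hC hM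
      rw [system, terminal_iff_of_stuck _ _ hF hS] at hA
      rw [hA]
      exact finite_iterate (seed_built w).finite k
    · refine iff_of_false ?_ h
      rw [system, terminal_iff_of_forall_forced _ _ (forall_forced_of_not_halts h)] at hA
      rw [hA]
      exact infinite_of_forall_forced (forall_forced_of_not_halts h)

end Sweep

end PolyTAM

/-! ### Renaming states and symbols -/

namespace TuringMachine

variable {Q Γ Q₁ Γ₁ : Type*} (eQ : Q ≃ Q₁) (eΓ : Γ ≃ Γ₁)

/-- The machine with renamed states and symbols. -/
def rename (M : TuringMachine Q Γ) : TuringMachine Q₁ Γ₁ where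
  blank := eΓ M.blank
  start := eQ M.start
  δ q a := (M.δ (eQ.symm q) (eΓ.symm a)).map (Prod.map eQ (Prod.map eΓ id))

/-- The configuration with renamed states and symbols. -/
def Config.rename (C : Config Q Γ) : Config Q₁ Γ₁ where
  state := eQ C.state
  head := C.head
  tape i := eΓ (C.tape i)

theorem Config.cell_rename (C : Config Q Γ) (i : ℤ) :
    (C.rename eQ eΓ).cell i = Prod.map eΓ (Option.map eQ) (C.cell i) := by
  simp only [Config.cell, Config.rename, Prod.map_apply, apply_ite (Option.map eQ),
    Option.map_some, Option.map_none]
  rfl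

theorem init_rename (M : TuringMachine Q Γ) (w : List Γ) :
    (M.rename eQ eΓ).init (w.map eΓ) = (M.init w).rename eQ eΓ := by
  simp only [init, rename, Config.rename, apply_ite eΓ, List.getD_map]

theorem step_rename (M : TuringMachine Q Γ) (C : Config Q Γ) :
    (M.rename eQ eΓ).step (C.rename eQ eΓ) = (M.step C).map (Config.rename eQ eΓ) := by
  simp only [step, rename, Config.rename, Equiv.symm_apply_apply, Option.map_map]
  congr 1
  ext1 r
  simp only [Function.comp_apply, Prod.map_fst, Prod.map_snd, id]
  congr 1
  ext1 i
  simp only [Function.update_apply, apply_ite eΓ]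

theorem run_rename (M : TuringMachine Q Γ) (w : List Γ) (t : ℕ) :
    (M.rename eQ eΓ).run (w.map eΓ) t = (M.run w t).map (Config.rename eQ eΓ) := by
  induction t with
  | zero => simp only [run, init_rename, Option.map_some]
  | succ t ih =>
    simp only [run, ih]
    cases M.run w t with
    | none => rfl
    | some C => exact step_rename eQ eΓ M C

theorem halts_rename (M : TuringMachine Q Γ) (w : List Γ) :
    (M.rename eQ eΓ).Halts (w.map eΓ) ↔ M.Halts w := by
  simp only [Halts, run_rename, Option.map_eq_some_iff]
  constructor
  · rintro ⟨t, _, ⟨C, hC, rfl⟩, h⟩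
    rw [step_rename, Option.map_eq_none_iff] at h
    exact ⟨t, C, hC, h⟩
  · rintro ⟨t, C, hC, h⟩
    exact ⟨t, _, ⟨C, hC, rfl⟩, by rw [step_rename, h, Option.map_none]⟩

end TuringMachine

namespace PolyTAM

variable {Q Γ Q' Γ' G : Type*}

theorem Simulates.of_rename {eQ : Q ≃ Q'} {eΓ : Γ ≃ Γ'} {S : TAS G} {M : TuringMachine Q Γ}
    {w : List Γ} {c h : ℕ} {dec : Set (PlacedTile G) → Option (Γ' × Option Q')}
    (hS : Simulates S (M.rename eQ eΓ) (w.map eΓ) c h dec) :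
    Simulates S M w c h fun V => (dec V).map (Prod.map eΓ.symm (Option.map eQ.symm)) := by
  have hcell : ∀ (C : TuringMachine.Config Q Γ) i,
      Prod.map eΓ.symm (Option.map eQ.symm) ((C.rename eQ eΓ).cell i) = C.cell i := by
    intro C i
    rw [TuringMachine.Config.cell_rename, Prod.map_map, Option.map_comp_map]
    simp
  refine ⟨?_, ?_, hS.exists_terminal, fun A hA =>
    (hS.halting A hA).trans (M.halts_rename eQ eΓ w)⟩
  · intro A hA i t a ha
    obtain ⟨a', ha', rfl⟩ := Option.map_eq_some_iff.1 ha
    obtain ⟨_, hC, rfl⟩ := hS.sound A hA i t a' ha'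
    rw [TuringMachine.run_rename, Option.map_eq_some_iff] at hC
    obtain ⟨C, hC, rfl⟩ := hC
    exact ⟨C, hC, (hcell C i).symm⟩
  · intro A hA t C hC i
    have hC' : (M.rename eQ eΓ).run (w.map eΓ) t = some (C.rename eQ eΓ) := by
      rw [TuringMachine.run_rename, hC, Option.map_some]
    rcases hS.complete A hA t _ hC' i with h | ⟨h1, h2⟩
    · exact Or.inl (by rw [h, Option.map_some, hcell])
    · refine Or.inr ⟨by rw [h1, Option.map_none], ?_⟩
      rw [← hcell, h2]
      simp [TuringMachine.rename]

theorem inputRow_map (f : Γ → Γ') (c : ℕ) (left right : Finset (PlacedTile G))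
    (letter : Γ' → Finset (PlacedTile G)) (w : List Γ) :
    inputRow c left letter right (w.map f) = inputRow c left (letter ∘ f) right w := by
  simp only [inputRow, List.length_map]
  congr 2
  ext x
  simp only [Set.mem_iUnion]
  constructor
  · rintro ⟨k, hk⟩
    exact ⟨⟨k, by simpa using k.2⟩, by simpa using hk⟩
  · rintro ⟨k, hk⟩
    exact ⟨⟨k, by simp⟩, by simpa using hk⟩

end PolyTAM

open PolyTAM in
/-- For every Turing machine `M` there are a finite set `T` of domino tiles, a fixed way to spell
inputs as seed rows and a fixed local decoding, so that for every input `w` the temperature-1 system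
with tile set `T` whose seed spells `w` simulates `M` on `w`. -/
theorem mainTheorem8 {Q Γ : Type*} [Finite Q] [Finite Γ] (M : TuringMachine Q Γ) :
    ∃ (G : Type) (T : Set (PolyominoTile G)) (strength : G → ℕ) (c h : ℕ)
      (left right : Finset (PlacedTile G)) (letter : Γ → Finset (PlacedTile G))
      (dec : Set (PlacedTile G) → Option (Γ × Option Q)),
      (∀ t ∈ T, t.shape = horizontalDomino ∨ t.shape = verticalDomino) ∧ 0 < c ∧ 0 < h ∧
      ∀ w : List Γ, ∃ S : TAS G,
        S.tiles = T ∧ S.strength = strength ∧ S.temperature = 1 ∧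
        (S.seed : Set (PlacedTile G)) = inputRow c left letter right w ∧
        Simulates S M w c h dec := by
  -- Glues must form a `Type`, while `Q` and `Γ` may live in any universe. The construction is
  -- applied to a copy of `M` over `Fin n` and `Fin m`, and the decoding is translated back.
  obtain ⟨n, ⟨eQ⟩⟩ := Finite.exists_equiv_fin Q
  obtain ⟨m, ⟨eΓ⟩⟩ := Finite.exists_equiv_fin Γ
  let N := M.rename eQ eΓ
  refine ⟨_, Sweep.tiles N, fun _ => 1, 6 * (Sweep.machine N).K, 4, Sweep.leftEnd N,
    Sweep.rightEnd N, Sweep.letterBlock N ∘ eΓ, _, fun t ht => tileSet_domino ht,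
    Nat.mul_pos (by norm_num) (Sweep.machine N).K_pos, by norm_num,
    fun w => ⟨Sweep.system N (w.map eΓ), rfl, rfl, rfl, ?_,
      (Sweep.simulates N (w.map eΓ)).of_rename⟩⟩
  rw [← inputRow_map, ← Sweep.seed_eq_inputRow]
  simp [Sweep.system, Built.tas]
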